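/- **Notation.** For $0\le\sigma$ and $1\le\Lambda<\infty$ let $S_{\sigma,\Lambda}=\{k\in\mathbb R^3:\sigma\le|k|<\Lambda\}$ and let $$\mathfrak h=\{f\in L^2(S_{\sigma,\Lambda};\mathbb C^3):\ k\cdot f(k)=0 \text{ for a.e. } k\}$$ be the Hilbert space of square-integrable divergence-free vector fields in momentum space; $|k|$ denotes multiplication by $|k|$ on $\mathfrak h$. For $\alpha>0$ and real $\phi\in L^2(\mathbb R^3)$ let $\Theta_{\phi,\alpha}=\Phi_{\phi,\alpha}^*\Phi_{\phi,\alpha}\ge 0$ be the bounded operator on $\mathfrak h$ defined by $$(\Phi_{\phi,\alpha}f)(x)=\frac{\sqrt\alpha}{(2\pi)^{3/2}}\,\phi(x)\int_{S_{\sigma,\Lambda}}e^{ik\cdot x}f(k)\,d^3k ,$$ that is, the operator with integral kernel $\alpha(2\pi)^{-3}\big(\int\phi(x)^2e^{-i(k-k')\cdot x}d^3x\big)P_k^\perp P_{k'}^\perp$, where $P_k^\perp$ is the orthogonal projection onto the complement of $k$. For bounded $A\ge0$ on $\mathfrak h$ put $X(A)=\mathrm{Tr}\big(\sqrt{|k|^2+A}-|k|\big)\in[0,\infty]$.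 For $\beta>0$ define $$\widehat{\mathcal E}_{\alpha,\Lambda}(\phi)=\tfrac12\|\nabla\phi\|_2^2+\tfrac12X(2\Theta_{\phi,\alpha}),\qquad \mathcal F_\beta(\phi)=\tfrac12\|\nabla\phi\|_2^2+\beta\|\phi\|_1 ,$$ (the dependence of $\widehat{\mathcal E}_{\alpha,\Lambda}$ on $\sigma$ is suppressed) and, for $L>0$, let $Y_L$ be the set of $\phi\in H^1(\mathbb R^3)$ that vanish a.e. outside the ball $B(0,L)=\{|x|<L\}$. The Lieb–Loss energy, the auxiliary energy and their localized versions are $$E_{LL}(\alpha,\Lambda)=\inf\{\widehat{\mathcal E}_{\alpha,\Lambda}(\phi):\phi=|\phi|\in H^1(\mathbb R^3),\ \|\phi\|_2=1\},$$ $$E_{LL}^{(L)}(\alpha,\Lambda)=\inf\{\widehat{\mathcal E}_{\alpha,\Lambda}(\phi):\phi=|\phi|\in Y_L,\ \|\phi\|_2=1\},$$ $$F[\beta]=\inf\{\mathcal F_\beta(\phi):\phi=|\phi|\in H^1(\mathbb R^3)\cap L^1(\mathbb R^3),\ \|\phi\|_2=1\},$$ $$F^{(L)}[\beta]=\inf\{\mathcal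 F_\beta(\phi):\phi=|\phi|\in Y_L,\ \|\phi\|_2=1\}.$$ **Theorem.** There is a universal constant $C<\infty$ such that for all $\alpha,\beta,L>0$, $\sigma\ge0$ and $\Lambda\ge1$ these four infima are finite and $$E_{LL}^{(L)}(\alpha,\Lambda)-\frac{C}{L^2}\ \le\ E_{LL}(\alpha,\Lambda)\ \le\ E_{LL}^{(L)}(\alpha,\Lambda),\qquad F^{(L)}[\beta]-\frac{C}{L^2}\ \le\ F[\beta]\ \le\ F^{(L)}[\beta].$$ -/

import Mathlib

open MeasureTheory Set
open scoped ENNReal NNReal InnerProductSpace ContDiff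

namespace LiebLoss

/-- Euclidean space `ℝ³` (positions and momenta). -/
abbrev E3 : Type := EuclideanSpace ℝ (Fin 3)

/-- The Hermitian space `ℂ³ = ℂ ⊗ ℝ³`. -/
abbrev C3 : Type := EuclideanSpace ℂ (Fin 3)

/-- Real-valued square integrable functions on `ℝ³`. -/
abbrev L2R : Type := Lp ℝ 2 (volume : Measure E3)

/-! ### Sobolev spaces -/

/-- `G` is the weak (distributional) gradient of `φ`: for every real test function `ψ` and every
direction `v`, `∫ φ ∂ᵥψ = - ∫ (G · v) ψ`. -/
def HasWeakGradient (φ : L2R) (G : Lp E3 2 (volume : Measure E3)) : Prop :=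
  ∀ ψ : E3 → ℝ, ContDiff ℝ ∞ ψ → HasCompactSupport ψ → ∀ v : E3,
    ∫ x, φ x * fderiv ℝ ψ x v = - ∫ x, ⟪G x, v⟫_ℝ * ψ x

/-- `φ ∈ H¹(ℝ³)`: the weak gradient of `φ ∈ L²` exists and is square integrable. -/
def MemH1 (φ : L2R) : Prop := ∃ G, HasWeakGradient φ G

/-- `‖∇φ‖₂²`. The weak gradient of an `H¹` function is unique, so that the infimum runs over
a single value; it is `∞` if `φ ∉ H¹(ℝ³)`. -/
noncomputable def gradSq (φ : L2R) : ℝ≥0∞ :=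
  ⨅ (G : Lp E3 2 (volume : Measure E3)) (_ : HasWeakGradient φ G), ‖G‖ₑ ^ 2

/-- `φ ∈ Y_L`: a function in `H¹(ℝ³)` that vanishes (almost everywhere) outside the open ball
`B(0, L)`. -/
def MemY (L : ℝ) (φ : L2R) : Prop :=
  MemH1 φ ∧ ∀ᵐ x ∂(volume : Measure E3), x ∉ Metric.ball (0 : E3) L → φ x = 0

/-! ### The one-photon space -/

/-- The momentum shell `σ ≤ |k| < Λ`. -/
def shell (σ Λ : ℝ) : Set E3 := {k | σ ≤ ‖k‖ ∧ ‖k‖ < Λ}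

/-- `ℂ³`-valued square integrable vector fields on the momentum shell. -/
abbrev L2Shell (σ Λ : ℝ) : Type := Lp C3 2 ((volume : Measure E3).restrict (shell σ Λ))

/-- The one-photon Hilbert space: the square integrable, divergence-free (that is,
`k · f(k) = 0`) vector fields supported in the momentum shell. -/
def photonSpace (σ Λ : ℝ) : Submodule ℂ (L2Shell σ Λ) where
  carrier := {f | ∀ᵐ k ∂((volume : Measure E3).restrict (shell σ Λ)),
    ∑ i, (k i : ℂ) * f k i = 0}
  zero_mem' := by
    filter_upwards [Lp.coeFn_zero C3 2 ((volume : Measure E3).restrict (shell σ Λ))] with k hk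
    rw [hk]
    simp
  add_mem' := by
    intro f g hf hg
    filter_upwards [hf, hg, Lp.coeFn_add f g] with k h1 h2 h3
    rw [h3]
    simp [mul_add, Finset.sum_add_distrib, h1, h2]
  smul_mem' := by
    intro c f hf
    filter_upwards [hf, Lp.coeFn_smul c f] with k h1 h2
    have : ∀ i, (k i : ℂ) * (c * f k i) = c * ((k i : ℂ) * f k i) := fun i => by ring
    rw [h2]
    simp [this, ← Finset.mul_sum, h1]

theorem isClosed_photonSpace (σ Λ : ℝ) : IsClosed (photonSpace σ Λ : Set (L2Shell σ Λ)) := by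
  refine isClosed_of_closure_subset fun f hf => ?_
  obtain ⟨u, hu, hlim⟩ := mem_closure_iff_seq_limit.1 hf
  obtain ⟨ns, -, hns⟩ := (tendstoInMeasure_of_tendsto_Lp hlim).exists_seq_tendsto_ae
  have hall : ∀ᵐ k ∂((volume : Measure E3).restrict (shell σ Λ)),
      ∀ n, ∑ i, (k i : ℂ) * u n k i = 0 := ae_all_iff.2 fun n => hu n
  change ∀ᵐ k ∂((volume : Measure E3).restrict (shell σ Λ)), ∑ i, (k i : ℂ) * f k i = 0
  filter_upwards [hns, hall] with k h1 h2
  have hc : Continuous fun y : C3 => ∑ i, (k i : ℂ) * y i := by fun_prop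
  have h3 := (hc.tendsto (f k)).comp h1
  refine tendsto_nhds_unique h3 ?_
  simp [Function.comp_def, h2]

instance (σ Λ : ℝ) : CompleteSpace (photonSpace σ Λ) :=
  (isClosed_photonSpace σ Λ).completeSpace_coe

theorem measurableSet_shell (σ Λ : ℝ) : MeasurableSet (shell σ Λ) :=
  (measurableSet_le measurable_const measurable_norm).inter
    (measurableSet_lt measurable_norm measurable_const)

theorem volume_shell_lt_top (σ Λ : ℝ) : (volume : Measure E3) (shell σ Λ) < ⊤ :=
  (measure_mono fun _ hk => mem_ball_zero_iff.2 hk.2).trans_lt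
    (measure_ball_lt_top (x := (0 : E3)) (r := Λ))

instance (σ Λ : ℝ) : IsFiniteMeasure ((volume : Measure E3).restrict (shell σ Λ)) :=
  ⟨by simpa using volume_shell_lt_top σ Λ⟩

/-! ### The multiplication operator `|k|` -/

theorem ae_norm_smul_le (σ Λ : ℝ) (f : L2Shell σ Λ) :
    ∀ᵐ k ∂((volume : Measure E3).restrict (shell σ Λ)),
      ‖((‖k‖ : ℝ) : ℂ) • f k‖ ≤ |Λ| * ‖f k‖ := by
  filter_upwards [ae_restrict_mem (measurableSet_shell σ Λ)] with k hk
  rw [norm_smul]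
  gcongr
  simpa using hk.2.le.trans (le_abs_self Λ)

theorem memLp_norm_smul (σ Λ : ℝ) (f : L2Shell σ Λ) :
    MemLp (fun k : E3 => ((‖k‖ : ℝ) : ℂ) • f k) 2
      ((volume : Measure E3).restrict (shell σ Λ)) :=
  (Lp.memLp f).of_le_mul
    ((by fun_prop : Continuous fun k : E3 => ((‖k‖ : ℝ) : ℂ)).aestronglyMeasurable.smul
      (Lp.aestronglyMeasurable f))
    (ae_norm_smul_le σ Λ f)

/-- The multiplication operator `[|k| f](k) = |k| f(k)` on the one-photon space. -/
noncomputable def absK (σ Λ : ℝ) : photonSpace σ Λ →L[ℂ] photonSpace σ Λ :=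
  LinearMap.mkContinuous
    { toFun := fun f => ⟨(memLp_norm_smul σ Λ f.1).toLp _, by
        change ∀ᵐ k ∂((volume : Measure E3).restrict (shell σ Λ)), _
        filter_upwards [(memLp_norm_smul σ Λ f.1).coeFn_toLp, f.2] with k h1 h2
        have : ∀ i, (k i : ℂ) * (((‖k‖ : ℝ) : ℂ) * f.1 k i)
          = ((‖k‖ : ℝ) : ℂ) * ((k i : ℂ) * f.1 k i) := fun i => by ring
        simp only [h1, PiLp.smul_apply, smul_eq_mul, this, ← Finset.mul_sum, h2, mul_zero]⟩
      map_add' := by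
        intro f g
        apply Subtype.ext
        apply Lp.ext
        filter_upwards [(memLp_norm_smul σ Λ (f + g).1).coeFn_toLp,
          (memLp_norm_smul σ Λ f.1).coeFn_toLp, (memLp_norm_smul σ Λ g.1).coeFn_toLp,
          Lp.coeFn_add f.1 g.1, Lp.coeFn_add ((memLp_norm_smul σ Λ f.1).toLp _)
            ((memLp_norm_smul σ Λ g.1).toLp _)] with k h1 h2 h3 h4 h5
        simp only [Submodule.coe_add] at h1 ⊢
        rw [h1, h5, Pi.add_apply, h2, h3, h4, Pi.add_apply, smul_add]
      map_smul' := by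
        intro c f
        apply Subtype.ext
        apply Lp.ext
        filter_upwards [(memLp_norm_smul σ Λ (c • f).1).coeFn_toLp,
          (memLp_norm_smul σ Λ f.1).coeFn_toLp, Lp.coeFn_smul c f.1,
          Lp.coeFn_smul c ((memLp_norm_smul σ Λ f.1).toLp _)] with k h1 h2 h3 h4
        simp only [Submodule.coe_smul, RingHom.id_apply] at h1 ⊢
        rw [h1, h4, Pi.smul_apply, h2, h3, Pi.smul_apply, smul_comm] }
    |Λ| (by
      intro f
      refine Lp.norm_le_mul_norm_of_ae_le_mul (f := (memLp_norm_smul σ Λ f.1).toLp _) (g := f.1) ?_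
      filter_upwards [(memLp_norm_smul σ Λ f.1).coeFn_toLp, ae_norm_smul_le σ Λ f.1] with k h1 h2
      rwa [h1])

/-! ### The operators `Φ` and `Θ` -/

/-- The inverse Fourier transform `(2π)^(-3/2) ∫_{σ ≤ |k| < Λ} e^{i k·x} f(k) dk` of a vector field
supported in the momentum shell. -/
noncomputable def synth (σ Λ : ℝ) (f : L2Shell σ Λ) (x : E3) : C3 :=
  (((2 * Real.pi) ^ (-(3 / 2) : ℝ) : ℝ) : ℂ) •
    ∫ k in shell σ Λ, Complex.exp (Complex.I * ((⟪k, x⟫_ℝ : ℝ) : ℂ)) • f k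

theorem integrable_L2Shell {σ Λ : ℝ} (f : L2Shell σ Λ) :
    Integrable f ((volume : Measure E3).restrict (shell σ Λ)) :=
  (Lp.memLp f).integrable (by norm_num)

theorem norm_phase (k x : E3) : ‖Complex.exp (Complex.I * ((⟪k, x⟫_ℝ : ℝ) : ℂ))‖ = 1 := by
  rw [mul_comm]; exact Complex.norm_exp_ofReal_mul_I _

theorem integrable_phase_smul {σ Λ : ℝ} (f : L2Shell σ Λ) (x : E3) :
    Integrable (fun k : E3 => Complex.exp (Complex.I * ((⟪k, x⟫_ℝ : ℝ) : ℂ)) • f k)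
      ((volume : Measure E3).restrict (shell σ Λ)) :=
  (integrable_L2Shell f).mono
    ((by fun_prop : Continuous fun k : E3 =>
      Complex.exp (Complex.I * ((⟪k, x⟫_ℝ : ℝ) : ℂ))).aestronglyMeasurable.smul
      (Lp.aestronglyMeasurable f))
    (Filter.Eventually.of_forall fun k => by rw [norm_smul, norm_phase, one_mul])

theorem synth_add {σ Λ : ℝ} (f g : L2Shell σ Λ) (x : E3) :
    synth σ Λ (f + g) x = synth σ Λ f x + synth σ Λ g x := by
  simp only [synth]
  rw [← smul_add, ← integral_add (integrable_phase_smul f x) (integrable_phase_smul g x)]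
  congr 1
  refine integral_congr_ae ?_
  filter_upwards [Lp.coeFn_add f g] with k hk
  rw [hk, Pi.add_apply, smul_add]

theorem synth_smul {σ Λ : ℝ} (c : ℂ) (f : L2Shell σ Λ) (x : E3) :
    synth σ Λ (c • f) x = c • synth σ Λ f x := by
  simp only [synth]
  rw [smul_comm c, ← integral_smul c (fun k : E3 =>
    Complex.exp (Complex.I * ((⟪k, x⟫_ℝ : ℝ) : ℂ)) • f k)]
  congr 1
  refine integral_congr_ae ?_
  filter_upwards [Lp.coeFn_smul c f] with k hk
  rw [hk, Pi.smul_apply, smul_comm]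

theorem continuous_synth {σ Λ : ℝ} (f : L2Shell σ Λ) : Continuous (synth σ Λ f) := by
  have h : Continuous fun x : E3 =>
      ∫ k in shell σ Λ, Complex.exp (Complex.I * ((⟪k, x⟫_ℝ : ℝ) : ℂ)) • f k := ?_
  · exact h.const_smul (((2 * Real.pi) ^ (-(3 / 2) : ℝ) : ℝ) : ℂ)
  refine continuous_of_dominated (bound := fun k => ‖f k‖)
    (fun x => (integrable_phase_smul f x).aestronglyMeasurable)
    (fun x => Filter.Eventually.of_forall fun k => by rw [norm_smul, norm_phase, one_mul])
    (integrable_L2Shell f).norm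
    (Filter.Eventually.of_forall fun k => by fun_prop)

theorem exists_norm_synth_le (σ Λ : ℝ) :
    ∃ M : ℝ, 0 ≤ M ∧ ∀ (f : L2Shell σ Λ) (x : E3), ‖synth σ Λ f x‖ ≤ M * ‖f‖ := by
  set μ := (volume : Measure E3).restrict (shell σ Λ) with hμ
  refine ⟨(2 * Real.pi) ^ (-(3 / 2) : ℝ) * (μ univ ^ (1 / 2 : ℝ)).toReal, by positivity,
    fun f x => ?_⟩
  have hfin : μ univ ^ (1 / 2 : ℝ) ≠ ⊤ :=
    ENNReal.rpow_ne_top_of_nonneg (by norm_num) (measure_ne_top μ univ)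
  have h1 : ∫ k, ‖f k‖ ∂μ ≤ (μ univ ^ (1 / 2 : ℝ)).toReal * ‖f‖ := by
    rw [integral_norm_eq_lintegral_enorm (Lp.aestronglyMeasurable f),
      ← eLpNorm_one_eq_lintegral_enorm, Lp.norm_def, ← ENNReal.toReal_mul]
    refine ENNReal.toReal_mono (ENNReal.mul_ne_top hfin (Lp.eLpNorm_ne_top f)) ?_
    have := eLpNorm_le_eLpNorm_mul_rpow_measure_univ (μ := μ) (p := 1) (q := 2) (by norm_num)
      (Lp.aestronglyMeasurable f)
    rw [mul_comm]
    refine this.trans (le_of_eq ?_)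
    norm_num
    rfl
  have h2 : ‖∫ k, Complex.exp (Complex.I * ((⟪k, x⟫_ℝ : ℝ) : ℂ)) • f k ∂μ‖ ≤ ∫ k, ‖f k‖ ∂μ := by
    refine (norm_integral_le_integral_norm _).trans (le_of_eq ?_)
    simp only [norm_smul, norm_phase, one_mul]
  rw [synth, norm_smul, Complex.norm_of_nonneg (by positivity), mul_assoc]
  exact mul_le_mul_of_nonneg_left (h2.trans h1) (by positivity)

theorem ae_norm_smul_synth_le {σ Λ M : ℝ} (φ : L2R) (f : L2Shell σ Λ)
    (hM : ∀ x, ‖synth σ Λ f x‖ ≤ M * ‖f‖) :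
    ∀ᵐ x ∂(volume : Measure E3), ‖(φ x : ℂ) • synth σ Λ f x‖ ≤ (M * ‖f‖) * ‖φ x‖ := by
  refine Filter.Eventually.of_forall fun x => ?_
  rw [norm_smul, Complex.norm_real, mul_comm]
  exact mul_le_mul_of_nonneg_right (hM x) (norm_nonneg _)

theorem memLp_smul_synth {σ Λ : ℝ} (φ : L2R) (f : L2Shell σ Λ) :
    MemLp (fun x : E3 => (φ x : ℂ) • synth σ Λ f x) 2 volume := by
  obtain ⟨M, -, hM⟩ := exists_norm_synth_le σ Λ
  exact (Lp.memLp φ).of_le_mul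
    ((Complex.continuous_ofReal.comp_aestronglyMeasurable (Lp.aestronglyMeasurable φ)).smul
      (continuous_synth f).aestronglyMeasurable)
    (ae_norm_smul_synth_le φ f (hM f))

/-- The operator `f ↦ φ(x) · f̌(x)` from the one-photon space to `L²(ℝ³; ℂ³)`, where `f̌` is the
inverse Fourier transform of `f`. In momentum space this is `(2π)^(-3/2)` times the convolution
with the (unitary) Fourier transform of `φ`. -/
noncomputable def mulSynth (σ Λ : ℝ) (φ : L2R) :
    photonSpace σ Λ →L[ℂ] Lp C3 2 (volume : Measure E3) :=
  LinearMap.mkContinuousOfExistsBound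
    { toFun := fun f => (memLp_smul_synth φ f.1).toLp _
      map_add' := by
        intro f g
        rw [← MemLp.toLp_add]
        refine MemLp.toLp_congr _ _ (Filter.Eventually.of_forall fun x => ?_)
        simp [synth_add]
      map_smul' := by
        intro c f
        rw [RingHom.id_apply, ← MemLp.toLp_const_smul]
        refine MemLp.toLp_congr _ _ (Filter.Eventually.of_forall fun x => ?_)
        simp only [Submodule.coe_smul, synth_smul, Pi.smul_apply]
        rw [smul_comm] }
    (by
      obtain ⟨M, hM0, hM⟩ := exists_norm_synth_le σ Λ
      refine ⟨M * ‖φ‖, fun f => ?_⟩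
      have h : ‖(memLp_smul_synth φ f.1).toLp _‖ ≤ (M * ‖f.1‖) * ‖φ‖ := by
        refine Lp.norm_le_mul_norm_of_ae_le_mul ?_
        filter_upwards [(memLp_smul_synth φ f.1).coeFn_toLp,
          ae_norm_smul_synth_le φ f.1 (hM f.1)] with x h1 h2
        rwa [h1]
      refine h.trans (le_of_eq ?_)
      rw [Submodule.coe_norm]; ring)

/-- The operator `Φ_{φ,α} = √α (2π)^(-3/2) (φ̂ *) P_C χ_{σ,Λ}`, with its values expressed in
position space. -/
noncomputable def Phi (α σ Λ : ℝ) (φ : L2R) :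
    photonSpace σ Λ →L[ℂ] Lp C3 2 (volume : Measure E3) :=
  ((Real.sqrt α : ℝ) : ℂ) • mulSynth σ Λ φ

/-- The nonnegative operator `Θ_{φ,α} = Φ_{φ,α}* Φ_{φ,α}` on the one-photon space. Its integral
kernel is `α (2π)⁻³ (∫ φ(x)² e^{-i(k-k')·x} dx) P_k^⊥ P_{k'}^⊥`. -/
noncomputable def Theta (α σ Λ : ℝ) (φ : L2R) : photonSpace σ Λ →L[ℂ] photonSpace σ Λ :=
  (ContinuousLinearMap.adjoint (Phi α σ Λ φ)).comp (Phi α σ Λ φ)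

/-! ### The trace and the functional `X` -/

/-- The trace of a nonnegative bounded operator on a Hilbert space, as an element of `[0, ∞]`: the
sum of the diagonal matrix elements in an orthonormal basis (the value does not depend on the
basis). It is used for nonnegative operators only. -/
noncomputable def posTrace {H : Type*} [NormedAddCommGroup H] [InnerProductSpace ℂ H]
    [CompleteSpace H] (T : H →L[ℂ] H) : ℝ≥0∞ :=
  ∑' i, ENNReal.ofReal
    (⟪(exists_hilbertBasis ℂ H).choose_spec.choose i,
      T ((exists_hilbertBasis ℂ H).choose_spec.choose i)⟫_ℂ).re

/-- `Tr(√(K² + A) - K)` for nonnegative bounded operators `K` and `A` on a Hilbert space. The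
operator under the trace is nonnegative since the square root is operator monotone. -/
noncomputable def traceSqrtSub {H : Type*} [NormedAddCommGroup H] [InnerProductSpace ℂ H]
    [CompleteSpace H] (K A : H →L[ℂ] H) : ℝ≥0∞ :=
  posTrace (CFC.sqrt (K ^ 2 + A) - K)

/-- `X(A) = Tr(√(|k|² + A) - |k|)` for a nonnegative operator `A` on the one-photon space. -/
noncomputable def X (σ Λ : ℝ) (A : photonSpace σ Λ →L[ℂ] photonSpace σ Λ) : ℝ≥0∞ :=
  traceSqrtSub (absK σ Λ) A

/-! ### The energy functionals and their infima -/

/-- The Lieb-Loss functional `½ ‖∇φ‖₂² + ½ X(2 Θ_{φ,α})`. -/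
noncomputable def effEnergy (α σ Λ : ℝ) (φ : L2R) : ℝ≥0∞ :=
  gradSq φ / 2 + X σ Λ ((2 : ℂ) • Theta α σ Λ φ) / 2

/-- The Lieb-Loss energy: infimum over `φ = |φ| ∈ H¹(ℝ³)` with `‖φ‖₂ = 1`. -/
noncomputable def ELL (α σ Λ : ℝ) : ℝ≥0∞ :=
  ⨅ (φ : L2R) (_ : φ = |φ| ∧ MemH1 φ ∧ ‖φ‖ = 1), effEnergy α σ Λ φ

/-- The localized Lieb-Loss energy: infimum over `φ = |φ| ∈ Y_L` with `‖φ‖₂ = 1`. -/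
noncomputable def ELLLoc (L α σ Λ : ℝ) : ℝ≥0∞ :=
  ⨅ (φ : L2R) (_ : φ = |φ| ∧ MemY L φ ∧ ‖φ‖ = 1), effEnergy α σ Λ φ

/-- The auxiliary functional `½ ‖∇φ‖₂² + β ‖φ‖₁`. -/
noncomputable def auxEnergy (β : ℝ) (φ : L2R) : ℝ≥0∞ :=
  gradSq φ / 2 + ENNReal.ofReal β * eLpNorm φ 1 (volume : Measure E3)

/-- The infimum `F[β]` over `φ = |φ| ∈ H¹(ℝ³) ∩ L¹(ℝ³)` with `‖φ‖₂ = 1`. -/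
noncomputable def auxF (β : ℝ) : ℝ≥0∞ :=
  ⨅ (φ : L2R) (_ : φ = |φ| ∧ MemH1 φ ∧ MemLp φ 1 (volume : Measure E3) ∧ ‖φ‖ = 1),
    auxEnergy β φ

/-- The infimum `F^{(L)}[β]` over `φ = |φ| ∈ Y_L` with `‖φ‖₂ = 1`. -/
noncomputable def auxFLoc (L β : ℝ) : ℝ≥0∞ :=
  ⨅ (φ : L2R) (_ : φ = |φ| ∧ MemY L φ ∧ ‖φ‖ = 1), auxEnergy β φ

end LiebLoss

/-! The upper bounds are inclusions of classes of trial functions. The lower bounds cut trial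
functions off at scale `L` at a cost `C / L ^ 2`, by different mechanisms for the two energies.

Lieb–Loss energy. Take a smooth `b ≥ 0` supported in the ball of radius `L` with `∫ b² = 1`, and
average over `y` the normalized functions `b(· - y) φ` with weight `‖b(· - y) φ‖²`, a probability
density. The averaged kinetic energy is exactly `‖∇φ‖² + ‖∇b‖²`, because the cross term is a total
derivative. Since `Θ_φ` is linear in `φ²`, the average of the operators is `Θ_φ`. The map `A ↦ √(K²
+ A) - K` is operator concave, so Jensen's inequality, applied to each diagonal matrix element,
shows that the averaged `X` does not exceed `X(2Θ_φ)` (`lintegral_X_cutoff_le`). Momentum phases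
implement translations unitarily and commute with `|k|`, so each piece may be recentred
(`X_Theta_translate`). This gives the constant `‖∇b‖² / 2`. The trace is finite because `T = √(K² +
A) - K` satisfies `K T + T K ≤ A`. Hence `Tr T` is at most the trace of `∫ e^{-sK} A e^{-sK} ds`,
which is controlled by `∫ dk / |k|` over the shell (`X_Theta_ne_top`).

Auxiliary energy. The normalized term `‖φ‖₁ / ‖φ‖₂` is not additive under such averages: splitting
`φ` into pieces of small mass is penalized. Scaling reduces to `β = 1`. If no ball of radius `ℓ`
carried nearly all the mass of an almost minimizer, testing the variational principle with its
translated cutoffs would give a strictly better lower bound for its energy, a contradiction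
(`exists_concentration`). An almost minimizer is then split by a quadratic partition of unity into
an inner and an outer piece (`exists_truncation`), with gradient error `O(ℓ⁻²)`. A first splitting
shows that the `L¹` tail is small. After a second one at twice the radius, Nash's inequality shows
that the outer piece costs at least `F + 1` per unit of mass (`le_of_nash`), which is more than `F`.
Renormalizing the inner piece is therefore free (`le_of_gain`), and only the gradient error remains.
-/

namespace LiebLoss

open scoped Gradient

/-! ### Weak gradients of square integrable functions -/

/-- `f` and `G` are square integrable and `G` is the weak gradient of `f`. -/
structure IsWeakGrad (f : E3 → ℝ) (G : E3 → E3) : Prop where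
  memLp_fun : MemLp f 2 volume
  memLp_grad : MemLp G 2 volume
  integral_eq : ∀ ψ : E3 → ℝ, ContDiff ℝ ∞ ψ → HasCompactSupport ψ → ∀ v : E3,
    ∫ x, f x * fderiv ℝ ψ x v = - ∫ x, ⟪G x, v⟫_ℝ * ψ x

theorem HasWeakGradient.isWeakGrad {φ : L2R} {G : Lp E3 2 (volume : Measure E3)}
    (h : HasWeakGradient φ G) : IsWeakGrad φ G :=
  ⟨Lp.memLp φ, Lp.memLp G, h⟩

theorem IsWeakGrad.hasWeakGradient {f : E3 → ℝ} {G : E3 → E3} (h : IsWeakGrad f G) :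
    HasWeakGradient (h.memLp_fun.toLp f) (h.memLp_grad.toLp G) := by
  intro ψ hψ hc v
  have h1 : ∫ x, (h.memLp_fun.toLp f) x * fderiv ℝ ψ x v = ∫ x, f x * fderiv ℝ ψ x v := by
    refine integral_congr_ae ?_
    filter_upwards [h.memLp_fun.coeFn_toLp] with x hx
    rw [hx]
  have h2 : ∫ x, ⟪(h.memLp_grad.toLp G) x, v⟫_ℝ * ψ x = ∫ x, ⟪G x, v⟫_ℝ * ψ x := by
    refine integral_congr_ae ?_
    filter_upwards [h.memLp_grad.coeFn_toLp] with x hx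
    rw [hx]
  rw [h1, h2, h.integral_eq ψ hψ hc v]

theorem fderiv_eq_inner_gradient (η : E3 → ℝ) (x v : E3) : fderiv ℝ η x v = ⟪∇ η x, v⟫_ℝ := by
  rw [gradient, InnerProductSpace.toDual_symm_apply]

theorem _root_.ContDiff.continuous_gradient {η : E3 → ℝ} (h : ContDiff ℝ ∞ η) :
    Continuous (∇ η) :=
  (InnerProductSpace.toDual ℝ E3).symm.continuous.comp (h.continuous_fderiv (by simp))

theorem memLp_test {ψ : E3 → ℝ} (hψ : ContDiff ℝ ∞ ψ) (hc : HasCompactSupport ψ) :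
    MemLp ψ 2 (volume : Measure E3) :=
  hψ.continuous.memLp_of_hasCompactSupport hc

theorem memLp_fderiv_test {ψ : E3 → ℝ} (hψ : ContDiff ℝ ∞ ψ) (hc : HasCompactSupport ψ) (v : E3) :
    MemLp (fun x => fderiv ℝ ψ x v) 2 (volume : Measure E3) :=
  ((hψ.continuous_fderiv (by simp)).clm_apply continuous_const).memLp_of_hasCompactSupport
    (hc.fderiv_apply ℝ v)

theorem _root_.MeasureTheory.MemLp.inner_vec {G : E3 → E3} (hG : MemLp G 2 volume) (v : E3) :
    MemLp (fun x => ⟪G x, v⟫_ℝ) 2 volume := hG.inner_const v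

/-- Multiplication by a bounded smooth function with bounded gradient. -/
theorem IsWeakGrad.mul_smooth {f : E3 → ℝ} {G : E3 → E3} (h : IsWeakGrad f G) {η : E3 → ℝ} {C : ℝ}
    (hη : ContDiff ℝ ∞ η) (hb : ∀ x, |η x| ≤ C) (hb' : ∀ x, ‖∇ η x‖ ≤ C) :
    IsWeakGrad (fun x => η x * f x) (fun x => η x • G x + f x • ∇ η x) := by
  have m1 : MemLp (fun x => η x * f x) 2 (volume : Measure E3) :=
    h.memLp_fun.of_le_mul (hη.continuous.aestronglyMeasurable.mul h.memLp_fun.1)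
      (Filter.Eventually.of_forall fun x => by
        rw [norm_mul]; exact mul_le_mul_of_nonneg_right (hb x) (norm_nonneg _))
  have m2 : MemLp (fun x => η x • G x) 2 (volume : Measure E3) :=
    h.memLp_grad.of_le_mul (hη.continuous.aestronglyMeasurable.smul h.memLp_grad.1)
      (Filter.Eventually.of_forall fun x => by
        rw [norm_smul]; exact mul_le_mul_of_nonneg_right (hb x) (norm_nonneg _))
  have m3 : MemLp (fun x => f x • ∇ η x) 2 (volume : Measure E3) :=
    h.memLp_fun.of_le_mul (h.memLp_fun.1.smul hη.continuous_gradient.aestronglyMeasurable)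
      (Filter.Eventually.of_forall fun x => by
        rw [norm_smul, mul_comm]; exact mul_le_mul_of_nonneg_right (hb' x) (norm_nonneg _))
  refine ⟨m1, m2.add m3, fun ψ hψ hc v => ?_⟩
  have hp : ContDiff ℝ ∞ (fun x => η x * ψ x) := hη.mul hψ
  have hpc : HasCompactSupport (fun x => η x * ψ x) := hc.mul_left
  have hd : ∀ x, fderiv ℝ (fun x => η x * ψ x) x v = η x * fderiv ℝ ψ x v + ψ x * ⟪∇ η x, v⟫_ℝ := by
    intro x
    rw [fderiv_fun_mul (hη.differentiable (by simp) x) (hψ.differentiable (by simp) x)]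
    simp
  have key := h.integral_eq _ hp hpc v
  simp only [hd] at key
  have i1 : Integrable (fun x => η x * f x * fderiv ℝ ψ x v) (volume : Measure E3) :=
    m1.integrable_mul (memLp_fderiv_test hψ hc v)
  have i3 : Integrable (fun x => ⟪f x • ∇ η x, v⟫_ℝ * ψ x) (volume : Measure E3) :=
    (m3.inner_vec v).integrable_mul (memLp_test hψ hc)
  have i2 : Integrable (fun x => ⟪η x • G x, v⟫_ℝ * ψ x) (volume : Measure E3) :=
    (m2.inner_vec v).integrable_mul (memLp_test hψ hc)
  have e1 : ∫ x, f x * (η x * fderiv ℝ ψ x v + ψ x * ⟪∇ η x, v⟫_ℝ)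
      = (∫ x, η x * f x * fderiv ℝ ψ x v) + ∫ x, ⟪f x • ∇ η x, v⟫_ℝ * ψ x := by
    rw [← integral_add i1 i3]
    refine integral_congr_ae (Filter.Eventually.of_forall fun x => ?_)
    simp only [real_inner_smul_left]
    ring
  have e2 : ∫ x, ⟪G x, v⟫_ℝ * (η x * ψ x) = ∫ x, ⟪η x • G x, v⟫_ℝ * ψ x := by
    refine integral_congr_ae (Filter.Eventually.of_forall fun x => ?_)
    simp only [real_inner_smul_left]
    ring
  have e3 : ∫ x, ⟪η x • G x + f x • ∇ η x, v⟫_ℝ * ψ x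
      = (∫ x, ⟪η x • G x, v⟫_ℝ * ψ x) + ∫ x, ⟪f x • ∇ η x, v⟫_ℝ * ψ x := by
    rw [← integral_add i2 i3]
    refine integral_congr_ae (Filter.Eventually.of_forall fun x => ?_)
    simp only [inner_add_left]
    ring
  rw [e1, e2] at key
  rw [e3]
  linarith

theorem IsWeakGrad.const_mul {f : E3 → ℝ} {G : E3 → E3} (h : IsWeakGrad f G) (c : ℝ) :
    IsWeakGrad (fun x => c * f x) (fun x => c • G x) := by
  refine ⟨h.memLp_fun.const_mul c, h.memLp_grad.const_smul c, fun ψ hψ hc v => ?_⟩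
  simp only [mul_assoc, real_inner_smul_left, integral_const_mul, h.integral_eq ψ hψ hc v, mul_neg]

/-- The Jacobian formula for an affine change of variables in `ℝ³`. -/
theorem integral_comp_affine {F : Type*} [NormedAddCommGroup F] [NormedSpace ℝ F] (g : E3 → F)
    {l : ℝ} (hl : 0 < l) (a : E3) :
    ∫ x, g (l • x + a) = (l ^ 3)⁻¹ • ∫ x, g x := by
  have := Measure.integral_comp_smul (volume : Measure E3) (fun x => g (x + a)) l
  rw [this, integral_add_right_eq_self g a]
  simp [abs_of_pos, hl]

theorem map_affine {l : ℝ} (hl : 0 < l) (a : E3) :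
    Measure.map (fun x : E3 => l • x + a) volume = ENNReal.ofReal (l ^ 3)⁻¹ • volume := by
  have h1 : Measure.map (fun x : E3 => l • x) volume = ENNReal.ofReal (l ^ 3)⁻¹ • volume := by
    rw [Measure.map_addHaar_smul volume hl.ne']
    simp [abs_of_pos, hl]
  have h2 : (fun x : E3 => l • x + a) = (fun x => x + a) ∘ (fun x => l • x) := rfl
  rw [h2, ← Measure.map_map (by fun_prop) (by fun_prop), h1, Measure.map_smul,
    map_add_right_eq_self]

theorem lintegral_comp_affine {g : E3 → ℝ≥0∞} (hg : AEMeasurable g volume)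
    {l : ℝ} (hl : 0 < l) (a : E3) :
    ∫⁻ x, g (l • x + a) = ENNReal.ofReal (l ^ 3)⁻¹ * ∫⁻ x, g x := by
  have hm := map_affine hl a
  have hg' : AEMeasurable g (Measure.map (fun x : E3 => l • x + a) volume) := by
    rw [hm]; exact hg.smul_measure _
  rw [← lintegral_map' hg' (by fun_prop), hm, lintegral_smul_measure, smul_eq_mul]

theorem quasiMeasurePreserving_affine {l : ℝ} (hl : 0 < l) (a : E3) :
    Measure.QuasiMeasurePreserving (fun x : E3 => l • x + a) volume volume :=
  ⟨by fun_prop, by rw [map_affine hl a]; exact Measure.smul_absolutelyContinuous⟩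

theorem _root_.MeasureTheory.MemLp.comp_affine {F : Type*} [NormedAddCommGroup F]
    {g : E3 → F} {p : ℝ≥0∞} (hg : MemLp g p volume) {l : ℝ} (hl : 0 < l) (a : E3) :
    MemLp (fun x => g (l • x + a)) p volume := by
  have h : MemLp g p (Measure.map (fun x : E3 => l • x + a) volume) := by
    rw [map_affine hl a]; exact hg.smul_measure ENNReal.ofReal_ne_top
  exact h.comp_of_map (by fun_prop)

/-- Weak gradients and affine changes of variables. -/
theorem IsWeakGrad.comp_affine {f : E3 → ℝ} {G : E3 → E3} (h : IsWeakGrad f G)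
    {l : ℝ} (hl : 0 < l) (a : E3) :
    IsWeakGrad (fun x => f (l • x + a)) (fun x => l • G (l • x + a)) := by
  refine ⟨h.memLp_fun.comp_affine hl a, (h.memLp_grad.comp_affine hl a).const_smul l,
    fun ψ hψ hc v => ?_⟩
  set ψ' : E3 → ℝ := fun x => ψ (l⁻¹ • (x - a)) with hψ'
  have hl' : l ≠ 0 := hl.ne'
  have hinv : ∀ x, ψ' (l • x + a) = ψ x := fun x => by simp [hψ', smul_smul, hl']
  have hs : ContDiff ℝ ∞ ψ' := hψ.comp (by fun_prop)
  let e : E3 ≃ₜ E3 := (Homeomorph.addRight (-a)).trans (Homeomorph.smulOfNeZero l⁻¹ (inv_ne_zero hl'))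
  have hcs : HasCompactSupport ψ' := by
    have h3 := hc.comp_homeomorph e
    convert h3 using 1
    ext x
    simp [hψ', e, sub_eq_add_neg, Homeomorph.smulOfNeZero]
  have hder : ∀ x, fderiv ℝ ψ x v = l * fderiv ℝ ψ' (l • x + a) v := by
    intro x
    have h1 : HasFDerivAt (fun x : E3 => l • x + a) (l • ContinuousLinearMap.id ℝ E3) x :=
      ((hasFDerivAt_id x).const_smul l).add_const a
    have h2 : HasFDerivAt ψ' (fderiv ℝ ψ' (l • x + a)) (l • x + a) :=
      (hs.differentiable (by simp) _).hasFDerivAt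
    have h3 := h2.comp x h1
    have h4 : ψ' ∘ (fun x : E3 => l • x + a) = ψ := funext hinv
    rw [h4] at h3
    rw [h3.fderiv]
    simp
  have key := h.integral_eq ψ' hs hcs v
  have e1 : ∫ x, f (l • x + a) * fderiv ℝ ψ x v
      = (l ^ 3)⁻¹ * (l * ∫ x, f x * fderiv ℝ ψ' x v) := by
    have := integral_comp_affine (fun x => f x * fderiv ℝ ψ' x v) hl a
    rw [smul_eq_mul] at this
    rw [mul_left_comm, ← this, ← integral_const_mul]
    refine integral_congr_ae (Filter.Eventually.of_forall fun x => ?_)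
    simp only [hder]; ring
  have e2 : ∫ x, ⟪l • G (l • x + a), v⟫_ℝ * ψ x
      = (l ^ 3)⁻¹ * (l * ∫ x, ⟪G x, v⟫_ℝ * ψ' x) := by
    have := integral_comp_affine (fun x => ⟪G x, v⟫_ℝ * ψ' x) hl a
    rw [smul_eq_mul] at this
    rw [mul_left_comm, ← this, ← integral_const_mul]
    refine integral_congr_ae (Filter.Eventually.of_forall fun x => ?_)
    simp only [hinv, real_inner_smul_left]; ring
  rw [e1, e2, key]; ring

/-- The classical gradient of a test function is its weak gradient. -/
theorem isWeakGrad_of_contDiff {f : E3 → ℝ} (hf : ContDiff ℝ ∞ f) (hc : HasCompactSupport f) :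
    IsWeakGrad f (∇ f) := by
  have hg : HasCompactSupport (∇ f) := by
    refine (hc.fderiv (𝕜 := ℝ)).comp_left (g := (InnerProductSpace.toDual ℝ E3).symm) (by simp)
  refine ⟨memLp_test hf hc, hf.continuous_gradient.memLp_of_hasCompactSupport hg,
    fun ψ hψ hψc v => ?_⟩
  simp only [← fderiv_eq_inner_gradient]
  exact integral_mul_fderiv_eq_neg_fderiv_mul_of_integrable
    ((memLp_fderiv_test hf hc v).integrable_mul (memLp_test hψ hψc))
    ((memLp_test hf hc).integrable_mul (memLp_fderiv_test hψ hψc v))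
    ((memLp_test hf hc).integrable_mul (memLp_test hψ hψc))
    (fun x _ => hf.differentiable (by simp) x) (fun x _ => hψ.differentiable (by simp) x)

/-! ### Averages over translated cutoffs -/

theorem gradient_comp_sub (b : E3 → ℝ) (x y : E3) : ∇ (fun x => b (x - y)) x = ∇ b (x - y) := by
  simp only [gradient, fderiv_comp_sub]

theorem lintegral_lintegral_sub_mul {k h : E3 → ℝ≥0∞} (hk : Measurable k)
    (hh : AEMeasurable h volume) :
    ∫⁻ y, ∫⁻ x, k (x - y) * h x = (∫⁻ z, k z) * ∫⁻ x, h x := by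
  rw [lintegral_lintegral_swap]
  · have : ∀ x, ∫⁻ y, k (x - y) * h x = (∫⁻ z, k z) * h x := fun x => by
      rw [lintegral_mul_const _ (by fun_prop), lintegral_sub_left_eq_self k x]
    simp only [this]
    rw [lintegral_const_mul'' _ hh]
  · exact (hk.comp (measurable_snd.sub measurable_fst)).aemeasurable.mul hh.comp_snd

theorem hasCompactSupport_gradient {b : E3 → ℝ} (hc : HasCompactSupport b) :
    HasCompactSupport (∇ b) :=
  (hc.fderiv (𝕜 := ℝ)).comp_left (g := (InnerProductSpace.toDual ℝ E3).symm) (by simp)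

theorem memLp_gradient {b : E3 → ℝ} (hb : ContDiff ℝ ∞ b) (hc : HasCompactSupport b) :
    MemLp (∇ b) 2 (volume : Measure E3) :=
  hb.continuous_gradient.memLp_of_hasCompactSupport (hasCompactSupport_gradient hc)

/-- The integrand is half a directional derivative of `b ^ 2`; using `b` as its own test function
gives an integral equal to its negative. -/
theorem integral_mul_gradient_self {b : E3 → ℝ} (hb : ContDiff ℝ ∞ b) (hc : HasCompactSupport b)
    (v : E3) : ∫ z, b z * ⟪∇ b z, v⟫_ℝ = 0 := by
  have := (isWeakGrad_of_contDiff hb hc).integral_eq b hb hc v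
  simp only [fderiv_eq_inner_gradient] at this
  have h2 : ∫ z, ⟪∇ b z, v⟫_ℝ * b z = ∫ z, b z * ⟪∇ b z, v⟫_ℝ := by simp only [mul_comm]
  linarith

theorem enorm_sq_eq_ofReal {F : Type*} [NormedAddCommGroup F] (x : F) :
    ‖x‖ₑ ^ 2 = ENNReal.ofReal (‖x‖ ^ 2) := by
  rw [ENNReal.ofReal_pow (norm_nonneg _), ofReal_norm]

theorem lintegral_enorm_sq_eq_ofReal {F : Type*} [NormedAddCommGroup F] {f : E3 → F}
    (hf : MemLp f 2 volume) : ∫⁻ x, ‖f x‖ₑ ^ 2 = ENNReal.ofReal (∫ x, ‖f x‖ ^ 2) := by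
  rw [ofReal_integral_eq_lintegral_ofReal hf.norm.integrable_sq
    (Filter.Eventually.of_forall fun x => by positivity)]
  simp only [enorm_sq_eq_ofReal]

theorem eLpNorm_two_sq {α F : Type*} [MeasurableSpace α] [NormedAddCommGroup F] (f : α → F)
    (μ : Measure α) : eLpNorm f 2 μ ^ 2 = ∫⁻ x, ‖f x‖ₑ ^ 2 ∂μ := by
  have := eLpNorm_nnreal_pow_eq_lintegral (f := f) (μ := μ) (p := 2) (by norm_num)
  simpa using this

theorem memLp_smul_const {b : E3 → ℝ} (hb : MemLp b 2 volume) (g : E3) :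
    MemLp (fun z => b z • g) 2 volume :=
  hb.of_le_mul (c := ‖g‖) (hb.1.smul aestronglyMeasurable_const)
    (Filter.Eventually.of_forall fun z => by rw [norm_smul, mul_comm])

/-- The cross term is a multiple of `∫ b ⟪∇ b, g⟫ = 0`, so the splitting is an identity without a
loss. -/
theorem lintegral_enorm_sq_cutoff {b : E3 → ℝ} (hb : ContDiff ℝ ∞ b) (hc : HasCompactSupport b)
    (g : E3) (c : ℝ) :
    ∫⁻ z, ‖b z • g + c • ∇ b z‖ₑ ^ 2
      = (∫⁻ z, ‖b z‖ₑ ^ 2) * ‖g‖ₑ ^ 2 + (∫⁻ z, ‖∇ b z‖ₑ ^ 2) * ‖c‖ₑ ^ 2 := by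
  have m1 := memLp_test hb hc
  have m2 := memLp_gradient hb hc
  have m3 : MemLp (fun z => b z • g + c • ∇ b z) 2 (volume : Measure E3) :=
    (memLp_smul_const m1 g).add (m2.const_smul c)
  rw [lintegral_enorm_sq_eq_ofReal m1, lintegral_enorm_sq_eq_ofReal m2,
    lintegral_enorm_sq_eq_ofReal m3, enorm_sq_eq_ofReal, enorm_sq_eq_ofReal,
    ← ENNReal.ofReal_mul (by positivity), ← ENNReal.ofReal_mul (by positivity),
    ← ENNReal.ofReal_add (by positivity) (by positivity)]
  congr 1
  have h : ∀ z, ‖b z • g + c • ∇ b z‖ ^ 2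
      = ‖g‖ ^ 2 * ‖b z‖ ^ 2 + (2 * c) * (b z * ⟪∇ b z, g⟫_ℝ) + ‖c‖ ^ 2 * ‖∇ b z‖ ^ 2 := by
    intro z
    rw [norm_add_sq_real, norm_smul, norm_smul, real_inner_smul_left, real_inner_smul_right,
      real_inner_comm]
    ring
  have i1 : Integrable (fun z => b z * ⟪∇ b z, g⟫_ℝ) (volume : Measure E3) :=
    m1.integrable_mul (m2.inner_vec g)
  simp only [h]
  rw [integral_add, integral_add, integral_const_mul, integral_const_mul, integral_const_mul,
    integral_mul_gradient_self hb hc]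
  · ring
  · exact m1.norm.integrable_sq.const_mul _
  · exact i1.const_mul _
  · exact (m1.norm.integrable_sq.const_mul _).add (i1.const_mul _)
  · exact m2.norm.integrable_sq.const_mul _

/-- The averaged localization formula for the kinetic energy. With the order of integration
exchanged, `G x` and `f x` are constants in the inner integral over the centre `y`. -/
theorem lintegral_lintegral_enorm_sq_cutoff {b : E3 → ℝ} (hb : ContDiff ℝ ∞ b)
    (hc : HasCompactSupport b) {f : E3 → ℝ} {G : E3 → E3} (hf : AEStronglyMeasurable f volume)
    (hG : AEStronglyMeasurable G volume) :
    ∫⁻ y, ∫⁻ x, ‖b (x - y) • G x + f x • ∇ b (x - y)‖ₑ ^ 2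
      = (∫⁻ z, ‖b z‖ₑ ^ 2) * (∫⁻ x, ‖G x‖ₑ ^ 2) + (∫⁻ z, ‖∇ b z‖ₑ ^ 2) * ∫⁻ x, ‖f x‖ₑ ^ 2 := by
  rw [lintegral_lintegral_swap]
  · have : ∀ x, ∫⁻ y, ‖b (x - y) • G x + f x • ∇ b (x - y)‖ₑ ^ 2
        = (∫⁻ z, ‖b z‖ₑ ^ 2) * ‖G x‖ₑ ^ 2 + (∫⁻ z, ‖∇ b z‖ₑ ^ 2) * ‖f x‖ₑ ^ 2 := fun x => by
      rw [lintegral_sub_left_eq_self (fun z => ‖b z • G x + f x • ∇ b z‖ₑ ^ 2) x,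
        lintegral_enorm_sq_cutoff hb hc]
    simp only [this]
    rw [lintegral_add_left' (by fun_prop), lintegral_const_mul'' _ (by fun_prop),
      lintegral_const_mul'' _ (by fun_prop)]
  · have h1 : Measurable fun p : E3 × E3 => b (p.2 - p.1) :=
      hb.continuous.measurable.comp (measurable_snd.sub measurable_fst)
    have h2 : Measurable fun p : E3 × E3 => ∇ b (p.2 - p.1) :=
      hb.continuous_gradient.measurable.comp (measurable_snd.sub measurable_fst)
    exact (((h1.aemeasurable.smul hG.aemeasurable.comp_snd).add
      (hf.aemeasurable.comp_snd.smul h2.aemeasurable)).enorm).pow_const 2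

/-! ### Normalized trial functions -/

/-- A nonnegative function with a weak gradient yields a normalized element of `H¹`. -/
theorem IsWeakGrad.exists_normalized {f : E3 → ℝ} {G : E3 → E3} (h : IsWeakGrad f G)
    (h0 : ∀ᵐ x, 0 ≤ f x) {N : ℝ} (hN : 0 < N) (hfN : ∫⁻ x, ‖f x‖ₑ ^ 2 = ENNReal.ofReal N) :
    ∃ φ : L2R, (φ =ᵐ[volume] fun x => (√N)⁻¹ * f x) ∧ φ = |φ| ∧ MemH1 φ ∧ ‖φ‖ = 1 ∧
      gradSq φ ≤ ENNReal.ofReal N⁻¹ * ∫⁻ x, ‖G x‖ₑ ^ 2 := by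
  have hw := h.const_mul (√N)⁻¹
  have hsq : ENNReal.ofReal ((√N)⁻¹ ^ 2) = ENNReal.ofReal N⁻¹ := by
    rw [inv_pow, Real.sq_sqrt hN.le]
  have hs0 : (0 : ℝ) ≤ (√N)⁻¹ := by positivity
  have key : ∀ (F : Type) [NormedAddCommGroup F] [NormedSpace ℝ F] (g : E3 → F),
      ∫⁻ x, ‖(√N)⁻¹ • g x‖ₑ ^ 2 = ENNReal.ofReal N⁻¹ * ∫⁻ x, ‖g x‖ₑ ^ 2 := by
    intro F _ _ g
    simp only [enorm_smul, mul_pow]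
    rw [lintegral_const_mul' _ _ (by simp), ← hsq, ENNReal.ofReal_pow hs0,
      Real.enorm_of_nonneg hs0]
  refine ⟨hw.memLp_fun.toLp _, hw.memLp_fun.coeFn_toLp, ?_, ⟨_, hw.hasWeakGradient⟩, ?_, ?_⟩
  · apply Lp.ext
    filter_upwards [hw.memLp_fun.coeFn_toLp, Lp.coeFn_abs (hw.memLp_fun.toLp _), h0]
      with x h1 h2 h3
    rw [h2, h1, abs_of_nonneg (mul_nonneg hs0 h3)]
  · have h1 : ‖hw.memLp_fun.toLp _‖ₑ ^ 2 = 1 := by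
      rw [Lp.enorm_toLp, eLpNorm_two_sq]
      have := key ℝ f
      simp only [smul_eq_mul] at this
      rw [this, hfN, ← ENNReal.ofReal_mul (by positivity), inv_mul_cancel₀ hN.ne',
        ENNReal.ofReal_one]
    rw [enorm_sq_eq_ofReal, ENNReal.ofReal_eq_one] at h1
    exact (pow_eq_one_iff_of_nonneg (norm_nonneg _) two_ne_zero).1 h1
  · refine (iInf₂_le _ hw.hasWeakGradient).trans (le_of_eq ?_)
    rw [Lp.enorm_toLp, eLpNorm_two_sq]
    exact key E3 G

/-! ### A Nash inequality -/

theorem toReal_eLpNorm_two {F : Type*} [NormedAddCommGroup F] {f : E3 → F} (hf : MemLp f 2 volume) :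
    (eLpNorm f 2 volume).toReal = √(∫ x, ‖f x‖ ^ 2) := by
  rw [eq_comm, Real.sqrt_eq_iff_mul_self_eq (by positivity) (by positivity), ← sq,
    ← ENNReal.toReal_pow, eLpNorm_two_sq, lintegral_enorm_sq_eq_ofReal hf,
    ENNReal.toReal_ofReal (by positivity)]

theorem abs_integral_mul_le {f g : E3 → ℝ} (hf : MemLp f 2 volume) (hg : MemLp g 2 volume) :
    |∫ x, f x * g x| ≤ √(∫ x, ‖f x‖ ^ 2) * √(∫ x, ‖g x‖ ^ 2) := by
  have h := norm_inner_le_norm (𝕜 := ℝ) (hg.toLp g) (hf.toLp f)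
  rw [L2.inner_def, Lp.norm_toLp, Lp.norm_toLp, toReal_eLpNorm_two hf, toReal_eLpNorm_two hg,
    mul_comm] at h
  refine le_trans (le_of_eq ?_) h
  rw [Real.norm_eq_abs]
  congr 1
  refine integral_congr_ae ?_
  filter_upwards [hf.coeFn_toLp, hg.coeFn_toLp] with x h1 h2
  rw [h1, h2]
  simp

/-- The `L²` norm is determined by the pairing with test functions. -/
theorem sqrt_integral_sq_le_of_forall_test {f : E3 → ℝ} (hf : MemLp f 2 volume) {M : ℝ}
    (hM : 0 ≤ M) (h : ∀ ψ : E3 → ℝ, ContDiff ℝ ∞ ψ → HasCompactSupport ψ →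
      |∫ x, f x * ψ x| ≤ M * √(∫ x, ‖ψ x‖ ^ 2)) :
    √(∫ x, ‖f x‖ ^ 2) ≤ M := by
  have hall : ∀ u : L2R, |⟪u, hf.toLp f⟫_ℝ| ≤ M * ‖u‖ := by
    have hcl : IsClosed {u : L2R | |⟪u, hf.toLp f⟫_ℝ| ≤ M * ‖u‖} :=
      isClosed_le (by fun_prop) (by fun_prop)
    -- Both sides are continuous in `u`, so the bound passes from test functions to all of `L²`; it
    -- is then used at `u = f`, where it reads `‖f‖² ≤ M ‖f‖`.
    have hd := MeasureTheory.Lp.dense_hasCompactSupport_contDiff (E := E3) (F := ℝ)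
        (μ := volume) (p := 2) (by norm_num)
    intro u
    refine closure_minimal ?_ hcl (hd u)
    rintro u ⟨ψ, hu, hc, hψ⟩
    have hm := memLp_test hψ hc
    have hu' : u = hm.toLp ψ := Lp.ext (hu.trans hm.coeFn_toLp.symm)
    have h2 := h ψ hψ hc
    rw [mem_ofPred_eq, hu', L2.inner_def, Lp.norm_toLp, toReal_eLpNorm_two hm]
    convert h2 using 2
    refine integral_congr_ae ?_
    filter_upwards [hf.coeFn_toLp, hm.coeFn_toLp] with x h1 h2
    rw [h1, h2]
    simp
  have h1 := hall (hf.toLp f)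
  rw [real_inner_self_eq_norm_sq, abs_of_nonneg (by positivity), Lp.norm_toLp,
    toReal_eLpNorm_two hf, sq] at h1
  rcases (Real.sqrt_nonneg (∫ x, ‖f x‖ ^ 2)).eq_or_lt with h0 | h0
  · rwa [← h0]
  · exact le_of_mul_le_mul_right h1 h0

/-- As a function of `h` the integral is the convolution of `f` with the reflected test function, so
the derivative falls on the smooth factor. -/
theorem hasFDerivAt_integral_mul_translate {f : E3 → ℝ} (hf : LocallyIntegrable f volume)
    {ψ : E3 → ℝ} (hψ : ContDiff ℝ ∞ ψ) (hc : HasCompactSupport ψ) (h : E3) :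
    ∃ D : E3 →L[ℝ] ℝ, HasFDerivAt (fun h => ∫ x, f x * ψ (x - h)) D h ∧
      ∀ v, D v = - ∫ x, f x * fderiv ℝ ψ (x - h) v := by
  set χ : E3 → ℝ := fun z => ψ (-z) with hχ
  have hχs : ContDiff ℝ ∞ χ := hψ.comp contDiff_neg
  have hχc : HasCompactSupport χ := hc.comp_homeomorph (Homeomorph.neg E3)
  have h1 := hχc.hasFDerivAt_convolution_right (ContinuousLinearMap.mul ℝ ℝ) hf
    (hχs.of_le (by simp)) h
  have hfun : (convolution f χ (ContinuousLinearMap.mul ℝ ℝ) volume)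
      = fun h => ∫ x, f x * ψ (x - h) := by
    ext h
    simp [convolution, hχ]
  rw [hfun] at h1
  refine ⟨_, h1, fun v => ?_⟩
  rw [convolution_precompR_apply _ hf (hχc.fderiv ℝ) (hχs.continuous_fderiv (by simp))]
  simp only [convolution, ContinuousLinearMap.mul_apply']
  rw [← integral_neg]
  refine integral_congr_ae (Filter.Eventually.of_forall fun x => ?_)
  have : fderiv ℝ χ (h - x) v = - fderiv ℝ ψ (x - h) v := by
    have h2 := ((hψ.differentiable (by simp) (-(h - x))).hasFDerivAt).comp (h - x)
      (hasFDerivAt_id (𝕜 := ℝ) (h - x)).neg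
    have h3 : fderiv ℝ χ (h - x) = _ := h2.fderiv
    rw [h3]
    simp
  simp only [this, mul_neg]

/-- The mean value inequality in `h`: by the weak gradient identity the derivative along `v` is `∫
⟪G, v⟫ ψ(· - h)`, to which Cauchy–Schwarz applies. This is the dual form of `‖f(· + h) - f‖₂ ≤ ‖h‖
‖∇f‖₂`. -/
theorem IsWeakGrad.abs_integral_sub_le {f : E3 → ℝ} {G : E3 → E3} (hw : IsWeakGrad f G)
    {ψ : E3 → ℝ} (hψ : ContDiff ℝ ∞ ψ) (hc : HasCompactSupport ψ) (h : E3) :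
    |(∫ x, f x * ψ (x - h)) - ∫ x, f x * ψ x|
      ≤ (√(∫ x, ‖G x‖ ^ 2) * √(∫ x, ‖ψ x‖ ^ 2)) * ‖h‖ := by
  have hf : LocallyIntegrable f volume := hw.memLp_fun.locallyIntegrable (by norm_num)
  choose D hD hDv using fun h => hasFDerivAt_integral_mul_translate hf hψ hc h
  have hbound : ∀ h, ‖D h‖ ≤ √(∫ x, ‖G x‖ ^ 2) * √(∫ x, ‖ψ x‖ ^ 2) := by
    intro h
    refine ContinuousLinearMap.opNorm_le_bound _ (by positivity) fun v => ?_
    have hψ' : ContDiff ℝ ∞ (fun x => ψ (x - h)) := hψ.comp (by fun_prop)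
    have hc' : HasCompactSupport (fun x => ψ (x - h)) := by
      simpa [sub_eq_add_neg, Function.comp_def] using
        hc.comp_homeomorph (Homeomorph.addRight (-h))
    have key := hw.integral_eq _ hψ' hc' v
    simp only [fderiv_comp_sub] at key
    rw [hDv, key, neg_neg, Real.norm_eq_abs]
    refine (abs_integral_mul_le (hw.memLp_grad.inner_vec v) (memLp_test hψ' hc')).trans ?_
    rw [integral_sub_right_eq_self (fun x => ‖ψ x‖ ^ 2) h, mul_right_comm]
    refine mul_le_mul_of_nonneg_right ?_ (by positivity)
    rw [← Real.sqrt_sq (norm_nonneg v), ← Real.sqrt_mul' _ (by positivity), mul_comm,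
      ← integral_const_mul]
    refine Real.sqrt_le_sqrt (integral_mono (hw.memLp_grad.inner_vec v).norm.integrable_sq
      (hw.memLp_grad.norm.integrable_sq.const_mul _) fun x => ?_)
    have := norm_inner_le_norm (𝕜 := ℝ) (G x) v
    calc ‖⟪G x, v⟫_ℝ‖ ^ 2 ≤ (‖G x‖ * ‖v‖) ^ 2 := by gcongr
      _ = ‖v‖ ^ 2 * ‖G x‖ ^ 2 := by ring
  have := convex_univ.norm_image_sub_le_of_norm_hasFDerivWithin_le
    (f := fun h => ∫ x, f x * ψ (x - h)) (x := 0) (y := h)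
    (fun x _ => (hD x).hasFDerivWithinAt) (fun x _ => hbound x) (mem_univ _) (mem_univ _)
  simpa using this

theorem lintegral_ball_translate_le {ψ : E3 → ℝ} (hψ : Continuous ψ) (x : E3) (r : ℝ) :
    ∫⁻ h in Metric.ball (0 : E3) r, ‖ψ (x - h)‖ₑ
      ≤ volume (Metric.ball (0 : E3) r) ^ (1 / 2 : ℝ) * eLpNorm ψ 2 volume := by
  have h1 := eLpNorm_le_eLpNorm_mul_rpow_measure_univ (p := 1) (q := 2)
    (μ := volume.restrict (Metric.ball (0 : E3) r)) (f := fun h => ψ (x - h)) (by norm_num)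
    (by fun_prop)
  rw [eLpNorm_one_eq_lintegral_enorm] at h1
  refine h1.trans ?_
  rw [mul_comm, Measure.restrict_apply_univ]
  norm_num
  gcongr
  refine (eLpNorm_restrict_le _ _ _ _).trans (le_of_eq ?_)
  exact eLpNorm_comp_measurePreserving (g := ψ) hψ.aestronglyMeasurable
    (Measure.measurePreserving_sub_left volume x)

/-- The pairing with `ψ` is compared with the pairings with its translates by `h` and averaged over
`‖h‖ < r`. Averaging `|ψ|` over a ball costs `|B| ^ (1 / 2) ‖ψ‖₂` uniformly in `x`, so that only the
`L¹` norm of `f` is left. -/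
theorem IsWeakGrad.ofReal_abs_integral_le {f : E3 → ℝ} {G : E3 → E3} (hw : IsWeakGrad f G)
    {ψ : E3 → ℝ} (hψ : ContDiff ℝ ∞ ψ) (hc : HasCompactSupport ψ) {r : ℝ} (hr : 0 < r) :
    volume (Metric.ball (0 : E3) r) * ‖∫ x, f x * ψ x‖ₑ
      ≤ volume (Metric.ball (0 : E3) r) *
          ENNReal.ofReal ((√(∫ x, ‖G x‖ ^ 2) * √(∫ x, ‖ψ x‖ ^ 2)) * r)
        + (∫⁻ x, ‖f x‖ₑ) *
          (volume (Metric.ball (0 : E3) r) ^ (1 / 2 : ℝ) * eLpNorm ψ 2 volume) := by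
  set B := Metric.ball (0 : E3) r with hB
  set M := √(∫ x, ‖G x‖ ^ 2) * √(∫ x, ‖ψ x‖ ^ 2) with hM
  have h1 : ∀ h ∈ B, ‖∫ x, f x * ψ x‖ₑ
      ≤ ENNReal.ofReal (M * r) + ∫⁻ x, ‖f x‖ₑ * ‖ψ (x - h)‖ₑ := by
    intro h hh
    have h2 := hw.abs_integral_sub_le hψ hc h
    have h3 : ‖h‖ ≤ r := (mem_ball_zero_iff.1 hh).le
    have h4 : ‖∫ x, f x * ψ (x - h)‖ₑ ≤ ∫⁻ x, ‖f x‖ₑ * ‖ψ (x - h)‖ₑ := by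
      refine (enorm_integral_le_lintegral_enorm _).trans (le_of_eq ?_)
      simp only [enorm_mul]
    refine le_trans ?_ (add_le_add_right h4 _)
    rw [← ofReal_norm, ← ofReal_norm, ← ENNReal.ofReal_add (by positivity) (by positivity)]
    refine ENNReal.ofReal_le_ofReal ?_
    rw [Real.norm_eq_abs, Real.norm_eq_abs]
    have h5 := abs_sub_abs_le_abs_sub (∫ x, f x * ψ x) (∫ x, f x * ψ (x - h))
    rw [abs_sub_comm] at h5
    have h6 : M * ‖h‖ ≤ M * r := mul_le_mul_of_nonneg_left h3 (by positivity)
    linarith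
  calc volume B * ‖∫ x, f x * ψ x‖ₑ = ∫⁻ h in B, ‖∫ x, f x * ψ x‖ₑ := by
        rw [setLIntegral_const, mul_comm]
    _ ≤ ∫⁻ h in B, (ENNReal.ofReal (M * r) + ∫⁻ x, ‖f x‖ₑ * ‖ψ (x - h)‖ₑ) :=
        setLIntegral_mono' measurableSet_ball h1
    _ = volume B * ENNReal.ofReal (M * r) + ∫⁻ h in B, ∫⁻ x, ‖f x‖ₑ * ‖ψ (x - h)‖ₑ := by
        rw [lintegral_add_left measurable_const, setLIntegral_const, mul_comm]
    _ ≤ _ := by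
        gcongr
        rw [lintegral_lintegral_swap]
        · rw [← lintegral_mul_const'' _ (by have := hw.memLp_fun.1; fun_prop)]
          refine lintegral_mono fun x => ?_
          rw [lintegral_const_mul _ (by have := hψ.continuous.measurable; fun_prop)]
          gcongr
          exact lintegral_ball_translate_le hψ.continuous x r
        · have h3 : Measurable fun p : E3 × E3 => ψ (p.2 - p.1) :=
            hψ.continuous.measurable.comp (measurable_snd.sub measurable_fst)
          exact (hw.memLp_fun.1.aemeasurable.comp_snd.enorm).mul h3.enorm.aemeasurable

/-- A Nash inequality with a length scale `r`. -/
theorem exists_nash : ∃ c : ℝ, 0 < c ∧ ∀ (f : E3 → ℝ) (G : E3 → E3), IsWeakGrad f G →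
    Integrable f volume → ∀ r : ℝ, 0 < r →
      √(∫ x, ‖f x‖ ^ 2) ≤ r * √(∫ x, ‖G x‖ ^ 2) + c / √(r ^ 3) * ∫ x, ‖f x‖ := by
  set V := (volume (Metric.ball (0 : E3) 1)).toReal with hV
  have hV0 : 0 < V := ENNReal.toReal_pos (Metric.measure_ball_pos _ _ one_pos).ne'
    measure_ball_lt_top.ne
  -- After division by `|B_r| = r³ V` the coefficient of `‖f‖₁` is `(r³ V) ^ (-1 / 2)`. Duality with
  -- test functions then gives the `L²` norm.
  refine ⟨1 / √V, by positivity, fun f G hw hi r hr => ?_⟩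
  refine sqrt_integral_sq_le_of_forall_test hw.memLp_fun
    (by positivity) fun ψ hψ hc => ?_
  have hvol : volume (Metric.ball (0 : E3) r) = ENNReal.ofReal (r ^ 3 * V) := by
    rw [Measure.addHaar_ball volume _ hr.le, ENNReal.ofReal_mul (by positivity), hV,
      ENNReal.ofReal_toReal measure_ball_lt_top.ne]
    simp
  have h := hw.ofReal_abs_integral_le hψ hc hr
  have hp : 0 < r ^ 3 * V := by positivity
  rw [hvol, ENNReal.ofReal_rpow_of_pos hp, ← Real.sqrt_eq_rpow,
    ← ofReal_integral_norm_eq_lintegral_enorm hi, ← ofReal_norm,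
    ← ENNReal.ofReal_toReal (memLp_test hψ hc).eLpNorm_ne_top, toReal_eLpNorm_two (memLp_test hψ hc),
    ← ENNReal.ofReal_mul (by positivity), ← ENNReal.ofReal_mul (by positivity),
    ← ENNReal.ofReal_mul (by positivity), ← ENNReal.ofReal_mul (by positivity),
    ← ENNReal.ofReal_add (by positivity) (by positivity),
    ENNReal.ofReal_le_ofReal_iff (by positivity)] at h
  rw [← Real.norm_eq_abs]
  refine le_of_mul_le_mul_left (h.trans (le_of_eq ?_)) hp
  have hs : √(r ^ 3 * V) = √(r ^ 3) * √V := Real.sqrt_mul (by positivity) _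
  have h1 : √(r ^ 3) ≠ 0 := by positivity
  have h2 : √V ≠ 0 := by positivity
  have e : r ^ 3 * V = (√(r ^ 3) * √V) * (√(r ^ 3) * √V) := by
    rw [← hs, Real.mul_self_sqrt hp.le]
  have e' : r ^ 3 * V * (1 / √V / √(r ^ 3)) = √(r ^ 3) * √V := by
    rw [e]; field_simp
  rw [hs, add_mul, mul_add]
  congr 1
  · ring
  · rw [show r ^ 3 * V * (1 / √V / √(r ^ 3) * (∫ x, ‖f x‖) * √(∫ x, ‖ψ x‖ ^ 2))
      = (r ^ 3 * V * (1 / √V / √(r ^ 3))) * ((∫ x, ‖f x‖) * √(∫ x, ‖ψ x‖ ^ 2)) by ring, e']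
    ring

/-! ### Trial functions for the auxiliary energy -/

theorem ofReal_div_two (x : ℝ) : ENNReal.ofReal x / 2 = ENNReal.ofReal (x / 2) := by
  rw [ENNReal.ofReal_div_of_pos two_pos, ENNReal.ofReal_ofNat]

/-- A nonnegative integrable function with a square integrable weak gradient. -/
structure IsTrial (f : E3 → ℝ) (G : E3 → E3) : Prop extends IsWeakGrad f G where
  nonneg : ∀ᵐ x, 0 ≤ f x
  integrable : Integrable f volume

theorem IsTrial.comp_affine {f : E3 → ℝ} {G : E3 → E3} (h : IsTrial f G) {l : ℝ} (hl : 0 < l)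
    (a : E3) : IsTrial (fun x => f (l • x + a)) (fun x => l • G (l • x + a)) :=
  ⟨h.toIsWeakGrad.comp_affine hl a, (quasiMeasurePreserving_affine hl a).ae h.nonneg,
    memLp_one_iff_integrable.1 ((memLp_one_iff_integrable.2 h.integrable).comp_affine hl a)⟩

theorem IsTrial.mul_smooth {f : E3 → ℝ} {G : E3 → E3} (h : IsTrial f G) {η : E3 → ℝ} {C : ℝ}
    (hη : ContDiff ℝ ∞ η) (h0 : ∀ x, 0 ≤ η x) (hb : ∀ x, |η x| ≤ C) (hb' : ∀ x, ‖∇ η x‖ ≤ C) :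
    IsTrial (fun x => η x * f x) (fun x => η x • G x + f x • ∇ η x) := by
  refine ⟨h.toIsWeakGrad.mul_smooth hη hb hb', ?_, ?_⟩
  · filter_upwards [h.nonneg] with x hx using mul_nonneg (h0 x) hx
  · exact h.integrable.bdd_mul hη.continuous.aestronglyMeasurable
      (Filter.Eventually.of_forall hb)

theorem isTrial_of_contDiff {f : E3 → ℝ} (hf : ContDiff ℝ ∞ f) (hc : HasCompactSupport f)
    (h0 : ∀ x, 0 ≤ f x) : IsTrial f (∇ f) :=
  ⟨isWeakGrad_of_contDiff hf hc, Filter.Eventually.of_forall h0,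
    hf.continuous.integrable_of_hasCompactSupport hc⟩

theorem eLpNorm_one_of_ae_eq {f : E3 → ℝ} (hf : Integrable f volume) {c : ℝ} (hc : 0 ≤ c)
    {φ : L2R} (hφ : φ =ᵐ[volume] fun x => c * f x) :
    eLpNorm φ 1 volume = ENNReal.ofReal (c * ∫ x, ‖f x‖) := by
  rw [eLpNorm_congr_ae hφ, eLpNorm_one_eq_lintegral_enorm,
    ← ofReal_integral_norm_eq_lintegral_enorm (hf.const_mul c)]
  simp only [norm_mul, integral_const_mul, Real.norm_of_nonneg hc]

theorem IsTrial.exists_normalized {f : E3 → ℝ} {G : E3 → E3} (h : IsTrial f G) {β : ℝ}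
    (hβ : 0 ≤ β) (hN : 0 < ∫ x, ‖f x‖ ^ 2) :
    ∃ φ : L2R, (φ =ᵐ[volume] fun x => (√(∫ x, ‖f x‖ ^ 2))⁻¹ * f x) ∧ φ = |φ| ∧ MemH1 φ ∧
      ‖φ‖ = 1 ∧ MemLp φ 1 volume ∧ auxEnergy β φ ≤ ENNReal.ofReal
        ((∫ x, ‖G x‖ ^ 2) / 2 / (∫ x, ‖f x‖ ^ 2) + β * (∫ x, ‖f x‖) / √(∫ x, ‖f x‖ ^ 2)) := by
  obtain ⟨φ, h1, h2, h3, h4, h5⟩ := h.toIsWeakGrad.exists_normalized h.nonneg hN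
    (lintegral_enorm_sq_eq_ofReal h.memLp_fun)
  have h6 := eLpNorm_one_of_ae_eq h.integrable (by positivity) h1
  refine ⟨φ, h1, h2, h3, h4, ⟨Lp.aestronglyMeasurable φ, by rw [h6]; exact ENNReal.ofReal_lt_top⟩, ?_⟩
  rw [auxEnergy, h6, ENNReal.ofReal_add (by positivity) (by positivity),
    ← ENNReal.ofReal_mul hβ]
  refine add_le_add ?_ (le_of_eq (by congr 1; ring))
  rw [lintegral_enorm_sq_eq_ofReal h.memLp_grad, ← ENNReal.ofReal_mul (by positivity)] at h5
  refine (ENNReal.div_le_div_right h5 2).trans (le_of_eq ?_)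
  rw [ofReal_div_two]
  congr 1
  ring

theorem auxF_le_of_isTrial {f : E3 → ℝ} {G : E3 → E3} (h : IsTrial f G) {β : ℝ}
    (hβ : 0 ≤ β) (hN : 0 < ∫ x, ‖f x‖ ^ 2) :
    auxF β ≤ ENNReal.ofReal
        ((∫ x, ‖G x‖ ^ 2) / 2 / (∫ x, ‖f x‖ ^ 2) + β * (∫ x, ‖f x‖) / √(∫ x, ‖f x‖ ^ 2)) := by
  obtain ⟨φ, -, h2, h3, h4, h5, h6⟩ := h.exists_normalized hβ hN
  exact (iInf₂_le φ ⟨h2, h3, h5, h4⟩).trans h6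

theorem auxFLoc_le_of_isTrial {f : E3 → ℝ} {G : E3 → E3} (h : IsTrial f G) {β L : ℝ}
    (hβ : 0 ≤ β) (hN : 0 < ∫ x, ‖f x‖ ^ 2)
    (hs : ∀ᵐ x ∂(volume : Measure E3), x ∉ Metric.ball (0 : E3) L → f x = 0) :
    auxFLoc L β ≤ ENNReal.ofReal
        ((∫ x, ‖G x‖ ^ 2) / 2 / (∫ x, ‖f x‖ ^ 2) + β * (∫ x, ‖f x‖) / √(∫ x, ‖f x‖ ^ 2)) := by
  obtain ⟨φ, h1, h2, h3, h4, h5, h6⟩ := h.exists_normalized hβ hN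
  refine (iInf₂_le φ ⟨h2, ⟨h3, ?_⟩, h4⟩).trans h6
  filter_upwards [h1, hs] with x hx hx' hxL
  rw [hx, hx' hxL, mul_zero]

/-- The integrals of `|f|` and `|f|²` acquire a factor `l⁻³` and that of `|∇f|²` a factor `l² l⁻³`;
the normalized quotients therefore scale as `l²` and `l ^ (-3 / 2)`. -/
theorem energy_comp_affine {f : E3 → ℝ} {G : E3 → E3} (hN : 0 < ∫ x, ‖f x‖ ^ 2) {l : ℝ}
    (hl : 0 < l) (a : E3) (β : ℝ) :
    0 < ∫ x, ‖f (l • x + a)‖ ^ 2 ∧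
    (∫ x, ‖l • G (l • x + a)‖ ^ 2) / 2 / (∫ x, ‖f (l • x + a)‖ ^ 2)
        + β * (∫ x, ‖f (l • x + a)‖) / √(∫ x, ‖f (l • x + a)‖ ^ 2)
      = l ^ 2 * ((∫ x, ‖G x‖ ^ 2) / 2 / (∫ x, ‖f x‖ ^ 2))
          + β / √(l ^ 3) * ((∫ x, ‖f x‖) / √(∫ x, ‖f x‖ ^ 2)) := by
  have e1 := integral_comp_affine (fun x => ‖f x‖ ^ 2) hl a
  have e2 := integral_comp_affine (fun x => ‖f x‖) hl a
  have e3 := integral_comp_affine (fun x => ‖l • G x‖ ^ 2) hl a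
  simp only [smul_eq_mul, norm_smul, mul_pow, integral_const_mul, Real.norm_of_nonneg hl.le]
    at e1 e2 e3
  have hl3 : 0 < l ^ 3 := by positivity
  refine ⟨by rw [e1]; positivity, ?_⟩
  simp only [norm_smul, mul_pow, integral_const_mul, Real.norm_of_nonneg hl.le]
  rw [e1, e2, e3, Real.sqrt_mul (by positivity), Real.sqrt_inv]
  have hsq : √(l ^ 3) * √(l ^ 3) = l ^ 3 := Real.mul_self_sqrt hl3.le
  have hs0 : 0 < √(l ^ 3) := by positivity
  have hN0 : 0 < √(∫ x, ‖f x‖ ^ 2) := by positivity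
  congr 1
  · field_simp
  · have : (l ^ 3)⁻¹ = (√(l ^ 3))⁻¹ * (√(l ^ 3))⁻¹ := by rw [← mul_inv, hsq]
    rw [this]; field_simp

/-- Trial functions may be dilated and translated. -/
theorem auxFLoc_le_of_isTrial_affine {f : E3 → ℝ} {G : E3 → E3} (h : IsTrial f G) {β L l : ℝ}
    {a : E3} (hβ : 0 ≤ β) (hl : 0 < l) (hN : 0 < ∫ x, ‖f x‖ ^ 2)
    (hs : ∀ᵐ x ∂(volume : Measure E3), x ∉ Metric.ball a (l * L) → f x = 0) :
    auxFLoc L β ≤ ENNReal.ofReal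
        (l ^ 2 * ((∫ x, ‖G x‖ ^ 2) / 2 / (∫ x, ‖f x‖ ^ 2))
          + β / √(l ^ 3) * ((∫ x, ‖f x‖) / √(∫ x, ‖f x‖ ^ 2))) := by
  obtain ⟨hN', he⟩ := energy_comp_affine (G := G) hN hl a β
  rw [← he]
  refine auxFLoc_le_of_isTrial (h.comp_affine hl a) hβ (L := L) hN' ?_
  filter_upwards [(quasiMeasurePreserving_affine hl a).ae hs] with x hx hxL
  refine hx fun hxa => hxL ?_
  rw [mem_ball_zero_iff]
  rw [mem_ball_iff_norm, add_sub_cancel_right, norm_smul, Real.norm_of_nonneg hl.le] at hxa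
  exact lt_of_mul_lt_mul_left hxa hl.le

theorem auxF_le_of_isTrial_dilate {f : E3 → ℝ} {G : E3 → E3} (h : IsTrial f G) {β l : ℝ}
    (hβ : 0 ≤ β) (hl : 0 < l) (hN : 0 < ∫ x, ‖f x‖ ^ 2) :
    auxF β ≤ ENNReal.ofReal
        (l ^ 2 * ((∫ x, ‖G x‖ ^ 2) / 2 / (∫ x, ‖f x‖ ^ 2))
          + β / √(l ^ 3) * ((∫ x, ‖f x‖) / √(∫ x, ‖f x‖ ^ 2))) := by
  obtain ⟨hN', he⟩ := energy_comp_affine (G := G) hN hl 0 β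
  rw [← he]
  exact auxF_le_of_isTrial (h.comp_affine hl 0) hβ hN'

/-- The variational principle with the normalization cleared. The factor `‖f‖₂` in front of `‖f‖₁`
carries the penalty for pieces of small mass. -/
theorem auxF_mul_le {f : E3 → ℝ} {G : E3 → E3} (h : IsTrial f G) {β : ℝ} (hβ : 0 ≤ β) :
    (auxF β).toReal * (∫ x, ‖f x‖ ^ 2)
      ≤ (∫ x, ‖G x‖ ^ 2) / 2 + β * (√(∫ x, ‖f x‖ ^ 2) * ∫ x, ‖f x‖) := by
  have h0 : 0 ≤ ∫ x, ‖f x‖ ^ 2 := by positivity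
  rcases h0.eq_or_lt with h0 | h0
  · rw [← h0, mul_zero]; positivity
  · have h1 := ENNReal.toReal_le_of_le_ofReal (by positivity) (auxF_le_of_isTrial h hβ h0)
    have h2 := mul_le_mul_of_nonneg_right h1 h0.le
    refine h2.trans (le_of_eq ?_)
    have hs : √(∫ x, ‖f x‖ ^ 2) * √(∫ x, ‖f x‖ ^ 2) = ∫ x, ‖f x‖ ^ 2 := Real.mul_self_sqrt h0.le
    have hs0 : 0 < √(∫ x, ‖f x‖ ^ 2) := by positivity
    rw [add_mul]
    congr 1
    · field_simp
    · rw [div_mul_eq_mul_div, div_eq_iff hs0.ne']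
      linear_combination (-(β * ∫ x, ‖f x‖)) * hs

/-! ### Bump functions, finiteness, and almost minimizers of the auxiliary energy. -/

theorem exists_bump {R : ℝ} (hR : 0 < R) : ∃ f : E3 → ℝ, ContDiff ℝ ∞ f ∧ HasCompactSupport f ∧
    (∀ x, 0 ≤ f x) ∧ (∀ x, x ∉ Metric.ball (0 : E3) R → f x = 0) ∧ 0 < ∫ x, ‖f x‖ ^ 2 := by
  let b : ContDiffBump (0 : E3) := ⟨R / 2, R, by positivity, by linarith⟩
  refine ⟨b, b.contDiff, b.hasCompactSupport, fun x => b.nonneg, fun x hx => ?_, ?_⟩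
  · exact b.zero_of_le_dist (by simpa using hx)
  · have hi : Integrable (fun x => ‖b x‖ ^ 2) (volume : Measure E3) :=
      (memLp_test (ψ := b) b.contDiff b.hasCompactSupport).norm.integrable_sq
    rw [integral_pos_iff_support_of_nonneg (fun x => by positivity) hi]
    have : Function.support (fun x => ‖b x‖ ^ 2) = Metric.ball (0 : E3) R := by
      rw [← b.support_eq]; ext x; simp
    rw [this]
    exact Metric.measure_ball_pos _ _ hR

theorem auxFLoc_ne_top {L β : ℝ} (hL : 0 < L) (hβ : 0 ≤ β) : auxFLoc L β ≠ ⊤ := by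
  obtain ⟨f, h1, h2, h3, h4, h5⟩ := exists_bump hL
  exact ((auxFLoc_le_of_isTrial (isTrial_of_contDiff h1 h2 h3) hβ h5
    (Filter.Eventually.of_forall h4)).trans_lt ENNReal.ofReal_lt_top).ne

theorem MemY.memLp_one {L : ℝ} {φ : L2R} (h : MemY L φ) : MemLp φ 1 (volume : Measure E3) := by
  have h1 : MemLp φ 1 ((volume : Measure E3).restrict (Metric.ball (0 : E3) L)) := by
    have : IsFiniteMeasure ((volume : Measure E3).restrict (Metric.ball (0 : E3) L)) :=
      ⟨by rw [Measure.restrict_apply_univ]; exact measure_ball_lt_top⟩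
    exact ((Lp.memLp φ).restrict _).mono_exponent (by norm_num)
  rw [← memLp_indicator_iff_restrict measurableSet_ball] at h1
  refine h1.ae_eq ?_
  filter_upwards [h.2] with x hx
  by_cases hxL : x ∈ Metric.ball (0 : E3) L
  · simp [hxL]
  · simp [hxL, hx hxL]

theorem auxF_le_auxFLoc (L β : ℝ) : auxF β ≤ auxFLoc L β :=
  le_iInf₂ fun φ h => iInf₂_le φ ⟨h.1, h.2.1.1, h.2.1.memLp_one, h.2.2⟩

theorem auxF_ne_top {β : ℝ} (hβ : 0 ≤ β) : auxF β ≠ ⊤ :=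
  ((auxF_le_auxFLoc 1 β).trans_lt (auxFLoc_ne_top one_pos hβ).lt_top).ne

/-- The strict inequality allows one weak gradient to be selected from the infimum `gradSq`, so its
uniqueness plays no role. -/
theorem exists_isTrial_of_auxEnergy_lt {φ : L2R} (h1 : φ = |φ|) (h3 : MemLp φ 1 volume)
    (h4 : ‖φ‖ = 1) {β : ℝ} (hβ : 0 ≤ β) {c : ℝ} (hc : 0 ≤ c)
    (h5 : auxEnergy β φ < ENNReal.ofReal c) :
    ∃ G, IsTrial φ G ∧ ∫ x, ‖φ x‖ ^ 2 = 1 ∧ (∫ x, ‖G x‖ ^ 2) / 2 + β * (∫ x, ‖φ x‖) ≤ c := by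
  have h6 : gradSq φ < (ENNReal.ofReal c - ENNReal.ofReal β * eLpNorm φ 1 volume) * 2 := by
    rw [auxEnergy] at h5
    have := lt_tsub_iff_right.2 h5
    rwa [ENNReal.div_lt_iff (by simp) (by simp)] at this
  simp only [gradSq, iInf_lt_iff] at h6
  obtain ⟨G, hG, h7⟩ := h6
  have h8 : ‖G‖ₑ ^ 2 / 2 + ENNReal.ofReal β * eLpNorm φ 1 volume ≤ ENNReal.ofReal c := by
    rw [← ENNReal.div_lt_iff (by simp) (by simp)] at h7
    exact (lt_tsub_iff_right.1 h7).le
  have hi : Integrable φ volume := memLp_one_iff_integrable.1 h3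
  have h0 : ∀ᵐ x, 0 ≤ φ x := by
    have := Lp.coeFn_abs φ
    rw [← h1] at this
    filter_upwards [this] with x hx
    rw [hx]; exact abs_nonneg _
  refine ⟨G, ⟨hG.isWeakGrad, h0, hi⟩, ?_, ?_⟩
  · have := toReal_eLpNorm_two (Lp.memLp φ)
    rw [← Lp.norm_def, h4] at this
    have h9 := congrArg (· ^ 2) this
    simp only [one_pow] at h9
    rw [Real.sq_sqrt (by positivity)] at h9
    exact h9.symm
  · have h9 : eLpNorm φ 1 volume = ENNReal.ofReal (∫ x, ‖φ x‖) := by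
      rw [eLpNorm_one_eq_lintegral_enorm, ofReal_integral_norm_eq_lintegral_enorm hi]
    have h10 : ‖G‖ₑ ^ 2 = ENNReal.ofReal (∫ x, ‖G x‖ ^ 2) := by
      rw [Lp.enorm_def, eLpNorm_two_sq, lintegral_enorm_sq_eq_ofReal (Lp.memLp G)]
    rw [h9, h10, ofReal_div_two, ← ENNReal.ofReal_mul hβ,
      ← ENNReal.ofReal_add (by positivity) (by positivity),
      ENNReal.ofReal_le_ofReal_iff hc] at h8
    exact h8

theorem lt_ofReal_toReal_add {x : ℝ≥0∞} (hx : x ≠ ⊤) {ν : ℝ} (hν : 0 < ν) :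
    x < ENNReal.ofReal (x.toReal + ν) := by
  rw [ENNReal.ofReal_add ENNReal.toReal_nonneg hν.le, ENNReal.ofReal_toReal hx]
  exact ENNReal.lt_add_right hx (by simpa using hν)

/-- Trial functions that almost minimize the auxiliary energy. -/
theorem exists_isTrial_le {β : ℝ} (hβ : 0 ≤ β) {ν : ℝ} (hν : 0 < ν) :
    ∃ f G, IsTrial f G ∧ ∫ x, ‖f x‖ ^ 2 = 1 ∧
      (∫ x, ‖G x‖ ^ 2) / 2 + β * (∫ x, ‖f x‖) ≤ (auxF β).toReal + ν := by
  have hlt := lt_ofReal_toReal_add (auxF_ne_top hβ) hν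
  conv_lhs at hlt => rw [auxF]
  simp only [iInf_lt_iff] at hlt
  obtain ⟨φ, ⟨h1, -, h3, h4⟩, h5⟩ := hlt
  exact ⟨φ, exists_isTrial_of_auxEnergy_lt h1 h3 h4 hβ (by positivity) h5⟩

/-- Trial functions that almost minimize the localized auxiliary energy. -/
theorem exists_isTrial_loc_le {β L : ℝ} (hβ : 0 ≤ β) (hL : 0 < L) {ν : ℝ} (hν : 0 < ν) :
    ∃ f G, IsTrial f G ∧ (∀ᵐ x ∂(volume : Measure E3), x ∉ Metric.ball (0 : E3) L → f x = 0) ∧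
      ∫ x, ‖f x‖ ^ 2 = 1 ∧
      (∫ x, ‖G x‖ ^ 2) / 2 + β * (∫ x, ‖f x‖) ≤ (auxFLoc L β).toReal + ν := by
  have hlt := lt_ofReal_toReal_add (auxFLoc_ne_top hL hβ) hν
  conv_lhs at hlt => rw [auxFLoc]
  simp only [iInf_lt_iff] at hlt
  obtain ⟨φ, ⟨h1, h2, h4⟩, h5⟩ := hlt
  obtain ⟨G, hG, hN, hE⟩ :=
    exists_isTrial_of_auxEnergy_lt h1 h2.memLp_one h4 hβ (by positivity) h5
  exact ⟨φ, G, hG, h2.2, hN, hE⟩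

/-! ### Cutoff functions -/

theorem exists_bound_gradient {b : E3 → ℝ} (hb : ContDiff ℝ ∞ b) (hc : HasCompactSupport b) :
    ∃ K : ℝ, 0 ≤ K ∧ ∀ x, ‖∇ b x‖ ≤ K := by
  obtain ⟨K, hK⟩ := (hasCompactSupport_gradient hc).exists_bound_of_continuous
    hb.continuous_gradient
  exact ⟨K, (norm_nonneg _).trans (hK 0), hK⟩

theorem gradient_comp_affine {b : E3 → ℝ} (hb : ContDiff ℝ ∞ b) (l : ℝ) (y x : E3) :
    ∇ (fun x => b (l • (x - y))) x = l • ∇ b (l • (x - y)) := by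
  have h1 : HasFDerivAt (fun x : E3 => l • (x - y)) (l • ContinuousLinearMap.id ℝ E3) x :=
    ((hasFDerivAt_id x).sub_const y).const_smul l
  have h2 := ((hb.differentiable (by simp) (l • (x - y))).hasFDerivAt).comp x h1
  have h3 : fderiv ℝ (fun x => b (l • (x - y))) x = l • fderiv ℝ b (l • (x - y)) := by
    refine h2.fderiv.trans ?_
    ext v; simp
  rw [gradient, h3, map_smul, gradient]

theorem hasCompactSupport_dilate {b : E3 → ℝ} (hc : HasCompactSupport b) {l : ℝ} (hl : l ≠ 0) :
    HasCompactSupport (fun x => b (l • x)) :=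
  hc.comp_homeomorph (Homeomorph.smulOfNeZero l hl)

/-- A bump function on the unit ball that is close to its indicator function. -/
theorem exists_bump_near_indicator {δ : ℝ} (hδ : 0 < δ) (hδ1 : δ ≤ 1) : ∃ b : E3 → ℝ,
    ContDiff ℝ ∞ b ∧ HasCompactSupport b ∧ (∀ x, 0 ≤ b x) ∧ (∀ x, b x ≤ 1) ∧
    (∀ x, x ∉ Metric.ball (0 : E3) 1 → b x = 0) ∧ 0 < ∫ x, ‖b x‖ ^ 2 ∧
    ∫ x, ‖b x‖ ≤ (1 + δ) * ∫ x, ‖b x‖ ^ 2 := by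
  -- For `δ ≤ 1` one has `(1 + δ / 7) ^ 3 ≤ 1 + δ`, so the ball where `b = 1` fills at least the
  -- fraction `1 / (1 + δ)` of the unit ball.
  set ρ : ℝ := (1 + δ / 7)⁻¹ with hρ
  have hρ0 : 0 < ρ := by positivity
  have hρ1 : ρ < 1 := inv_lt_one_of_one_lt₀ (by linarith)
  let b : ContDiffBump (0 : E3) := ⟨ρ, 1, hρ0, hρ1⟩
  set V := volume.real (Metric.ball (0 : E3) 1) with hV
  have hV0 : 0 < V := ENNReal.toReal_pos (Metric.measure_ball_pos _ _ one_pos).ne'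
    measure_ball_lt_top.ne
  have hVρ : volume.real (Metric.ball (0 : E3) ρ) = ρ ^ 3 * V := by
    rw [measureReal_def, Measure.addHaar_ball volume _ hρ0.le, ENNReal.toReal_mul,
      ENNReal.toReal_ofReal (by positivity)]
    simp [hV, measureReal_def]
  have hi : Integrable (fun x => ‖b x‖ ^ 2) (volume : Measure E3) :=
    (memLp_test (ψ := b) b.contDiff b.hasCompactSupport).norm.integrable_sq
  have hi1 : Integrable (fun x => ‖b x‖) (volume : Measure E3) :=
    (b.continuous.integrable_of_hasCompactSupport b.hasCompactSupport).norm
  have hind : ∀ r : ℝ, Integrable (indicator (Metric.ball (0 : E3) r) (fun _ => (1 : ℝ)))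
      (volume : Measure E3) := fun r =>
    (integrable_indicator_iff measurableSet_ball).2
      (integrableOn_const (C := (1 : ℝ)) measure_ball_lt_top.ne (by simp))
  have hint : ∀ r : ℝ, ∫ x, indicator (Metric.ball (0 : E3) r) (fun _ => (1 : ℝ)) x
      = volume.real (Metric.ball (0 : E3) r) := fun r => by
    rw [integral_indicator measurableSet_ball]; simp
  have hlow : ρ ^ 3 * V ≤ ∫ x, ‖b x‖ ^ 2 := by
    rw [← hVρ, ← hint]
    refine integral_mono (hind ρ) hi fun x => ?_
    by_cases hx : x ∈ Metric.ball (0 : E3) ρ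
    · rw [indicator_of_mem hx, b.one_of_mem_closedBall (Metric.ball_subset_closedBall hx)]; simp
    · rw [indicator_of_notMem hx]; positivity
  have hup : ∫ x, ‖b x‖ ≤ V := by
    rw [hV, ← hint]
    refine integral_mono hi1 (hind 1) fun x => ?_
    by_cases hx : x ∈ Metric.ball (0 : E3) 1
    · rw [indicator_of_mem hx, Real.norm_of_nonneg b.nonneg]; exact b.le_one
    · rw [indicator_of_notMem hx, b.zero_of_le_dist (by simpa using hx), norm_zero]
  refine ⟨b, b.contDiff, b.hasCompactSupport, fun x => b.nonneg, fun x => b.le_one,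
    fun x hx => b.zero_of_le_dist (by simpa using hx), lt_of_lt_of_le (by positivity) hlow, ?_⟩
  have h1 : 1 ≤ (1 + δ) * ρ ^ 3 := by
    rw [hρ, inv_pow, ← div_eq_mul_inv, one_le_div (by positivity)]
    nlinarith [mul_pos hδ hδ, mul_nonneg hδ.le (sub_nonneg.2 hδ1),
      mul_nonneg (mul_pos hδ hδ).le (sub_nonneg.2 hδ1)]
  calc ∫ x, ‖b x‖ ≤ V := hup
    _ ≤ ((1 + δ) * ρ ^ 3) * V := le_mul_of_one_le_left hV0.le h1
    _ = (1 + δ) * (ρ ^ 3 * V) := by ring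
    _ ≤ _ := by gcongr

/-- A smooth quadratic partition of unity subordinate to a ball and the complement of a smaller
ball. -/
theorem exists_quadratic_partition : ∃ (χ ξ : E3 → ℝ) (K : ℝ), ContDiff ℝ ∞ χ ∧ ContDiff ℝ ∞ ξ ∧
    (∀ x, 0 ≤ χ x) ∧ (∀ x, 0 ≤ ξ x) ∧ (∀ x, χ x ^ 2 + ξ x ^ 2 = 1) ∧
    (∀ x ∈ Metric.ball (0 : E3) 1, ξ x = 0) ∧ (∀ x, x ∉ Metric.ball (0 : E3) 2 → χ x = 0) ∧
    (∀ x, ‖∇ χ x‖ ≤ K) ∧ (∀ x, ‖∇ ξ x‖ ≤ K) := by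
  let b : ContDiffBump (0 : E3) := ⟨1, 2, by norm_num, by norm_num⟩
  -- The pair `sin θ`, `cos θ` is smooth, with squares that add up to one, and involves no square
  -- root of a function with zeros.
  set θ : E3 → ℝ := fun x => Real.pi / 2 * b x with hθ
  have hbs : ContDiff ℝ ∞ b := b.contDiff
  have hθs : ContDiff ℝ ∞ θ := contDiff_const.mul hbs
  have hθ0 : ∀ x, 0 ≤ θ x := fun x => mul_nonneg (by positivity) b.nonneg
  have hθ1 : ∀ x, θ x ≤ Real.pi / 2 := fun x =>
    mul_le_of_le_one_right (by positivity) b.le_one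
  have hs : ContDiff ℝ ∞ (fun x => Real.sin (θ x)) := Real.contDiff_sin.comp hθs
  have hc : ContDiff ℝ ∞ (fun x => Real.cos (θ x)) := Real.contDiff_cos.comp hθs
  have hsc : HasCompactSupport (fun x => Real.sin (θ x)) :=
    b.hasCompactSupport.comp_left (g := fun t => Real.sin (Real.pi / 2 * t)) (by simp)
  -- The cosine equals one far out; subtracting one gives compact support, hence a bounded gradient.
  have hcc : HasCompactSupport (fun x => Real.cos (θ x) - 1) :=
    b.hasCompactSupport.comp_left (g := fun t => Real.cos (Real.pi / 2 * t) - 1) (by simp)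
  obtain ⟨K1, hK1, h1⟩ := exists_bound_gradient hs hsc
  obtain ⟨K2, hK2, h2⟩ := exists_bound_gradient (hc.sub contDiff_const) hcc
  refine ⟨fun x => Real.sin (θ x), fun x => Real.cos (θ x), K1 + K2, hs, hc,
    fun x => Real.sin_nonneg_of_nonneg_of_le_pi (hθ0 x) (by linarith [hθ1 x, Real.pi_pos]),
    fun x => Real.cos_nonneg_of_neg_pi_div_two_le_of_le (by linarith [hθ0 x, Real.pi_pos]) (hθ1 x),
    fun x => Real.sin_sq_add_cos_sq _, fun x hx => ?_, fun x hx => ?_,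
    fun x => (h1 x).trans (by linarith), fun x => ?_⟩
  · have : b x = 1 := b.one_of_mem_closedBall (Metric.ball_subset_closedBall hx)
    simp [hθ, this]
  · have : b x = 0 := b.zero_of_le_dist (by simpa using hx)
    simp [hθ, this]
  · have := h2 x
    simp only [gradient, fderiv_sub_const] at this
    exact this.trans (by linarith)

/-! ### Concentration of almost minimizers -/

theorem setIntegral_le_integral_of_sq {f : E3 → ℝ} (hf : MemLp f 2 volume) {η : E3 → ℝ}
    (h0 : ∀ x, 0 ≤ η x) (h1 : ∀ x, η x ≤ 1) {s : Set E3} (hs : MeasurableSet s)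
    (hz : ∀ x, x ∉ s → η x = 0) : ∫ x, ‖η x * f x‖ ^ 2 ≤ ∫ x in s, ‖f x‖ ^ 2 := by
  rw [← integral_indicator hs]
  refine integral_mono_of_nonneg (Filter.Eventually.of_forall fun x => by positivity)
    (hf.norm.integrable_sq.indicator hs) (Filter.Eventually.of_forall fun x => ?_)
  by_cases hx : x ∈ s
  · simp only [indicator_of_mem hx, norm_mul, Real.norm_of_nonneg (h0 x)]
    exact pow_le_pow_left₀ (mul_nonneg (h0 x) (norm_nonneg (f x)))
      (mul_le_of_le_one_left (norm_nonneg (f x)) (h1 x)) 2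
  · simp [indicator_of_notMem hx, hz x hx]

/-- By contradiction. If every ball of radius `ℓ` had mass below `(1 - ε)²`, the function `b((· - y)
/ ℓ) f` would have norm at most `1 - ε`. `auxF_mul_le` then holds with `(1 - ε)` in front of its
`L¹` norm. Averaging over `y` improves the lower bound for the energy of `f` by a multiple of `ε
‖f‖₁ ≥ ε c₁`, more than an almost minimizer allows. -/
theorem exists_concentration {ε c₁ : ℝ} (hε : 0 < ε) (hε1 : ε ≤ 1) (hc₁ : 0 < c₁) :
    ∃ ν > 0, ∃ ℓ₀ > 0, ∀ ℓ ≥ ℓ₀, ∀ f G, IsTrial f G → ∫ x, ‖f x‖ ^ 2 = 1 →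
      (∫ x, ‖G x‖ ^ 2) / 2 + (∫ x, ‖f x‖) ≤ (auxF 1).toReal + ν → c₁ ≤ ∫ x, ‖f x‖ →
      ∃ y : E3, (1 - ε) ^ 2 ≤ ∫ x in Metric.ball y ℓ, ‖f x‖ ^ 2 := by
  -- The average weights the `L¹` term by `∫ b` and the mass by `∫ b²`. Their ratio must not absorb
  -- the gain, and `(1 - ε) (1 + ε / 2) ≤ 1 - ε / 2`.
  obtain ⟨b, hb, hbc, hb0, hb1, hbz, hκ, hB⟩ := exists_bump_near_indicator (δ := ε / 2)
    (by positivity) (by linarith)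
  set κ := ∫ x, ‖b x‖ ^ 2 with hκdef
  set g := ∫ x, ‖∇ b x‖ ^ 2 with hgdef
  have hg0 : 0 ≤ g := by positivity
  -- The gain is at least `ε c₁ / 2`. The excess energy `ν` and the gradient of the cutoff may use
  -- `ε c₁ / 8` each; the radius is chosen for the latter.
  refine ⟨ε * c₁ / 8, by positivity, √(1 + 4 * g / (κ * (ε * c₁))), by positivity,
    fun ℓ hℓ f G h hN hE hI => ?_⟩
  have hℓ0 : 0 < ℓ := lt_of_lt_of_le (by positivity) hℓ
  have hℓg : g ≤ ℓ ^ 2 * (κ * (ε * c₁)) / 4 := by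
    have h1 := (Real.sqrt_le_left hℓ0.le).1 hℓ
    have h2 : 4 * g / (κ * (ε * c₁)) ≤ ℓ ^ 2 := by linarith
    rw [div_le_iff₀ (by positivity)] at h2
    linarith
  by_contra! hcon
  set F := (auxF 1).toReal with hF
  have hF0 : 0 ≤ F := ENNReal.toReal_nonneg
  have hl : 0 < ℓ⁻¹ := inv_pos.2 hℓ0
  set bl : E3 → ℝ := fun x => b (ℓ⁻¹ • x) with hbl
  have hbls : ContDiff ℝ ∞ bl := hb.comp (by fun_prop)
  have hblc : HasCompactSupport bl := hasCompactSupport_dilate hbc hl.ne'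
  obtain ⟨K, hK0, hK⟩ := exists_bound_gradient hbls hblc
  have hlow : ∀ y, ENNReal.ofReal F * (∫⁻ x, ‖bl (x - y)‖ₑ ^ 2 * ‖f x‖ₑ ^ 2)
      ≤ 2⁻¹ * (∫⁻ x, ‖bl (x - y) • G x + f x • ∇ bl (x - y)‖ₑ ^ 2)
        + ENNReal.ofReal (1 - ε) * ∫⁻ x, ‖bl (x - y)‖ₑ * ‖f x‖ₑ := by
    intro y
    set η : E3 → ℝ := fun x => bl (x - y) with hη
    have hηs : ContDiff ℝ ∞ η := hbls.comp (by fun_prop)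
    have hη0 : ∀ x, 0 ≤ η x := fun x => hb0 _
    have hη1 : ∀ x, η x ≤ 1 := fun x => hb1 _
    have hgr : ∀ x, ∇ η x = ∇ bl (x - y) := fun x => gradient_comp_sub bl x y
    have ht : IsTrial (fun x => η x * f x) (fun x => η x • G x + f x • ∇ η x) :=
      h.mul_smooth hηs (C := 1 + K) hη0
        (fun x => by rw [abs_of_nonneg (hη0 x)]; linarith [hη1 x])
        (fun x => by rw [hgr]; linarith [hK (x - y)])
    have h1 := auxF_mul_le ht (β := 1) zero_le_one
    have h2 : √(∫ x, ‖η x * f x‖ ^ 2) ≤ 1 - ε := by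
      rw [Real.sqrt_le_left (by linarith)]
      refine (setIntegral_le_integral_of_sq h.memLp_fun hη0 hη1
        (s := Metric.ball y ℓ) measurableSet_ball fun x hx => hbz _ fun hx' => hx ?_).trans
        (hcon y).le
      rw [mem_ball_zero_iff, norm_smul, Real.norm_of_nonneg hl.le, inv_mul_lt_iff₀ hℓ0,
        mul_one] at hx'
      rwa [mem_ball_iff_norm]
    have h3 : F * (∫ x, ‖η x * f x‖ ^ 2) ≤ 2⁻¹ * (∫ x, ‖η x • G x + f x • ∇ η x‖ ^ 2)
        + (1 - ε) * ∫ x, ‖η x * f x‖ := by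
      refine h1.trans ?_
      rw [one_mul, div_eq_inv_mul]
      gcongr
    have e1 : ∫⁻ x, ‖η x‖ₑ ^ 2 * ‖f x‖ₑ ^ 2 = ENNReal.ofReal (∫ x, ‖η x * f x‖ ^ 2) := by
      rw [← lintegral_enorm_sq_eq_ofReal ht.memLp_fun]
      simp only [enorm_mul, mul_pow]
    have e2 : ∫⁻ x, ‖η x‖ₑ * ‖f x‖ₑ = ENNReal.ofReal (∫ x, ‖η x * f x‖) := by
      rw [ofReal_integral_norm_eq_lintegral_enorm ht.integrable]
      simp only [enorm_mul]
    have e3 : ∫⁻ x, ‖η x • G x + f x • ∇ bl (x - y)‖ₑ ^ 2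
        = ENNReal.ofReal (∫ x, ‖η x • G x + f x • ∇ η x‖ ^ 2) := by
      rw [← lintegral_enorm_sq_eq_ofReal ht.memLp_grad]
      simp only [hgr]
    have e4 : (2⁻¹ : ℝ≥0∞) = ENNReal.ofReal 2⁻¹ := by
      rw [ENNReal.ofReal_inv_of_pos two_pos, ENNReal.ofReal_ofNat]
    change ENNReal.ofReal F * (∫⁻ x, ‖η x‖ₑ ^ 2 * ‖f x‖ₑ ^ 2)
      ≤ 2⁻¹ * (∫⁻ x, ‖η x • G x + f x • ∇ bl (x - y)‖ₑ ^ 2)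
        + ENNReal.ofReal (1 - ε) * ∫⁻ x, ‖η x‖ₑ * ‖f x‖ₑ
    rw [e1, e2, e3, e4, ← ENNReal.ofReal_mul hF0, ← ENNReal.ofReal_mul (by positivity),
      ← ENNReal.ofReal_mul (by linarith),
      ← ENNReal.ofReal_add (by positivity) (mul_nonneg (by linarith) (by positivity))]
    exact ENNReal.ofReal_le_ofReal h3
  -- Integration over all centres `y`; every double integral factorizes by Tonelli's theorem.
  have hint := lintegral_mono (μ := (volume : Measure E3)) hlow
  have hblm : Measurable bl := hbls.continuous.measurable
  have hm : AEMeasurable (fun y => ∫⁻ x, ‖bl (x - y)‖ₑ * ‖f x‖ₑ) (volume : Measure E3) := by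
    have h3 : Measurable fun p : E3 × E3 => bl (p.2 - p.1) :=
      hblm.comp (measurable_snd.sub measurable_fst)
    exact (h3.enorm.aemeasurable.mul h.memLp_fun.1.aemeasurable.comp_snd.enorm).lintegral_prod_right'
  have hfm : AEMeasurable f volume := h.memLp_fun.1.aemeasurable
  rw [lintegral_add_right' _ (hm.const_mul _), lintegral_const_mul' _ _ (by simp),
    lintegral_const_mul' _ _ (by simp), lintegral_const_mul' _ _ (by simp),
    lintegral_lintegral_sub_mul (k := fun z => ‖bl z‖ₑ ^ 2) (by fun_prop) (by fun_prop),
    lintegral_lintegral_sub_mul (k := fun z => ‖bl z‖ₑ) (by fun_prop) (by fun_prop),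
    lintegral_lintegral_enorm_sq_cutoff hbls hblc h.memLp_fun.1 h.memLp_grad.1,
    lintegral_enorm_sq_eq_ofReal h.memLp_fun, lintegral_enorm_sq_eq_ofReal h.memLp_grad,
    lintegral_enorm_sq_eq_ofReal (memLp_test hbls hblc),
    lintegral_enorm_sq_eq_ofReal (memLp_gradient hbls hblc),
    ← ofReal_integral_norm_eq_lintegral_enorm h.integrable,
    ← ofReal_integral_norm_eq_lintegral_enorm
      (hbls.continuous.integrable_of_hasCompactSupport hblc), hN] at hint
  have s1 : ∫ x, ‖bl x‖ ^ 2 = ℓ ^ 3 * κ := by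
    have := integral_comp_affine (fun x => ‖b x‖ ^ 2) hl 0
    simpa [hbl, hκdef] using this
  have s2 : ∫ x, ‖bl x‖ = ℓ ^ 3 * ∫ x, ‖b x‖ := by
    have := integral_comp_affine (fun x => ‖b x‖) hl 0
    simpa [hbl] using this
  have s3 : ∫ x, ‖∇ bl x‖ ^ 2 = ℓ * g := by
    have := integral_comp_affine (fun x => ‖ℓ⁻¹ • ∇ b x‖ ^ 2) hl 0
    have h2 : ∀ x, ∇ bl x = ℓ⁻¹ • ∇ b (ℓ⁻¹ • x) := fun x => by
      have := gradient_comp_affine hb ℓ⁻¹ 0 x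
      simpa [hbl] using this
    simp only [h2]
    simp only [add_zero] at this
    rw [this]
    simp only [norm_smul, mul_pow, integral_const_mul, Real.norm_of_nonneg hl.le, smul_eq_mul]
    field_simp
    exact hgdef.symm
  rw [s1, s2, s3, show (2⁻¹ : ℝ≥0∞) = ENNReal.ofReal 2⁻¹ by
      rw [ENNReal.ofReal_inv_of_pos two_pos, ENNReal.ofReal_ofNat]] at hint
  set D := ∫ x, ‖G x‖ ^ 2 with hD
  set I := ∫ x, ‖f x‖ with hIdef
  set B := ∫ x, ‖b x‖ with hBdef
  have hD0 : 0 ≤ D := by positivity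
  have hI0 : 0 ≤ I := by positivity
  have hB0 : 0 ≤ B := by positivity
  have h1ε : 0 ≤ 1 - ε := by linarith
  rw [← ENNReal.ofReal_mul (by positivity), ← ENNReal.ofReal_mul (by positivity),
    ← ENNReal.ofReal_mul (by positivity), ← ENNReal.ofReal_mul (by positivity),
    ← ENNReal.ofReal_mul (by positivity), ← ENNReal.ofReal_add (by positivity) (by positivity),
    ← ENNReal.ofReal_mul (by positivity), ← ENNReal.ofReal_mul (by positivity),
    ← ENNReal.ofReal_add (by positivity) (by positivity),
    ENNReal.ofReal_le_ofReal_iff (by positivity)] at hint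
  have hBI : (1 - ε) * (ℓ ^ 3 * B * I) ≤ (1 - ε / 2) * (ℓ ^ 3 * κ * I) := by
    have h4 : (1 - ε) * B ≤ (1 - ε / 2) * κ := by
      calc (1 - ε) * B ≤ (1 - ε) * ((1 + ε / 2) * κ) := by gcongr
        _ ≤ (1 - ε / 2) * κ := by nlinarith [mul_pos (mul_pos hε hε) hκ]
    calc (1 - ε) * (ℓ ^ 3 * B * I) = ((1 - ε) * B) * (ℓ ^ 3 * I) := by ring
      _ ≤ ((1 - ε / 2) * κ) * (ℓ ^ 3 * I) := by gcongr
      _ = _ := by ring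
  have hgl : ℓ * g ≤ ℓ ^ 3 * κ * (ε * c₁ / 4) := by
    calc ℓ * g ≤ ℓ * (ℓ ^ 2 * (κ * (ε * c₁)) / 4) := by gcongr
      _ = _ := by ring
  have hfin : ℓ ^ 3 * κ * F ≤ ℓ ^ 3 * κ * (D / 2 + ε * c₁ / 8 + (1 - ε / 2) * I) := by
    nlinarith
  have h5 := le_of_mul_le_mul_left hfin (by positivity)
  have h6 : ε * c₁ ≤ ε * I := by gcongr
  have h7 : 0 < ε * c₁ := by positivity
  linarith

/-! ### Truncation of almost minimizers -/

theorem sq_integral_le_of_sq_le {u v w : E3 → ℝ} (hv : Integrable v volume)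
    (hw : Integrable w volume) (hv0 : ∀ x, 0 ≤ v x)
    (hw0 : ∀ x, 0 ≤ w x) (h : ∀ x, u x ^ 2 = v x * w x) (hu0 : ∀ x, 0 ≤ u x) :
    (∫ x, u x) ^ 2 ≤ (∫ x, v x) * ∫ x, w x := by
  have m : ∀ {v : E3 → ℝ}, Integrable v volume → (∀ x, 0 ≤ v x) →
      MemLp (fun x => √(v x)) 2 volume := by
    intro v hv hv0
    rw [memLp_two_iff_integrable_sq (Real.continuous_sqrt.comp_aestronglyMeasurable hv.1)]
    simpa only [Real.sq_sqrt (hv0 _)] using hv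
  have key := abs_integral_mul_le (m hv hv0) (m hw hw0)
  have e : ∀ x, √(v x) * √(w x) = u x := fun x => by
    rw [← Real.sqrt_mul (hv0 x), ← h x, Real.sqrt_sq (hu0 x)]
  simp only [e, Real.norm_of_nonneg (Real.sqrt_nonneg _), Real.sq_sqrt (hv0 _),
    Real.sq_sqrt (hw0 _)] at key
  rw [← Real.sqrt_mul (by exact integral_nonneg hv0)] at key
  rw [← sq_abs]
  exact (Real.le_sqrt (abs_nonneg _) (mul_nonneg (integral_nonneg hv0) (integral_nonneg hw0))).1 key

/-- Half the derivative of the constant `χ² + ξ²`. -/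
theorem gradient_quadratic_partition {χ ξ : E3 → ℝ} (hχ : ContDiff ℝ ∞ χ) (hξ : ContDiff ℝ ∞ ξ)
    (h : ∀ x, χ x ^ 2 + ξ x ^ 2 = 1) (x : E3) : χ x • ∇ χ x + ξ x • ∇ ξ x = 0 := by
  have h1 := (hχ.differentiable (by simp) x).hasFDerivAt
  have h2 := (hξ.differentiable (by simp) x).hasFDerivAt
  have h3 := (h1.mul h1).add (h2.mul h2)
  have h4 : (χ * χ + ξ * ξ : E3 → ℝ) = fun _ => 1 := by
    ext x; simp [← h x, sq]
  rw [h4] at h3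
  have h5 := h3.unique (hasFDerivAt_const 1 x)
  refine ext_inner_right ℝ fun v => ?_
  have h6 := congrArg (fun T : E3 →L[ℝ] ℝ => T v) h5
  simp only [_root_.add_apply, _root_.smul_apply, smul_eq_mul,
    _root_.zero_apply, fderiv_eq_inner_gradient] at h6
  simp only [inner_add_left, real_inner_smul_left, inner_zero_left]
  linarith

/-- The pointwise localization formula: the two cross terms add up to `2 c ⟪g, a • u + b • v⟫ = 0`.
-/
theorem norm_sq_quadratic_partition {a b c : ℝ} {g u v : E3} (h : a ^ 2 + b ^ 2 = 1)
    (h' : a • u + b • v = 0) :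
    ‖a • g + c • u‖ ^ 2 + ‖b • g + c • v‖ ^ 2 = ‖g‖ ^ 2 + c ^ 2 * (‖u‖ ^ 2 + ‖v‖ ^ 2) := by
  have h2 : a * ⟪g, u⟫_ℝ + b * ⟪g, v⟫_ℝ = 0 := by
    rw [← real_inner_smul_right, ← real_inner_smul_right, ← inner_add_right, h', inner_zero_right]
  simp only [norm_add_sq_real, norm_smul, real_inner_smul_left, real_inner_smul_right, mul_pow,
    Real.norm_eq_abs, sq_abs]
  linear_combination (‖g‖ ^ 2) * h + (2 * c) * h2

/-- The pieces are `χ f` and `ξ f` for the quadratic partition rescaled to radius `ℓ` about `y`. The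
last bound comes from Cauchy–Schwarz for `ξ |f| = (ξ² |f|) ^ (1 / 2) |f| ^ (1 / 2)` on the support
of `ξ`. It makes the `L¹` norm of the outer piece quadratically small: the lost `L¹` norm times a
tail. -/
theorem exists_truncation : ∃ K : ℝ, 0 ≤ K ∧ ∀ f G, IsTrial f G → ∫ x, ‖f x‖ ^ 2 = 1 →
    ∀ (y : E3) (ℓ : ℝ), 0 < ℓ → ∃ f₁ G₁ f₂ G₂, IsTrial f₁ G₁ ∧ IsTrial f₂ G₂ ∧
      (∀ x, x ∉ Metric.ball y (2 * ℓ) → f₁ x = 0) ∧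
      (∫ x, ‖G₁ x‖ ^ 2) + (∫ x, ‖G₂ x‖ ^ 2) ≤ (∫ x, ‖G x‖ ^ 2) + K / ℓ ^ 2 ∧
      (∫ x, ‖f₁ x‖ ^ 2) + (∫ x, ‖f₂ x‖ ^ 2) = 1 ∧
      ∫ x, ‖f₂ x‖ ^ 2 ≤ 1 - ∫ x in Metric.ball y ℓ, ‖f x‖ ^ 2 ∧
      ∫ x in (Metric.ball y (2 * ℓ))ᶜ, ‖f x‖ ≤ (∫ x, ‖f x‖) - ∫ x, ‖f₁ x‖ ∧
      (∫ x, ‖f₂ x‖) ^ 2 ≤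
        2 * ((∫ x, ‖f x‖) - ∫ x, ‖f₁ x‖) * ∫ x in (Metric.ball y ℓ)ᶜ, ‖f x‖ := by
  obtain ⟨χ, ξ, K, hχ, hξ, hχ0, hξ0, hsum, hξz, hχz, hχK, hξK⟩ := exists_quadratic_partition
  have hK0 : 0 ≤ K := (norm_nonneg _).trans (hχK 0)
  refine ⟨2 * K ^ 2, by positivity, fun f G h hN y ℓ hℓ => ?_⟩
  have hl : 0 < ℓ⁻¹ := inv_pos.2 hℓ
  set a : E3 → ℝ := fun x => χ (ℓ⁻¹ • (x - y)) with ha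
  set b : E3 → ℝ := fun x => ξ (ℓ⁻¹ • (x - y)) with hb
  have has : ContDiff ℝ ∞ a := hχ.comp (by fun_prop)
  have hbs : ContDiff ℝ ∞ b := hξ.comp (by fun_prop)
  have ha0 : ∀ x, 0 ≤ a x := fun x => hχ0 _
  have hb0 : ∀ x, 0 ≤ b x := fun x => hξ0 _
  have hab : ∀ x, a x ^ 2 + b x ^ 2 = 1 := fun x => hsum _
  have ha1 : ∀ x, a x ≤ 1 := fun x => by nlinarith [hab x, sq_nonneg (b x), ha0 x]
  have hb1 : ∀ x, b x ≤ 1 := fun x => by nlinarith [hab x, sq_nonneg (a x), hb0 x]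
  have hga : ∀ x, ‖∇ a x‖ ≤ ℓ⁻¹ * K := fun x => by
    rw [gradient_comp_affine hχ, norm_smul, Real.norm_of_nonneg hl.le]
    gcongr; exact hχK _
  have hgb : ∀ x, ‖∇ b x‖ ≤ ℓ⁻¹ * K := fun x => by
    rw [gradient_comp_affine hξ, norm_smul, Real.norm_of_nonneg hl.le]
    gcongr; exact hξK _
  have hball : ∀ x (s : ℝ), x ∈ Metric.ball y (s * ℓ) ↔ ℓ⁻¹ • (x - y) ∈ Metric.ball (0 : E3) s := by
    intro x s
    rw [mem_ball_iff_norm, mem_ball_zero_iff, norm_smul, Real.norm_of_nonneg hl.le,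
      inv_mul_lt_iff₀ hℓ, mul_comm]
  have haz : ∀ x, x ∉ Metric.ball y (2 * ℓ) → a x = 0 := fun x hx =>
    hχz _ fun hx' => hx ((hball x 2).2 hx')
  have hbz : ∀ x ∈ Metric.ball y ℓ, b x = 0 := fun x hx =>
    hξz _ ((hball x 1).1 (by rwa [one_mul]))
  have ht1 : IsTrial (fun x => a x * f x) (fun x => a x • G x + f x • ∇ a x) :=
    h.mul_smooth has (C := 1 + ℓ⁻¹ * K) ha0
      (fun x => by rw [abs_of_nonneg (ha0 x)]; linarith [ha1 x, mul_nonneg hl.le hK0])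
      (fun x => by linarith [hga x])
  have ht2 : IsTrial (fun x => b x * f x) (fun x => b x • G x + f x • ∇ b x) :=
    h.mul_smooth hbs (C := 1 + ℓ⁻¹ * K) hb0
      (fun x => by rw [abs_of_nonneg (hb0 x)]; linarith [hb1 x, mul_nonneg hl.le hK0])
      (fun x => by linarith [hgb x])
  have hf2 := h.memLp_fun.norm.integrable_sq
  have hI : (∫ x, ‖f x‖) - ∫ x, ‖a x * f x‖ = ∫ x, (1 - a x) * ‖f x‖ := by
    rw [← integral_sub h.integrable.norm ht1.integrable.norm]
    refine integral_congr_ae (Filter.Eventually.of_forall fun x => ?_)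
    simp only [norm_mul, Real.norm_of_nonneg (ha0 x)]
    ring
  have hi1 : Integrable (fun x => (1 - a x) * ‖f x‖) volume :=
    (h.integrable.norm.sub ht1.integrable.norm).congr (Filter.Eventually.of_forall fun x => by
      simp only [Pi.sub_apply, norm_mul, Real.norm_of_nonneg (ha0 x)]
      ring)
  have hn0 : ∀ x, 0 ≤ (1 - a x) * ‖f x‖ := fun x =>
    mul_nonneg (by linarith [ha1 x]) (norm_nonneg _)
  refine ⟨_, _, _, _, ht1, ht2, fun x hx => by rw [haz x hx, zero_mul], ?_, ?_, ?_, ?_, ?_⟩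
  · rw [← integral_add ht1.memLp_grad.norm.integrable_sq ht2.memLp_grad.norm.integrable_sq]
    have e : (∫ x, ‖G x‖ ^ 2) + 2 * K ^ 2 / ℓ ^ 2
        = ∫ x, (‖G x‖ ^ 2 + 2 * K ^ 2 / ℓ ^ 2 * ‖f x‖ ^ 2) := by
      rw [integral_add h.memLp_grad.norm.integrable_sq (hf2.const_mul _), integral_const_mul, hN,
        mul_one]
    rw [e]
    refine integral_mono
      (ht1.memLp_grad.norm.integrable_sq.add ht2.memLp_grad.norm.integrable_sq)
      (h.memLp_grad.norm.integrable_sq.add (hf2.const_mul _)) fun x => ?_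
    simp only
    rw [norm_sq_quadratic_partition (hab x) (gradient_quadratic_partition has hbs hab x)]
    have h1 : ‖∇ a x‖ ^ 2 ≤ (ℓ⁻¹ * K) ^ 2 := pow_le_pow_left₀ (norm_nonneg _) (hga x) 2
    have h2 : ‖∇ b x‖ ^ 2 ≤ (ℓ⁻¹ * K) ^ 2 := pow_le_pow_left₀ (norm_nonneg _) (hgb x) 2
    have h3 : 2 * K ^ 2 / ℓ ^ 2 = (ℓ⁻¹ * K) ^ 2 + (ℓ⁻¹ * K) ^ 2 := by
      rw [div_eq_mul_inv, ← inv_pow]; ring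
    rw [h3, Real.norm_eq_abs, sq_abs, mul_comm (f x ^ 2)]
    gcongr
  · rw [← integral_add ht1.memLp_fun.norm.integrable_sq ht2.memLp_fun.norm.integrable_sq, ← hN]
    refine integral_congr_ae (Filter.Eventually.of_forall fun x => ?_)
    simp only [norm_mul, mul_pow, Real.norm_of_nonneg (ha0 x), Real.norm_of_nonneg (hb0 x)]
    rw [← add_mul, hab, one_mul]
  · have h1 := setIntegral_le_integral_of_sq h.memLp_fun hb0 hb1
      (s := (Metric.ball y ℓ)ᶜ) measurableSet_ball.compl fun x hx => hbz x (notMem_compl_iff.1 hx)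
    have h2 := integral_add_compl (measurableSet_ball (x := y) (ε := ℓ)) hf2
    linarith
  · rw [hI, ← integral_indicator measurableSet_ball.compl]
    refine integral_mono (h.integrable.norm.indicator measurableSet_ball.compl) hi1 fun x => ?_
    by_cases hx : x ∈ (Metric.ball y (2 * ℓ))ᶜ
    · simp only [indicator_of_mem hx, haz x hx, sub_zero, one_mul, le_refl]
    · rw [indicator_of_notMem hx]; exact hn0 x
  · rw [hI, ← integral_indicator measurableSet_ball.compl]
    have h1 : Integrable (fun x => b x ^ 2 * ‖f x‖) volume :=
      h.integrable.norm.bdd_mul (c := 1) (hbs.continuous.pow 2).aestronglyMeasurable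
        (Filter.Eventually.of_forall fun x => by
          rw [norm_pow, Real.norm_of_nonneg (hb0 x)]; exact pow_le_one₀ (hb0 x) (hb1 x))
    refine (sq_integral_le_of_sq_le (v := fun x => b x ^ 2 * ‖f x‖) h1
      (h.integrable.norm.indicator (measurableSet_ball (x := y) (ε := ℓ)).compl)
      (fun x => by positivity)
      (fun x => indicator_nonneg (fun x _ => norm_nonneg (f x)) x) (fun x => ?_)
      (fun x => norm_nonneg _)).trans ?_
    · by_cases hx : x ∈ (Metric.ball y ℓ)ᶜ
      · simp only [indicator_of_mem hx, norm_mul, Real.norm_of_nonneg (hb0 x)]; ring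
      · simp [indicator_of_notMem hx, hbz x (notMem_compl_iff.1 hx)]
    · have hnn : ∀ x, 0 ≤ indicator (Metric.ball y ℓ)ᶜ (fun x => ‖f x‖) x := fun x =>
        indicator_nonneg (fun x _ => norm_nonneg (f x)) x
      refine mul_le_mul_of_nonneg_right ?_ (integral_nonneg hnn)
      rw [← integral_const_mul]
      refine integral_mono h1 (hi1.const_mul 2) fun x => ?_
      simp only
      rw [← mul_assoc]
      refine mul_le_mul_of_nonneg_right ?_ (norm_nonneg _)
      -- Here `b² = 1 - a² = 2 (1 - a) - (1 - a)²`.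
      nlinarith [hab x, sq_nonneg (1 - a x)]

/-! ### The localization estimate for the auxiliary energy -/

/-- An almost minimizer has a bounded gradient, so Nash's inequality at a small fixed `r` leaves at
least half of `‖f‖₂ = 1` to the `L¹` term. This excludes spreading out with vanishing `L¹` norm and
makes the gain in `exists_concentration` definite. -/
theorem exists_lower_bound_integral : ∃ c₁ : ℝ, 0 < c₁ ∧ ∀ f G, IsTrial f G →
    ∫ x, ‖f x‖ ^ 2 = 1 → (∫ x, ‖G x‖ ^ 2) / 2 + (∫ x, ‖f x‖) ≤ (auxF 1).toReal + 1 →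
    c₁ ≤ ∫ x, ‖f x‖ := by
  obtain ⟨c, hc, hnash⟩ := exists_nash
  set F := (auxF 1).toReal with hF
  have hF0 : 0 ≤ F := ENNReal.toReal_nonneg
  set r : ℝ := (2 * √(2 * (F + 1)))⁻¹ with hr
  have hs0 : 0 < √(2 * (F + 1)) := by positivity
  have hr0 : 0 < r := by positivity
  refine ⟨√(r ^ 3) / (2 * c), by positivity, fun f G h hN hE => ?_⟩
  have h1 := hnash f G h.toIsWeakGrad h.integrable r hr0
  rw [hN, Real.sqrt_one] at h1
  have hI0 : 0 ≤ ∫ x, ‖f x‖ := by positivity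
  have h2 : √(∫ x, ‖G x‖ ^ 2) ≤ √(2 * (F + 1)) := Real.sqrt_le_sqrt (by linarith)
  have h3 : r * √(∫ x, ‖G x‖ ^ 2) ≤ 1 / 2 := by
    calc r * √(∫ x, ‖G x‖ ^ 2) ≤ r * √(2 * (F + 1)) := by gcongr
      _ = 1 / 2 := by rw [hr]; field_simp
  have hq : 0 < √(r ^ 3) := by positivity
  have h4 : 1 / 2 ≤ c / √(r ^ 3) * ∫ x, ‖f x‖ := by linarith
  rw [div_le_iff₀ (by positivity)]
  rw [div_mul_eq_mul_div, le_div_iff₀ hq] at h4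
  linarith

/-- Nash's inequality is squared with `(p + q)² ≤ 2 (p² + q²)`. The value of `r` turns the
coefficient of `D` into one half, and that of `τ` turns the coefficient of `J` into one. In the
application `m`, `D`, `I` belong to the outer piece and `J` is the `L¹` norm lost by the inner one.
-/
theorem le_of_nash {c r τ F m D I J : ℝ} (hc : 0 < c) (hr : 0 < r) (hF : 0 ≤ F) (hm : 0 ≤ m)
    (hD : 0 ≤ D) (hr2 : 2 * r ^ 2 * (F + 1) = 1 / 2)
    (hτ : τ = r ^ 3 / (4 * c ^ 2 * (F + 1))) (h : √m ≤ r * √D + c / √(r ^ 3) * I)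
    (hI : I ^ 2 ≤ 2 * J * τ) : (F + 1) * m ≤ D / 2 + J := by
  have hq : √(r ^ 3) ^ 2 = r ^ 3 := Real.sq_sqrt (by positivity)
  have e1 : √m ^ 2 = m := Real.sq_sqrt hm
  have e2 : √D ^ 2 = D := Real.sq_sqrt hD
  have e3 : (c / √(r ^ 3) * I) ^ 2 = c ^ 2 / r ^ 3 * I ^ 2 := by rw [mul_pow, div_pow, hq]
  have n3 := pow_le_pow_left₀ (Real.sqrt_nonneg m) h 2
  have n4 := add_sq_le (a := r * √D) (b := c / √(r ^ 3) * I)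
  rw [e3, mul_pow, e2] at n4
  rw [e1] at n3
  have n5 : c ^ 2 / r ^ 3 * I ^ 2 ≤ J / (2 * (F + 1)) := by
    calc c ^ 2 / r ^ 3 * I ^ 2 ≤ c ^ 2 / r ^ 3 * (2 * J * τ) := by gcongr
      _ = J / (2 * (F + 1)) := by rw [hτ]; field_simp; ring
  calc (F + 1) * m ≤ (F + 1) * (2 * (r ^ 2 * D + J / (2 * (F + 1)))) := by
        gcongr; linarith
    _ = (2 * r ^ 2 * (F + 1)) * D + J := by field_simp
    _ = D / 2 + J := by rw [hr2]; ring

/-- For `e ≤ 1` one has `F + e - (F + 1) m ≤ (F + e) (1 - m)`, so the energy saved by discarding the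
mass `m` pays for the renormalization by `N = 1 - m`. -/
theorem le_of_gain {N m D I F e : ℝ} (hN : 0 < N) (hNm : N = 1 - m) (hm : 0 ≤ m) (hI : 0 ≤ I)
    (he : e ≤ 1) (h : D / 2 + I ≤ F + e - (F + 1) * m) : D / 2 / N + I / √N ≤ F + e := by
  have hs : √N * √N = N := Real.mul_self_sqrt hN.le
  have hs0 : 0 < √N := by positivity
  have hs1 : √N ≤ 1 := by rw [Real.sqrt_le_one]; linarith
  have e1 : D / 2 / N + I / √N = (D / 2 + √N * I) / N := by
    rw [add_div]; congr 1
    rw [div_eq_div_iff hs0.ne' hN.ne']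
    linear_combination (-I) * hs
  rw [e1, div_le_iff₀ hN]
  have h5 : √N * I ≤ I := mul_le_of_le_one_left hI hs1
  have h6 : e * m ≤ 1 * m := by gcongr
  have h8 : (F + e) * N = (F + e) * (1 - m) := by rw [← hNm]
  rw [h8]
  linarith

/-- The localization estimate for `β = 1` at large scales. -/
theorem exists_auxFLoc_le_of_large : ∃ K ℓ₀ : ℝ, 0 ≤ K ∧ 0 < ℓ₀ ∧ ∀ ℓ ≥ ℓ₀,
    (auxFLoc (4 * ℓ) 1).toReal ≤ (auxF 1).toReal + K / ℓ ^ 2 := by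
  obtain ⟨c, hc, hnash⟩ := exists_nash
  obtain ⟨c₁, hc₁, hlow⟩ := exists_lower_bound_integral
  obtain ⟨K, hK0, htr⟩ := exists_truncation
  set F := (auxF 1).toReal with hF
  have hF0 : 0 ≤ F := ENNReal.toReal_nonneg
  -- `r` and, below, `τ` are the values for which `le_of_nash` yields a cost of `F + 1` per unit of
  -- mass.
  set r : ℝ := (2 * √(F + 1))⁻¹ with hr
  have hs0 : 0 < √(F + 1) := by positivity
  have hr0 : 0 < r := by positivity
  have hr2 : 2 * r ^ 2 * (F + 1) = 1 / 2 := by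
    have : √(F + 1) ^ 2 = F + 1 := Real.sq_sqrt (by positivity)
    rw [hr, inv_pow, mul_pow, this]
    field_simp
  set τ : ℝ := r ^ 3 / (4 * c ^ 2 * (F + 1)) with hτ
  have hτ0 : 0 < τ := by positivity
  -- The mass outside the concentration ball will be at most `2 ε`. It has to stay below `1 / 2`,
  -- and its energy `F (2 ε)` below `τ / 4`.
  set ε : ℝ := min (1 / 4) (τ / (8 * (F + 1))) with hε
  have hε0 : 0 < ε := by positivity
  have hε4 : ε ≤ 1 / 4 := min_le_left _ _
  have hετ : F * (2 * ε) ≤ τ / 4 := by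
    have h1 : ε ≤ τ / (8 * (F + 1)) := min_le_right _ _
    rw [le_div_iff₀ (by positivity)] at h1
    nlinarith
  obtain ⟨ν₁, hν₁, ℓ₁, hℓ₁, hconc⟩ := exists_concentration hε0 (by linarith) hc₁
  -- `m₀` bounds both `ν` and `K / ℓ ^ 2`: their sum is then at most one, as `le_of_gain` requires,
  -- and fits into `τ` together with `F (2 ε)`.
  set m₀ : ℝ := min (1 / 2) (τ / 4) with hm₀
  have hm₀0 : 0 < m₀ := by positivity
  refine ⟨K, max ℓ₁ √(K / m₀ + 1), hK0, lt_of_lt_of_le hℓ₁ (le_max_left _ _), fun ℓ hℓ => ?_⟩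
  have hℓ1 : ℓ ≥ ℓ₁ := (le_max_left _ _).trans hℓ
  have hℓ0 : 0 < ℓ := lt_of_lt_of_le hℓ₁ hℓ1
  have hKℓ : K / ℓ ^ 2 ≤ m₀ := by
    have h1 : √(K / m₀ + 1) ≤ ℓ := (le_max_right _ _).trans hℓ
    have h2 := (Real.sqrt_le_left hℓ0.le).1 h1
    have h3 : K / m₀ ≤ ℓ ^ 2 := by linarith
    rw [div_le_iff₀ hm₀0] at h3
    rw [div_le_iff₀ (by positivity)]
    linarith
  have hKℓ0 : 0 ≤ K / ℓ ^ 2 := by positivity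
  -- The threshold for `ℓ` is already fixed, so the excess energy of the almost minimizer may tend
  -- to zero at fixed `ℓ`.
  refine le_of_forall_pos_le_add fun ν' hν' => ?_
  set ν : ℝ := min (min ν₁ m₀) ν' with hν
  have hν0 : 0 < ν := by positivity
  have hνν₁ : ν ≤ ν₁ := (min_le_left _ _).trans (min_le_left _ _)
  have hνm : ν ≤ m₀ := (min_le_left _ _).trans (min_le_right _ _)
  have hνν' : ν ≤ ν' := min_le_right _ _
  have hm2 : m₀ ≤ 1 / 2 := min_le_left _ _
  have hmτ : m₀ ≤ τ / 4 := min_le_right _ _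
  obtain ⟨f, G, h, hN, hE⟩ := exists_isTrial_le (β := 1) zero_le_one hν0
  rw [one_mul, ← hF] at hE
  obtain ⟨y, hy⟩ := hconc ℓ hℓ1 f G h hN (by linarith) (hlow f G h hN (by linarith))
  have hε2 : 1 - (1 - ε) ^ 2 ≤ 2 * ε := by nlinarith [sq_nonneg ε]
  have hE1 : ∀ f₁ G₁, IsTrial f₁ G₁ → ∫ x, ‖f₁ x‖ ^ 2 ≤ 1 →
      F * (∫ x, ‖f₁ x‖ ^ 2) ≤ (∫ x, ‖G₁ x‖ ^ 2) / 2 + √(∫ x, ‖f₁ x‖ ^ 2) * ∫ x, ‖f₁ x‖ := by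
    intro f₁ G₁ h₁ _
    have := auxF_mul_le h₁ (β := 1) zero_le_one
    rwa [one_mul] at this
  -- First truncation, at radius `ℓ`. The inner piece keeps mass at least `1 - 2 ε`, hence energy at
  -- least `F (1 - 2 ε)`. The lost `L¹` norm is therefore at most `ν + K / (2 ℓ²) + 2 ε F`.
  have htail : ∫ x in (Metric.ball y (2 * ℓ))ᶜ, ‖f x‖ ≤ τ := by
    obtain ⟨f₁, G₁, f₂, G₂, h₁, h₂, -, t1, t2, t3, t4, -⟩ := htr f G h hN y ℓ hℓ0
    have hN2 : 0 ≤ ∫ x, ‖f₂ x‖ ^ 2 := by positivity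
    have hD2 : 0 ≤ ∫ x, ‖G₂ x‖ ^ 2 := by positivity
    have hI1 : 0 ≤ ∫ x, ‖f₁ x‖ := by positivity
    have h3 := hE1 f₁ G₁ h₁ (by linarith)
    have h4 : √(∫ x, ‖f₁ x‖ ^ 2) ≤ 1 := by
      rw [Real.sqrt_le_one]; linarith
    have h5 : √(∫ x, ‖f₁ x‖ ^ 2) * (∫ x, ‖f₁ x‖) ≤ ∫ x, ‖f₁ x‖ := mul_le_of_le_one_left hI1 h4
    have h6 : F * (∫ x, ‖f₂ x‖ ^ 2) ≤ F * (2 * ε) := by gcongr; linarith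
    have h7 : F * (∫ x, ‖f₁ x‖ ^ 2) = F - F * (∫ x, ‖f₂ x‖ ^ 2) := by
      rw [← mul_one_sub]; congr 1; linarith
    linarith
  have h2ℓ : (0 : ℝ) < 2 * ℓ := by positivity
  -- Second truncation, at radius `2 ℓ`: the outer piece now lives where the `L¹` tail of `f` is at
  -- most `τ`.
  obtain ⟨f₁, G₁, f₂, G₂, h₁, h₂, hz, t1, t2, t3, t4, t5⟩ := htr f G h hN y (2 * ℓ) h2ℓ
  have hmono : ∫ x in Metric.ball y ℓ, ‖f x‖ ^ 2 ≤ ∫ x in Metric.ball y (2 * ℓ), ‖f x‖ ^ 2 :=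
    setIntegral_mono_set h.memLp_fun.norm.integrable_sq.integrableOn
      (Filter.Eventually.of_forall fun x => by positivity)
      (LE.le.eventuallyLE (Metric.ball_subset_ball (by linarith)))
  set m := ∫ x, ‖f₂ x‖ ^ 2 with hm
  set N₁ := ∫ x, ‖f₁ x‖ ^ 2 with hN₁
  set D₁ := ∫ x, ‖G₁ x‖ ^ 2 with hD₁
  set D₂ := ∫ x, ‖G₂ x‖ ^ 2 with hD₂
  set I := ∫ x, ‖f x‖ with hI
  set I₁ := ∫ x, ‖f₁ x‖ with hI₁
  set I₂ := ∫ x, ‖f₂ x‖ with hI₂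
  have hm0 : 0 ≤ m := by positivity
  have hD20 : 0 ≤ D₂ := by positivity
  have hI10 : 0 ≤ I₁ := by positivity
  have hI20 : 0 ≤ I₂ := by positivity
  have hJ : I₂ ^ 2 ≤ 2 * (I - I₁) * τ := by
    have hJ0 : 0 ≤ I - I₁ := (by positivity : (0 : ℝ) ≤ ∫ x in (Metric.ball y (2 * (2 * ℓ)))ᶜ, ‖f x‖).trans t4
    refine t5.trans ?_
    gcongr
  have hgain : (F + 1) * m ≤ D₂ / 2 + (I - I₁) := by
    have n1 := hnash f₂ G₂ h₂.toIsWeakGrad h₂.integrable r hr0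
    rw [← hm, ← hD₂, ← hI₂] at n1
    exact le_of_nash hc hr0 hF0 hm0 hD20 hr2 hτ n1 hJ
  have hN1 : 1 / 2 ≤ N₁ := by linarith
  have hN10 : 0 < N₁ := by linarith
  have hKq : K / (2 * ℓ) ^ 2 ≤ K / ℓ ^ 2 := by
    gcongr; linarith
  have hbound : D₁ / 2 / N₁ + I₁ / √N₁ ≤ F + (ν + K / ℓ ^ 2) := by
    refine le_of_gain hN10 (by linarith) hm0 hI10 (by linarith) ?_
    linarith
  have hfin := auxFLoc_le_of_isTrial_affine h₁ (β := 1) (L := 4 * ℓ) (l := 1) (a := y) zero_le_one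
    one_pos hN10 (Filter.Eventually.of_forall fun x hx => hz x (by
      rwa [show 2 * (2 * ℓ) = 1 * (4 * ℓ) by ring]))
  simp only [one_pow, one_mul, Real.sqrt_one, div_one] at hfin
  have := ENNReal.toReal_le_of_le_ofReal (by positivity) hfin
  linarith

/-- The localization estimate for `β = 1`. -/
theorem exists_auxFLoc_one_le : ∃ C : ℝ, 0 ≤ C ∧ ∀ L > 0,
    (auxFLoc L 1).toReal ≤ (auxF 1).toReal + C / L ^ 2 := by
  obtain ⟨K, ℓ₀, hK, hℓ₀, hlarge⟩ := exists_auxFLoc_le_of_large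
  obtain ⟨f, h1, h2, h3, h4, h5⟩ := exists_bump one_pos
  have ht := isTrial_of_contDiff h1 h2 h3
  set A := (∫ x, ‖∇ f x‖ ^ 2) / 2 / (∫ x, ‖f x‖ ^ 2) with hA
  set B := (∫ x, ‖f x‖) / √(∫ x, ‖f x‖ ^ 2) with hB
  have hA0 : 0 ≤ A := by positivity
  have hB0 : 0 ≤ B := by positivity
  -- For `L ≤ 4 ℓ₀` a dilated bump has energy `A / L ^ 2 + L ^ (3 / 2) B`, and `M` is the maximum of
  -- `L ^ 2 * L ^ (3 / 2)` in this range.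
  set M := (4 * ℓ₀) ^ 2 * √((4 * ℓ₀) ^ 3) with hM
  have hM0 : 0 ≤ M := by positivity
  have hF0 : 0 ≤ (auxF 1).toReal := ENNReal.toReal_nonneg
  refine ⟨16 * K + (A + M * B), by positivity, fun L hL => ?_⟩
  rcases le_total (4 * ℓ₀) L with hle | hle
  · have h := hlarge (L / 4) (by linarith)
    rw [show 4 * (L / 4) = L by ring] at h
    refine h.trans ?_
    rw [add_div (16 * K)]
    have e : K / (L / 4) ^ 2 = 16 * K / L ^ 2 := by field_simp; norm_num
    have : 0 ≤ (A + M * B) / L ^ 2 := by positivity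
    linarith
  · have hs := auxFLoc_le_of_isTrial_affine ht (β := 1) (L := L) (l := L⁻¹) (a := 0) zero_le_one
      (inv_pos.2 hL) h5 (Filter.Eventually.of_forall fun x hx => h4 x (by
        rwa [inv_mul_cancel₀ hL.ne'] at hx))
    have hs' := ENNReal.toReal_le_of_le_ofReal (by positivity) hs
    rw [← hA, ← hB, inv_pow, inv_pow, Real.sqrt_inv, one_div, inv_inv] at hs'
    have hML : √(L ^ 3) ≤ M / L ^ 2 := by
      rw [le_div_iff₀ (by positivity), hM, mul_comm]
      gcongr
    have h6 : √(L ^ 3) * B ≤ M / L ^ 2 * B := by gcongr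
    have h7 : (16 * K + (A + M * B)) / L ^ 2
        = 16 * K / L ^ 2 + ((L ^ 2)⁻¹ * A + M / L ^ 2 * B) := by
      field_simp
    have h8 : 0 ≤ 16 * K / L ^ 2 := by positivity
    rw [h7]
    linarith

/-- Scaling of the localized auxiliary energy. -/
theorem auxFLoc_scaling {β L l : ℝ} (hβ : 0 ≤ β) (hL : 0 < L) (hl : 0 < l) :
    (auxFLoc L (l ^ 2 * √(l ^ 3) * β)).toReal ≤ l ^ 2 * (auxFLoc (l * L) β).toReal := by
  have hs : 0 < √(l ^ 3) := by positivity
  refine le_of_forall_pos_le_add fun ν hν => ?_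
  obtain ⟨f, G, h, hz, hN, hE⟩ := exists_isTrial_loc_le (L := l * L) hβ (by positivity)
    (ν := ν / l ^ 2) (by positivity)
  have := auxFLoc_le_of_isTrial_affine h (β := l ^ 2 * √(l ^ 3) * β) (L := L) (l := l) (a := 0)
    (by positivity) hl (by rw [hN]; exact one_pos) hz
  rw [hN, Real.sqrt_one, div_one, div_one] at this
  refine (ENNReal.toReal_le_of_le_ofReal (by positivity) this).trans ?_
  calc _ = l ^ 2 * ((∫ x, ‖G x‖ ^ 2) / 2 + β * ∫ x, ‖f x‖) := by field_simp
    _ ≤ l ^ 2 * ((auxFLoc (l * L) β).toReal + ν / l ^ 2) := by gcongr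
    _ = _ := by field_simp

/-- Scaling of the auxiliary energy. -/
theorem auxF_scaling {β l : ℝ} (hβ : 0 ≤ β) (hl : 0 < l) :
    l ^ 2 * (auxF β).toReal ≤ (auxF (l ^ 2 * √(l ^ 3) * β)).toReal := by
  have hs : 0 < √(l ^ 3) := by positivity
  refine le_of_forall_pos_le_add fun ν hν => ?_
  obtain ⟨f, G, h, hN, hE⟩ := exists_isTrial_le (β := l ^ 2 * √(l ^ 3) * β) (by positivity) hν
  have := auxF_le_of_isTrial_dilate h (β := β) (l := l⁻¹) hβ (inv_pos.2 hl)
    (by rw [hN]; exact one_pos)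
  rw [hN, Real.sqrt_one, div_one, div_one, inv_pow, inv_pow, Real.sqrt_inv] at this
  have h2 := ENNReal.toReal_le_of_le_ofReal (by positivity) this
  calc l ^ 2 * (auxF β).toReal
      ≤ l ^ 2 * ((l ^ 2)⁻¹ * ((∫ x, ‖G x‖ ^ 2) / 2) + β / (√(l ^ 3))⁻¹ * ∫ x, ‖f x‖) := by gcongr
    _ = (∫ x, ‖G x‖ ^ 2) / 2 + l ^ 2 * √(l ^ 3) * β * ∫ x, ‖f x‖ := by field_simp
    _ ≤ _ := hE

/-- The localization estimate for the auxiliary energy. -/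
theorem exists_auxFLoc_le : ∃ C : ℝ, 0 ≤ C ∧ ∀ β L : ℝ, 0 < β → 0 < L →
    (auxFLoc L β).toReal ≤ (auxF β).toReal + C / L ^ 2 := by
  obtain ⟨C, hC, h⟩ := exists_auxFLoc_one_le
  refine ⟨C, hC, fun β L hβ hL => ?_⟩
  -- The dilation with `l ^ (7 / 2) = β` reduces to `β = 1` at length `l L`. The error `l ^ 2 * (C /
  -- (l L) ^ 2)` is again `C / L ^ 2`, so the constant is uniform in `β`.
  set l : ℝ := β ^ (2 / 7 : ℝ) with hl
  have hl0 : 0 < l := Real.rpow_pos_of_pos hβ _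
  have e : l ^ 2 * √(l ^ 3) * 1 = β := by
    rw [mul_one, Real.sqrt_eq_rpow, hl, ← Real.rpow_natCast, ← Real.rpow_natCast,
      ← Real.rpow_mul hβ.le, ← Real.rpow_mul hβ.le, ← Real.rpow_mul hβ.le, ← Real.rpow_add hβ]
    norm_num
  have h1 := auxFLoc_scaling (β := 1) zero_le_one hL hl0
  have h2 := auxF_scaling (β := 1) zero_le_one hl0
  rw [e] at h1 h2
  calc (auxFLoc L β).toReal ≤ l ^ 2 * (auxFLoc (l * L) 1).toReal := h1
    _ ≤ l ^ 2 * ((auxF 1).toReal + C / (l * L) ^ 2) := by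
        gcongr; exact h _ (by positivity)
    _ = l ^ 2 * (auxF 1).toReal + C / L ^ 2 := by field_simp
    _ ≤ _ := by gcongr

/-! ### Traces of nonnegative operators -/

section Operators

variable {H : Type*} [NormedAddCommGroup H] [InnerProductSpace ℂ H] [CompleteSpace H]

theorem ofReal_norm_sq_eq_tsum {ι : Type*} (b : HilbertBasis ι ℂ H) (x : H) :
    ENNReal.ofReal (‖x‖ ^ 2) = ∑' i, ENNReal.ofReal (‖⟪b i, x⟫_ℂ‖ ^ 2) := by
  have h := b.hasSum_inner_mul_inner x x
  have h2 : HasSum (fun i => ‖⟪b i, x⟫_ℂ‖ ^ 2) (‖x‖ ^ 2) := by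
    have h3 := Complex.hasSum_re h
    convert h3 using 1
    · ext i
      rw [← inner_conj_symm x (b i), Complex.conj_mul', ← Complex.ofReal_pow, Complex.ofReal_re]
    · exact (inner_self_eq_norm_sq (𝕜 := ℂ) x).symm
  rw [← h2.tsum_eq, ENNReal.ofReal_tsum_of_nonneg (fun i => by positivity) h2.summable]

theorem nonneg_re_inner {T : H →L[ℂ] H} (hT : 0 ≤ T) (x : H) : 0 ≤ (⟪x, T x⟫_ℂ).re :=
  ((ContinuousLinearMap.nonneg_iff_isPositive T).1 hT).re_inner_nonneg_right x

theorem re_inner_le_re_inner {S T : H →L[ℂ] H} (h : S ≤ T) (x : H) :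
    (⟪x, S x⟫_ℂ).re ≤ (⟪x, T x⟫_ℂ).re := by
  have := nonneg_re_inner (sub_nonneg.2 h) x
  rw [_root_.sub_apply, inner_sub_right, Complex.sub_re] at this
  linarith

theorem inner_apply_comm {T : H →L[ℂ] H} (hT : 0 ≤ T) (x y : H) : ⟪T x, y⟫_ℂ = ⟪x, T y⟫_ℂ :=
  ((ContinuousLinearMap.nonneg_iff_isPositive T).1 hT).inner_left_eq_inner_right x y

theorem re_inner_eq_norm_sqrt_sq {T : H →L[ℂ] H} (hT : 0 ≤ T) (x : H) :
    (⟪x, T x⟫_ℂ).re = ‖CFC.sqrt T x‖ ^ 2 := by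
  have h := CFC.sqrt_mul_sqrt_self T hT
  have h2 : T x = CFC.sqrt T (CFC.sqrt T x) := by
    conv_lhs => rw [← h]
    rfl
  rw [h2, ← inner_apply_comm (CFC.sqrt_nonneg T)]
  exact inner_self_eq_norm_sq (𝕜 := ℂ) _

/-- Each diagonal element is `‖√T b_i‖²`, which Parseval's identity expands in the other basis;
self-adjointness of `√T` makes the double sum symmetric. -/
theorem tsum_re_inner_eq_tsum_re_inner {ι κ : Type*} (b : HilbertBasis ι ℂ H)
    (c : HilbertBasis κ ℂ H) {T : H →L[ℂ] H} (hT : 0 ≤ T) :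
    ∑' i, ENNReal.ofReal (⟪b i, T (b i)⟫_ℂ).re = ∑' j, ENNReal.ofReal (⟪c j, T (c j)⟫_ℂ).re := by
  simp only [re_inner_eq_norm_sqrt_sq hT]
  calc ∑' i, ENNReal.ofReal (‖CFC.sqrt T (b i)‖ ^ 2)
      = ∑' i, ∑' j, ENNReal.ofReal (‖⟪c j, CFC.sqrt T (b i)⟫_ℂ‖ ^ 2) := by
        simp only [ofReal_norm_sq_eq_tsum c]
    _ = ∑' j, ∑' i, ENNReal.ofReal (‖⟪c j, CFC.sqrt T (b i)⟫_ℂ‖ ^ 2) := ENNReal.tsum_comm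
    _ = ∑' j, ∑' i, ENNReal.ofReal (‖⟪b i, CFC.sqrt T (c j)⟫_ℂ‖ ^ 2) := by
        simp only [← inner_apply_comm (CFC.sqrt_nonneg T), norm_inner_symm]
    _ = ∑' j, ENNReal.ofReal (‖CFC.sqrt T (c j)‖ ^ 2) := by
        simp only [ofReal_norm_sq_eq_tsum b]

theorem posTrace_eq_tsum {ι : Type*} (b : HilbertBasis ι ℂ H) {T : H →L[ℂ] H} (hT : 0 ≤ T) :
    posTrace T = ∑' i, ENNReal.ofReal (⟪b i, T (b i)⟫_ℂ).re :=
  tsum_re_inner_eq_tsum_re_inner _ b hT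

/-- Distinct basis vectors lie at distance `√2`, so the balls of radius `1 / 2` about them are
disjoint. Countability is needed to interchange the trace with integrals. -/
theorem countable_of_hilbertBasis [SecondCountableTopology H] {ι : Type*}
    (b : HilbertBasis ι ℂ H) : Countable ι := by
  have hdist : ∀ i j, i ≠ j → 1 ≤ dist (b i) (b j) := by
    intro i j hij
    have h1 := b.orthonormal.2 hij
    have h2 : ‖b i - b j‖ ^ 2 = 2 := by
      rw [@norm_sub_sq ℂ, h1, b.orthonormal.1, b.orthonormal.1]; norm_num
    rw [dist_eq_norm]
    nlinarith [norm_nonneg (b i - b j)]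
  refine Pairwise.countable_of_isOpen_disjoint (s := fun i => Metric.ball (b i) (1 / 2))
    (fun i j hij => Metric.ball_disjoint_ball (by linarith [hdist i j hij]))
    (fun i => Metric.isOpen_ball) (fun i => ⟨b i, Metric.mem_ball_self (by norm_num)⟩)

/-! ### The operator `√(K² + A) - K` -/

theorem pow_two_nonneg_of_nonneg {K : H →L[ℂ] H} (hK : 0 ≤ K) : 0 ≤ K ^ 2 := by
  have h : IsSelfAdjoint K := IsSelfAdjoint.of_nonneg hK
  rw [sq]
  nth_rewrite 1 [← h.star_eq]
  exact star_mul_self_nonneg K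

theorem sqrt_sub_nonneg {K A : H →L[ℂ] H} (hK : 0 ≤ K) (hA : 0 ≤ A) :
    0 ≤ CFC.sqrt (K ^ 2 + A) - K := by
  have h := CFC.sqrt_le_sqrt (K ^ 2) (K ^ 2 + A) (le_add_of_nonneg_right hA)
  rw [CFC.sqrt_sq K hK] at h
  exact sub_nonneg.2 h

/-- The Lyapunov inequality `K T + T K ≤ A` for `T = √(K² + A) - K`. -/
theorem two_mul_re_inner_sqrt_sub_le {K A : H →L[ℂ] H} (hK : 0 ≤ K) (hA : 0 ≤ A) (x : H) :
    2 * (⟪K x, (CFC.sqrt (K ^ 2 + A) - K) x⟫_ℂ).re ≤ (⟪x, A x⟫_ℂ).re := by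
  set T := CFC.sqrt (K ^ 2 + A) - K with hT
  have hT0 : 0 ≤ T := sqrt_sub_nonneg hK hA
  have hs : CFC.sqrt (K ^ 2 + A) = K + T := by rw [hT]; abel
  have h := CFC.sqrt_mul_sqrt_self (K ^ 2 + A) (add_nonneg (pow_two_nonneg_of_nonneg hK) hA)
  rw [hs] at h
  -- This is `(K + T)² = K² + A`; the inequality results from dropping `T² ≥ 0`.
  have h2 : A = K * T + T * K + T * T := by
    have : K ^ 2 + A = K ^ 2 + (K * T + T * K + T * T) := by rw [← h]; noncomm_ring
    exact add_left_cancel this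
  have h3 : ⟪x, A x⟫_ℂ = ⟪K x, T x⟫_ℂ + ⟪T x, K x⟫_ℂ + ⟪T x, T x⟫_ℂ := by
    rw [h2]
    simp only [_root_.add_apply, mul_apply_eq_comp, inner_add_right]
    rw [inner_apply_comm hK, inner_apply_comm hT0, inner_apply_comm hT0]
  have h4 : (⟪T x, K x⟫_ℂ).re = (⟪K x, T x⟫_ℂ).re := by
    rw [← inner_conj_symm, Complex.conj_re]
  have h5 : 0 ≤ (⟪T x, T x⟫_ℂ).re := inner_self_nonneg (𝕜 := ℂ)
  rw [h3, Complex.add_re, Complex.add_re, h4]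
  linarith

/-- The square root is operator concave, and neither the shift by `K ^ 2` nor the subtraction of `K`
affects concavity. -/
theorem concaveOn_re_inner_sqrt_sub {K : H →L[ℂ] H} (hK : 0 ≤ K) (x : H) :
    ConcaveOn ℝ (Ici (0 : H →L[ℂ] H))
      fun A => (⟪x, (CFC.sqrt (K ^ 2 + A) - K) x⟫_ℂ).re := by
  have hc := CFC.concaveOn_rpow (A := H →L[ℂ] H) (p := 1 / 2) (by norm_num)
  simp only [← CFC.sqrt_eq_rpow] at hc
  refine ⟨convex_Ici _, fun A hA B hB a b ha hb hab => ?_⟩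
  have hK2 := pow_two_nonneg_of_nonneg hK
  have h := hc.2 (x := K ^ 2 + A) (y := K ^ 2 + B) (add_nonneg hK2 hA) (add_nonneg hK2 hB) ha hb hab
  have e : a • (K ^ 2 + A) + b • (K ^ 2 + B) = K ^ 2 + (a • A + b • B) := by
    rw [smul_add, smul_add, add_add_add_comm, ← add_smul, hab, one_smul]
  rw [e] at h
  have h2 := re_inner_le_re_inner h x
  have hre : ∀ (r : ℝ) (z : ℂ), ((r : ℂ) * z).re = r * z.re := fun r z => Complex.re_ofReal_mul r z
  have hsm : ∀ (r : ℝ) (S : H →L[ℂ] H), (⟪x, (r • S) x⟫_ℂ).re = r * (⟪x, S x⟫_ℂ).re := by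
    intro r S
    rw [_root_.smul_apply, inner_smul_right_eq_smul, Complex.smul_re, smul_eq_mul]
  have hsub : ∀ S : H →L[ℂ] H, (⟪x, (S - K) x⟫_ℂ).re = (⟪x, S x⟫_ℂ).re - (⟪x, K x⟫_ℂ).re := by
    intro S
    rw [_root_.sub_apply, inner_sub_right, Complex.sub_re]
  rw [_root_.add_apply, inner_add_right, Complex.add_re, hsm, hsm] at h2
  simp only [hsub, smul_eq_mul]
  have : (⟪x, K x⟫_ℂ).re = a * (⟪x, K x⟫_ℂ).re + b * (⟪x, K x⟫_ℂ).re := by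
    rw [← add_mul, hab, one_mul]
  linarith

theorem continuousOn_re_inner_sqrt_sub {K : H →L[ℂ] H} (hK : 0 ≤ K) (x : H) :
    ContinuousOn (fun A => (⟪x, (CFC.sqrt (K ^ 2 + A) - K) x⟫_ℂ).re) (Ici (0 : H →L[ℂ] H)) := by
  have h1 : ContinuousOn (fun A : H →L[ℂ] H => CFC.sqrt (K ^ 2 + A)) (Ici 0) :=
    CFC.continuousOn_sqrt.comp (by fun_prop) fun A hA =>
      add_nonneg (pow_two_nonneg_of_nonneg hK) hA
  have h2 : Continuous fun S : H →L[ℂ] H => (⟪x, (S - K) x⟫_ℂ).re := by fun_prop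
  exact h2.comp_continuousOn h1

theorem traceSqrtSub_eq_tsum {ι : Type*} (b : HilbertBasis ι ℂ H) {K A : H →L[ℂ] H} (hK : 0 ≤ K)
    (hA : 0 ≤ A) : traceSqrtSub K A
      = ∑' i, ENNReal.ofReal (⟪b i, (CFC.sqrt (K ^ 2 + A) - K) (b i)⟫_ℂ).re :=
  posTrace_eq_tsum b (sqrt_sub_nonneg hK hA)

/-- Jensen's inequality for the concave functional `A ↦ Tr(√(K² + A) - K)`. -/
theorem lintegral_traceSqrtSub_le [SecondCountableTopology H] {Y : Type*} [TopologicalSpace Y]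
    [SecondCountableTopology Y] [MeasurableSpace Y] [OpensMeasurableSpace Y] {ν : Measure Y}
    [IsProbabilityMeasure ν] {K : H →L[ℂ] H} (hK : 0 ≤ K) {A : Y → H →L[ℂ] H} (hA : ∀ y, 0 ≤ A y)
    {C : ℝ} (hC : ∀ y, ‖A y‖ ≤ C) {s : Set Y} (hs : MeasurableSet s) (hνs : ν.restrict s = ν)
    (hAs : ContinuousOn A s) :
    ∫⁻ y, traceSqrtSub K (A y) ∂ν ≤ traceSqrtSub K (∫ y, A y ∂ν) := by
  -- The space of bounded operators need not be separable in norm; strong measurability comes from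
  -- continuity on `s` and the second countability of `Y`.
  have hmA : AEStronglyMeasurable A ν := by
    have := hAs.aestronglyMeasurable (μ := ν) hs
    rwa [hνs] at this
  have hiA : Integrable A ν := Integrable.of_bound hmA C (Filter.Eventually.of_forall hC)
  have hcl : IsClosed (Ici (0 : H →L[ℂ] H)) := isClosed_Ici
  have hA0 : 0 ≤ ∫ y, A y ∂ν := by
    have := (convex_Ici (𝕜 := ℝ) (0 : H →L[ℂ] H)).integral_mem hcl
      (Filter.Eventually.of_forall hA) hiA
    exact this
  set b := (exists_hilbertBasis ℂ H).choose_spec.choose with hb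
  have : Countable (exists_hilbertBasis ℂ H).choose := countable_of_hilbertBasis b
  set g : H → (H →L[ℂ] H) → ℝ := fun x A => (⟪x, (CFC.sqrt (K ^ 2 + A) - K) x⟫_ℂ).re with hg
  have hgm : ∀ x, AEStronglyMeasurable (fun y => g x (A y)) ν := by
    intro x
    have h1 : ContinuousOn (fun y => g x (A y)) s :=
      (continuousOn_re_inner_sqrt_sub hK x).comp hAs fun y _ => hA y
    have h2 := h1.aestronglyMeasurable (μ := ν) hs
    rwa [hνs] at h2
  have hg0 : ∀ x y, 0 ≤ g x (A y) := fun x y => nonneg_re_inner (sqrt_sub_nonneg hK (hA y)) x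
  have hgi : ∀ x, Integrable (fun y => g x (A y)) ν := by
    intro x
    refine Integrable.of_bound (hgm x) (‖x‖ * ((√(‖K ^ 2‖ + C) + ‖K‖) * ‖x‖))
      (Filter.Eventually.of_forall fun y => ?_)
    have h1 : ‖CFC.sqrt (K ^ 2 + A y) - K‖ ≤ √(‖K ^ 2‖ + C) + ‖K‖ := by
      refine (norm_sub_le _ _).trans (add_le_add_left ?_ _)
      rw [CFC.norm_sqrt (K ^ 2 + A y) (add_nonneg (pow_two_nonneg_of_nonneg hK) (hA y))]
      exact Real.sqrt_le_sqrt ((norm_add_le _ _).trans (by linarith [hC y]))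
    calc ‖g x (A y)‖ ≤ ‖⟪x, (CFC.sqrt (K ^ 2 + A y) - K) x⟫_ℂ‖ := Complex.abs_re_le_norm _
      _ ≤ ‖x‖ * ‖(CFC.sqrt (K ^ 2 + A y) - K) x‖ := norm_inner_le_norm _ _
      _ ≤ ‖x‖ * (‖CFC.sqrt (K ^ 2 + A y) - K‖ * ‖x‖) := by
          gcongr; exact ContinuousLinearMap.le_opNorm _ _
      _ ≤ _ := by gcongr
  -- In a countable basis the claim reduces to the scalar Jensen inequality for each diagonal matrix
  -- element.
  calc ∫⁻ y, traceSqrtSub K (A y) ∂ν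
      = ∫⁻ y, ∑' i, ENNReal.ofReal (g (b i) (A y)) ∂ν := by
        refine lintegral_congr fun y => traceSqrtSub_eq_tsum b hK (hA y)
    _ = ∑' i, ∫⁻ y, ENNReal.ofReal (g (b i) (A y)) ∂ν :=
        lintegral_tsum fun i => (hgm (b i)).aemeasurable.ennreal_ofReal
    _ = ∑' i, ENNReal.ofReal (∫ y, g (b i) (A y) ∂ν) := by
        refine tsum_congr fun i => ?_
        rw [ofReal_integral_eq_lintegral_ofReal (hgi _) (Filter.Eventually.of_forall (hg0 _))]
    _ ≤ ∑' i, ENNReal.ofReal (g (b i) (∫ y, A y ∂ν)) := by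
        refine ENNReal.tsum_le_tsum fun i => ENNReal.ofReal_le_ofReal ?_
        exact (concaveOn_re_inner_sqrt_sub hK (b i)).le_map_integral
          (continuousOn_re_inner_sqrt_sub hK (b i)) hcl (Filter.Eventually.of_forall hA) hiA (hgi _)
    _ = traceSqrtSub K (∫ y, A y ∂ν) := (traceSqrtSub_eq_tsum b hK hA0).symm

/-- Unitary invariance of `Tr(√(K² + A) - K)`. -/
theorem traceSqrtSub_conj (U : H ≃ₗᵢ[ℂ] H) {K A B : H →L[ℂ] H} (hK : 0 ≤ K) (hA : 0 ≤ A)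
    (hB : 0 ≤ B) (hKU : ∀ x, K (U x) = U (K x)) (hAU : ∀ x, A (U x) = U (B x)) :
    traceSqrtSub K A = traceSqrtSub K B := by
  set V : H →L[ℂ] H := U.toContinuousLinearEquiv.toContinuousLinearMap with hV
  set W : H →L[ℂ] H := U.symm.toContinuousLinearEquiv.toContinuousLinearMap with hW
  have hVx : ∀ x, V x = U x := fun x => rfl
  have hWx : ∀ x, W x = U.symm x := fun x => rfl
  set S := CFC.sqrt (K ^ 2 + A) with hS
  have hS0 : 0 ≤ S := CFC.sqrt_nonneg _
  have hSS : S * S = K ^ 2 + A :=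
    CFC.sqrt_mul_sqrt_self _ (add_nonneg (pow_two_nonneg_of_nonneg hK) hA)
  -- Uniqueness of the nonnegative square root: conjugating by `U` turns `K ^ 2 + A` into `K ^ 2 +
  -- B`.
  have hR : CFC.sqrt (K ^ 2 + B) = W * S * V := by
    refine CFC.sqrt_unique ?_ ?_
    · ext x
      have h1 : S (S (U x)) = K (K (U x)) + A (U x) := by
        have := congrArg (fun T : H →L[ℂ] H => T (U x)) hSS
        simpa [sq] using this
      simp only [mul_apply_eq_comp, hVx, hWx, LinearIsometryEquiv.apply_symm_apply, h1,
        _root_.add_apply, sq, hKU, hAU, map_add, LinearIsometryEquiv.symm_apply_apply]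
    · rw [ContinuousLinearMap.nonneg_iff_isPositive, ContinuousLinearMap.isPositive_iff_complex]
      intro x
      have h1 : ⟪(W * S * V) x, x⟫_ℂ = ⟪S (U x), U x⟫_ℂ := by
        rw [← U.inner_map_map]
        simp only [mul_apply_eq_comp, hVx, hWx, LinearIsometryEquiv.apply_symm_apply]
      rw [h1]
      exact (ContinuousLinearMap.isPositive_iff_complex S).1
        ((ContinuousLinearMap.nonneg_iff_isPositive S).1 hS0) (U x)
  obtain ⟨w, c, -⟩ := exists_hilbertBasis ℂ H
  let d : HilbertBasis w ℂ H := HilbertBasis.ofRepr (U.symm.trans c.repr)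
  have hd : ∀ i, d i = U (c i) := by
    classical
    intro i
    rw [← d.repr_symm_single, ← c.repr_symm_single]
    rfl
  rw [traceSqrtSub_eq_tsum d hK hA, traceSqrtSub_eq_tsum c hK hB]
  refine tsum_congr fun i => ?_
  congr 2
  rw [hd, hR, _root_.sub_apply, _root_.sub_apply, hKU, ← hS]
  have : S (U (c i)) = U ((W * S * V) (c i)) := by
    simp only [mul_apply_eq_comp, hVx, hWx, LinearIsometryEquiv.apply_symm_apply]
  rw [this, ← map_sub, LinearIsometryEquiv.inner_map_map]

end Operators

/-! ### The Lyapunov equation -/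

section Lyapunov

variable {H : Type*} [NormedAddCommGroup H] [InnerProductSpace ℂ H] [CompleteSpace H]

/-- The quadratic form of `√(K² + A) - K` is controlled by that of the solution
`∫ e^{-sK} A e^{-sK} ds` of the Lyapunov equation. -/
theorem ofReal_re_inner_sqrt_sub_le_lintegral {K A : H →L[ℂ] H} (hK0 : 0 ≤ K) (hA : 0 ≤ A)
    {F : ℝ → H} (hFd : ∀ s, HasDerivAt F (-K (F s)) s)
    (hF : Filter.Tendsto (fun s => ‖F s‖ ^ 2) Filter.atTop (nhds 0)) :
    ENNReal.ofReal (⟪F 0, (CFC.sqrt (K ^ 2 + A) - K) (F 0)⟫_ℂ).re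
      ≤ ∫⁻ s in Ioi (0 : ℝ), ENNReal.ofReal (⟪F s, A (F s)⟫_ℂ).re := by
  set T := CFC.sqrt (K ^ 2 + A) - K with hT
  have hT0 : 0 ≤ T := sqrt_sub_nonneg hK0 hA
  have hFc : Continuous F := continuous_iff_continuousAt.2 fun s => (hFd s).continuousAt
  set u : ℝ → ℝ := fun s => (⟪F s, T (F s)⟫_ℂ).re with hu
  set a : ℝ → ℝ := fun s => (⟪F s, A (F s)⟫_ℂ).re with ha
  have hac : Continuous a := by fun_prop
  have ha0 : ∀ s, 0 ≤ a s := fun s => nonneg_re_inner hA _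
  have hu0 : ∀ s, 0 ≤ u s := fun s => nonneg_re_inner hT0 _
  have hud : ∀ s, HasDerivAt u (-(2 * (⟪K (F s), T (F s)⟫_ℂ).re)) s := by
    intro s
    have h1 : HasDerivAt (fun s => T (F s)) (T (-K (F s))) s :=
      (T.restrictScalars ℝ).hasFDerivAt.comp_hasDerivAt s (hFd s)
    have h2 := (hFd s).inner ℂ h1
    have h3 : HasDerivAt u (Complex.reCLM (⟪F s, T (-K (F s))⟫_ℂ + ⟪-K (F s), T (F s)⟫_ℂ)) s :=
      Complex.reCLM.hasFDerivAt.comp_hasDerivAt s h2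
    convert h3 using 1
    rw [← inner_apply_comm hT0 (F s) (-K (F s)), inner_neg_right, inner_neg_left, Complex.reCLM_apply,
      Complex.add_re, Complex.neg_re, Complex.neg_re]
    have : (⟪T (F s), K (F s)⟫_ℂ).re = (⟪K (F s), T (F s)⟫_ℂ).re := by
      rw [← inner_conj_symm, Complex.conj_re]
    rw [this]; ring
  -- The Lyapunov inequality says `u' ≥ -a`; integrate it over `[0, R]`, where `u R` vanishes in the
  -- limit.
  have hkey : ∀ R : ℝ, 0 ≤ R → u 0 ≤ u R + ∫ s in (0)..R, a s := by
    intro R hR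
    have hc : Continuous fun s => -(2 * (⟪K (F s), T (F s)⟫_ℂ).re) := by fun_prop
    have h1 := intervalIntegral.integral_eq_sub_of_hasDerivAt (a := 0) (b := R)
      (fun s _ => hud s) (hc.intervalIntegrable 0 R)
    have h2 : ∫ s in (0)..R, -(2 * (⟪K (F s), T (F s)⟫_ℂ).re) ≥ ∫ s in (0)..R, -a s := by
      refine intervalIntegral.integral_mono_on hR (hac.neg.intervalIntegrable 0 R)
        (hc.intervalIntegrable 0 R) fun s _ => ?_
      exact neg_le_neg (two_mul_re_inner_sqrt_sub_le hK0 hA (F s))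
    rw [intervalIntegral.integral_neg (f := a)] at h2
    linarith
  have hulim : Filter.Tendsto u Filter.atTop (nhds 0) := by
    have h1 := hF.const_mul ‖T‖
    rw [mul_zero] at h1
    refine squeeze_zero hu0 (fun s => ?_) h1
    calc u s ≤ ‖⟪F s, T (F s)⟫_ℂ‖ := Complex.re_le_norm _
      _ ≤ ‖F s‖ * (‖T‖ * ‖F s‖) := (norm_inner_le_norm _ _).trans (by
          gcongr; exact T.le_opNorm _)
      _ = ‖T‖ * ‖F s‖ ^ 2 := by ring
  change ENNReal.ofReal (u 0) ≤ _
  have hlim2 : Filter.Tendsto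
      (fun R => ENNReal.ofReal (u R) + ∫⁻ s in Ioi (0 : ℝ), ENNReal.ofReal (a s)) Filter.atTop
      (nhds (ENNReal.ofReal 0 + ∫⁻ s in Ioi (0 : ℝ), ENNReal.ofReal (a s))) :=
    ((ENNReal.continuous_ofReal.tendsto 0).comp hulim).add tendsto_const_nhds
  rw [ENNReal.ofReal_zero, zero_add] at hlim2
  refine ge_of_tendsto hlim2 ?_
  filter_upwards [Filter.eventually_ge_atTop 0] with R hR
  refine (ENNReal.ofReal_le_ofReal (hkey R hR)).trans (ENNReal.ofReal_add_le.trans ?_)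
  gcongr
  rw [intervalIntegral.integral_of_le hR, ofReal_integral_eq_lintegral_ofReal
    ((hac.integrableOn_Icc (a := 0) (b := R)).mono_set Ioc_subset_Icc_self)
    (Filter.Eventually.of_forall ha0)]
  exact lintegral_mono_set Ioc_subset_Ioi_self

theorem traceSqrtSub_le_tsum {ι : Type*} (b : HilbertBasis ι ℂ H) {K A : H →L[ℂ] H} (hK : 0 ≤ K)
    (hA : 0 ≤ A) {D : ℝ → H →L[ℂ] H} (hD0 : ∀ f, D 0 f = f)
    (hD : ∀ s f, HasDerivAt (fun s => D s f) (-K (D s f)) s)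
    (hDt : ∀ f, Filter.Tendsto (fun s => ‖D s f‖ ^ 2) Filter.atTop (nhds 0)) :
    traceSqrtSub K A
      ≤ ∑' i, ∫⁻ s in Ioi (0 : ℝ), ENNReal.ofReal (⟪D s (b i), A (D s (b i))⟫_ℂ).re := by
  rw [traceSqrtSub_eq_tsum b hK hA]
  refine ENNReal.tsum_le_tsum fun i => ?_
  have h := ofReal_re_inner_sqrt_sub_le_lintegral hK hA (fun s => hD s (b i)) (hDt (b i))
  rwa [hD0] at h

end Lyapunov

/-! ### Multiplication operators on the one-photon space -/

section Multipliers

variable {σ Λ : ℝ}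

/-- `M` is the operator of multiplication by `m` on the one-photon space. -/
def IsMult (m : E3 → ℂ) (M : photonSpace σ Λ →L[ℂ] photonSpace σ Λ) : Prop :=
  ∀ f, ((M f : L2Shell σ Λ) : E3 → C3)
    =ᵐ[(volume : Measure E3).restrict (shell σ Λ)] fun k => m k • (f : L2Shell σ Λ) k

theorem ae_mem_shell : ∀ᵐ k ∂((volume : Measure E3).restrict (shell σ Λ)), k ∈ shell σ Λ :=
  ae_restrict_mem (measurableSet_shell σ Λ)

theorem isMult_absK : IsMult (fun k => ((‖k‖ : ℝ) : ℂ)) (absK σ Λ) := fun f =>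
  (memLp_norm_smul σ Λ f.1).coeFn_toLp

theorem photonSpace_ext {f g : photonSpace σ Λ}
    (h : (f : L2Shell σ Λ) =ᵐ[(volume : Measure E3).restrict (shell σ Λ)] (g : L2Shell σ Λ)) :
    f = g := Subtype.ext (Lp.ext h)

theorem exists_isMult {m : E3 → ℂ} (hm : Continuous m) {C : ℝ}
    (hC : ∀ k ∈ shell σ Λ, ‖m k‖ ≤ C) :
    ∃ M : photonSpace σ Λ →L[ℂ] photonSpace σ Λ, IsMult m M := by
  have hae : ∀ f : L2Shell σ Λ, ∀ᵐ k ∂((volume : Measure E3).restrict (shell σ Λ)),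
      ‖m k • f k‖ ≤ C * ‖f k‖ := fun f => by
    filter_upwards [ae_mem_shell] with k hk
    rw [norm_smul]
    exact mul_le_mul_of_nonneg_right (hC k hk) (norm_nonneg _)
  have hmem : ∀ f : L2Shell σ Λ, MemLp (fun k => m k • f k) 2
      ((volume : Measure E3).restrict (shell σ Λ)) := fun f =>
    (Lp.memLp f).of_le_mul (hm.aestronglyMeasurable.smul (Lp.aestronglyMeasurable f)) (hae f)
  let L : photonSpace σ Λ →ₗ[ℂ] photonSpace σ Λ :=
    { toFun := fun f => ⟨(hmem f.1).toLp _, by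
        change ∀ᵐ k ∂((volume : Measure E3).restrict (shell σ Λ)), _
        filter_upwards [(hmem f.1).coeFn_toLp, f.2] with k h1 h2
        have : ∀ i, (k i : ℂ) * (m k * f.1 k i) = m k * ((k i : ℂ) * f.1 k i) := fun i => by ring
        simp only [h1, PiLp.smul_apply, smul_eq_mul, this, ← Finset.mul_sum, h2, mul_zero]⟩
      map_add' := by
        intro f g
        apply photonSpace_ext
        filter_upwards [(hmem (f + g).1).coeFn_toLp, (hmem f.1).coeFn_toLp, (hmem g.1).coeFn_toLp,
          Lp.coeFn_add f.1 g.1, Lp.coeFn_add ((hmem f.1).toLp _) ((hmem g.1).toLp _)]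
          with k h1 h2 h3 h4 h5
        simp only [Submodule.coe_add] at h1 ⊢
        rw [h1, h5, Pi.add_apply, h2, h3, h4, Pi.add_apply, smul_add]
      map_smul' := by
        intro c f
        apply photonSpace_ext
        filter_upwards [(hmem (c • f).1).coeFn_toLp, (hmem f.1).coeFn_toLp, Lp.coeFn_smul c f.1,
          Lp.coeFn_smul c ((hmem f.1).toLp _)] with k h1 h2 h3 h4
        simp only [Submodule.coe_smul, RingHom.id_apply] at h1 ⊢
        rw [h1, h4, Pi.smul_apply, h2, h3, Pi.smul_apply, smul_comm] }
  refine ⟨L.mkContinuous C fun f => ?_, fun f => (hmem f.1).coeFn_toLp⟩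
  refine Lp.norm_le_mul_norm_of_ae_le_mul (f := (hmem f.1).toLp _) (g := f.1) ?_
  filter_upwards [(hmem f.1).coeFn_toLp, hae f.1] with k h1 h2
  rwa [h1]

theorem inner_photonSpace (f g : photonSpace σ Λ) :
    ⟪f, g⟫_ℂ = ∫ k in shell σ Λ, ⟪(f : L2Shell σ Λ) k, (g : L2Shell σ Λ) k⟫_ℂ := by
  rw [Submodule.coe_inner, L2.inner_def]

theorem norm_sq_photonSpace (f : photonSpace σ Λ) :
    ‖f‖ ^ 2 = ∫ k in shell σ Λ, ‖(f : L2Shell σ Λ) k‖ ^ 2 := by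
  have h1 : ((‖f‖ ^ 2 : ℝ) : ℂ) = ⟪f, f⟫_ℂ := by
    refine Eq.trans ?_ (inner_self_eq_norm_sq_to_K (𝕜 := ℂ) f).symm
    norm_cast
  have h2 : ⟪f, f⟫_ℂ = ((∫ k in shell σ Λ, ‖(f : L2Shell σ Λ) k‖ ^ 2 : ℝ) : ℂ) := by
    rw [inner_photonSpace, ← integral_complex_ofReal]
    refine integral_congr_ae (Filter.Eventually.of_forall fun k => ?_)
    simp only [inner_self_eq_norm_sq_to_K]
    norm_cast
  exact_mod_cast h1.trans h2

theorem absK_nonneg : 0 ≤ absK σ Λ := by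
  rw [ContinuousLinearMap.nonneg_iff_isPositive, ContinuousLinearMap.isPositive_iff_complex]
  intro f
  have h : ⟪absK σ Λ f, f⟫_ℂ
      = ((∫ k in shell σ Λ, ‖k‖ * ‖(f : L2Shell σ Λ) k‖ ^ 2 : ℝ) : ℂ) := by
    rw [inner_photonSpace, ← integral_complex_ofReal]
    refine integral_congr_ae ?_
    filter_upwards [isMult_absK f] with k hk
    rw [hk, inner_smul_left, inner_self_eq_norm_sq_to_K]
    simp
  rw [h]
  refine ⟨by simp, ?_⟩
  simp only [RCLike.re_to_complex, Complex.ofReal_re]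
  positivity

instance : SecondCountableTopology (photonSpace σ Λ) := by
  have : Fact ((2 : ℝ≥0∞) ≠ ⊤) := ⟨by norm_num⟩
  have : SecondCountableTopology (L2Shell σ Λ) := inferInstance
  exact inferInstanceAs (SecondCountableTopology (photonSpace σ Λ : Set (L2Shell σ Λ)))

/-! ### The semigroup generated by `-|k|` -/

theorem continuous_decay (s : ℝ) : Continuous fun k : E3 => ((Real.exp (-(s * ‖k‖)) : ℝ) : ℂ) := by
  fun_prop

theorem norm_decay_le (s : ℝ) : ∀ k ∈ shell σ Λ,
    ‖((Real.exp (-(s * ‖k‖)) : ℝ) : ℂ)‖ ≤ Real.exp (|s| * Λ) := by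
  intro k hk
  rw [Complex.norm_real, Real.norm_of_nonneg (Real.exp_pos _).le, Real.exp_le_exp]
  have h1 : -(s * ‖k‖) ≤ |s| * ‖k‖ := by
    rw [← neg_mul]
    exact mul_le_mul_of_nonneg_right (neg_le_abs s) (norm_nonneg _)
  exact h1.trans (mul_le_mul_of_nonneg_left hk.2.le (abs_nonneg s))

/-- The semigroup `e^{-s|k|}`. -/
noncomputable def decay (σ Λ s : ℝ) : photonSpace σ Λ →L[ℂ] photonSpace σ Λ :=
  (exists_isMult (continuous_decay s) (norm_decay_le (σ := σ) (Λ := Λ) s)).choose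

theorem isMult_decay (s : ℝ) :
    IsMult (fun k => ((Real.exp (-(s * ‖k‖)) : ℝ) : ℂ)) (decay σ Λ s) :=
  (exists_isMult (continuous_decay s) (norm_decay_le (σ := σ) (Λ := Λ) s)).choose_spec

theorem decay_zero (f : photonSpace σ Λ) : decay σ Λ 0 f = f := by
  apply photonSpace_ext
  filter_upwards [isMult_decay 0 f] with k hk
  rw [hk]; simp

theorem decay_add (s t : ℝ) (f : photonSpace σ Λ) :
    decay σ Λ (s + t) f = decay σ Λ s (decay σ Λ t f) := by
  apply photonSpace_ext
  filter_upwards [isMult_decay (s + t) f, isMult_decay s (decay σ Λ t f), isMult_decay t f]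
    with k h1 h2 h3
  rw [h1, h2, h3, smul_smul, ← Complex.ofReal_mul, ← Real.exp_add]
  congr 3
  ring

/-- On the shell `|k| < Λ`, so `|e^t - 1 - t| ≤ t²` for `|t| ≤ 1` gives a remainder of order `h²` in
norm, uniformly in `k`. -/
theorem hasDerivAt_decay_zero (f : photonSpace σ Λ) :
    HasDerivAt (fun s => decay σ Λ s f) (-absK σ Λ f) 0 := by
  rw [hasDerivAt_iff_isLittleO_nhds_zero]
  have hbound : ∀ h : ℝ, |h| * |Λ| ≤ 1 →
      ‖decay σ Λ (0 + h) f - decay σ Λ 0 f - h • -absK σ Λ f‖ ≤ (h ^ 2 * Λ ^ 2) * ‖f‖ := by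
    intro h hh
    refine Lp.norm_le_mul_norm_of_ae_le_mul
      (f := (decay σ Λ (0 + h) f - decay σ Λ 0 f - h • -absK σ Λ f : photonSpace σ Λ).1)
      (g := f.1) ?_
    rw [zero_add, decay_zero]
    have e1 : ((decay σ Λ h f - f - h • -absK σ Λ f : photonSpace σ Λ) : L2Shell σ Λ)
        = (decay σ Λ h f : L2Shell σ Λ) - f.1 + ((h : ℂ) • (absK σ Λ f : L2Shell σ Λ)) := by
      simp only [Submodule.coe_sub, smul_neg, sub_neg_eq_add, Submodule.coe_add]
      rfl
    rw [e1]
    filter_upwards [isMult_decay h f, isMult_absK f, ae_mem_shell,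
      Lp.coeFn_add ((decay σ Λ h f : L2Shell σ Λ) - f.1) ((h : ℂ) • (absK σ Λ f : L2Shell σ Λ)),
      Lp.coeFn_sub (decay σ Λ h f : L2Shell σ Λ) f.1,
      Lp.coeFn_smul (h : ℂ) (absK σ Λ f : L2Shell σ Λ)] with k h1 h2 h3 h4 h5 h6
    rw [h4, Pi.add_apply, h5, Pi.sub_apply, h6, Pi.smul_apply, h1, h2, smul_smul]
    have e2 : ((Real.exp (-(h * ‖k‖)) : ℝ) : ℂ) • (f : L2Shell σ Λ) k - (f : L2Shell σ Λ) k
        + ((h : ℂ) * ((‖k‖ : ℝ) : ℂ)) • (f : L2Shell σ Λ) k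
        = ((Real.exp (-(h * ‖k‖)) - 1 - -(h * ‖k‖) : ℝ) : ℂ) • (f : L2Shell σ Λ) k := by
      push_cast
      module
    rw [e2, norm_smul, Complex.norm_real]
    refine mul_le_mul_of_nonneg_right ?_ (norm_nonneg _)
    have hkΛ : ‖k‖ ≤ |Λ| := h3.2.le.trans (le_abs_self _)
    have h7 : |-(h * ‖k‖)| ≤ 1 := by
      rw [abs_neg, abs_mul, abs_norm]
      exact (mul_le_mul_of_nonneg_left hkΛ (abs_nonneg h)).trans hh
    refine (Real.abs_exp_sub_one_sub_id_le h7).trans ?_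
    rw [neg_sq, mul_pow]
    have : ‖k‖ ^ 2 ≤ Λ ^ 2 := by
      rw [← sq_abs Λ]; gcongr
    gcongr
  refine Asymptotics.IsBigO.trans_isLittleO (g := fun h : ℝ => h ^ 2) ?_ ?_
  · refine Asymptotics.IsBigO.of_bound (Λ ^ 2 * ‖f‖) ?_
    have hev : ∀ᶠ h : ℝ in nhds 0, |h| * |Λ| < 1 := by
      have hc : Continuous fun h : ℝ => |h| * |Λ| := by fun_prop
      exact hc.continuousAt.eventually_lt continuousAt_const (by simp)
    filter_upwards [hev] with h hh
    refine (hbound h hh.le).trans (le_of_eq ?_)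
    rw [Real.norm_of_nonneg (by positivity)]
    ring
  · have := Asymptotics.isLittleO_pow_id (𝕜 := ℝ) (n := 2) (by norm_num)
    simpa using this

theorem hasDerivAt_decay (s : ℝ) (f : photonSpace σ Λ) :
    HasDerivAt (fun s => decay σ Λ s f) (-absK σ Λ (decay σ Λ s f)) s := by
  have h := hasDerivAt_decay_zero (decay σ Λ s f)
  have h2 : HasDerivAt (fun t => decay σ Λ (t - s) (decay σ Λ s f))
      (-absK σ Λ (decay σ Λ s f)) s := by
    have h3 := HasDerivAt.scomp (h := fun t : ℝ => t - s) (h' := 1) s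
      (by rw [sub_self]; exact h) ((hasDerivAt_id s).sub_const s)
    simpa [Function.comp_def] using h3
  refine h2.congr_of_eventuallyEq (Filter.Eventually.of_forall fun t => ?_)
  simp only
  rw [← decay_add, sub_add_cancel]

/-- Dominated convergence. For `σ = 0` there is no uniform decay rate, but the point `k = 0` is a
null set. -/
theorem tendsto_norm_decay_sq (f : photonSpace σ Λ) :
    Filter.Tendsto (fun s => ‖decay σ Λ s f‖ ^ 2) Filter.atTop (nhds 0) := by
  have h1 : ∀ s, ‖decay σ Λ s f‖ ^ 2
      = ∫ k in shell σ Λ, Real.exp (-(s * ‖k‖)) ^ 2 * ‖(f : L2Shell σ Λ) k‖ ^ 2 := by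
    intro s
    rw [norm_sq_photonSpace]
    refine integral_congr_ae ?_
    filter_upwards [isMult_decay s f] with k hk
    rw [hk, norm_smul, Complex.norm_real, Real.norm_of_nonneg (Real.exp_pos _).le, mul_pow]
  simp only [h1]
  have hz : (0 : ℝ) = ∫ k in shell σ Λ, (0 : ℝ) := by simp
  rw [hz]
  have hint : Integrable (fun k => ‖(f : L2Shell σ Λ) k‖ ^ 2)
      ((volume : Measure E3).restrict (shell σ Λ)) := (Lp.memLp f.1).norm.integrable_sq
  refine tendsto_integral_filter_of_dominated_convergence
    (fun k => ‖(f : L2Shell σ Λ) k‖ ^ 2) ?_ ?_ hint ?_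
  · refine Filter.Eventually.of_forall fun s => ?_
    exact (by fun_prop : Continuous fun k : E3 => Real.exp (-(s * ‖k‖)) ^ 2).aestronglyMeasurable.mul
      hint.1
  · filter_upwards [Filter.eventually_ge_atTop 0] with s hs
    refine Filter.Eventually.of_forall fun k => ?_
    rw [norm_mul, norm_pow, norm_pow, norm_norm, Real.norm_of_nonneg (Real.exp_pos _).le]
    refine mul_le_of_le_one_left (by positivity) (pow_le_one₀ (Real.exp_pos _).le ?_)
    rw [Real.exp_le_one_iff]
    have := mul_nonneg hs (norm_nonneg k)
    linarith
  · have hne : ∀ᵐ k ∂((volume : Measure E3).restrict (shell σ Λ)), k ≠ 0 :=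
      ae_restrict_of_ae (Measure.ae_ne volume 0)
    filter_upwards [hne] with k hk
    have hk0 : 0 < ‖k‖ := norm_pos_iff.2 hk
    have h2 : Filter.Tendsto (fun s : ℝ => Real.exp (-(s * ‖k‖))) Filter.atTop (nhds 0) :=
      Real.tendsto_exp_neg_atTop_nhds_zero.comp (Filter.tendsto_id.atTop_mul_const hk0)
    have h3 := (h2.pow 2).mul_const (‖(f : L2Shell σ Λ) k‖ ^ 2)
    simpa using h3

/-- The trace of `√(|k|² + A) - |k|` is controlled by that of the solution of the Lyapunov
equation. -/
theorem X_le_tsum {ι : Type*} (b : HilbertBasis ι ℂ (photonSpace σ Λ))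
    {A : photonSpace σ Λ →L[ℂ] photonSpace σ Λ} (hA : 0 ≤ A) :
    X σ Λ A ≤ ∑' i, ∫⁻ s in Ioi (0 : ℝ),
      ENNReal.ofReal (⟪decay σ Λ s (b i), A (decay σ Λ s (b i))⟫_ℂ).re :=
  traceSqrtSub_le_tsum b absK_nonneg hA decay_zero hasDerivAt_decay tendsto_norm_decay_sq

end Multipliers

/-! ### The operators `Φ` and `Θ` -/

section AdjointComp

variable {H G : Type*} [NormedAddCommGroup H] [InnerProductSpace ℂ H] [CompleteSpace H]
  [NormedAddCommGroup G] [InnerProductSpace ℂ G] [CompleteSpace G]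

theorem inner_two_smul_adjoint_comp {α : ℝ} (hα : 0 ≤ α) (S : H →L[ℂ] G) (f : H) :
    ⟪f, ((2 : ℂ) • (ContinuousLinearMap.adjoint (((Real.sqrt α : ℝ) : ℂ) • S)).comp
      (((Real.sqrt α : ℝ) : ℂ) • S)) f⟫_ℂ = ((2 * α * ‖S f‖ ^ 2 : ℝ) : ℂ) := by
  rw [_root_.smul_apply, inner_smul_right, ContinuousLinearMap.comp_apply,
    ContinuousLinearMap.adjoint_inner_right, _root_.smul_apply, inner_smul_left, inner_smul_right,
    inner_self_eq_norm_sq_to_K (𝕜 := ℂ), Complex.conj_ofReal, ← mul_assoc ((√α : ℝ) : ℂ),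
    ← Complex.ofReal_mul, Real.mul_self_sqrt hα]
  push_cast
  rw [mul_assoc]
  rfl

theorem two_smul_adjoint_comp_nonneg {α : ℝ} (hα : 0 ≤ α) (S : H →L[ℂ] G) :
    0 ≤ (2 : ℂ) • (ContinuousLinearMap.adjoint (((Real.sqrt α : ℝ) : ℂ) • S)).comp
      (((Real.sqrt α : ℝ) : ℂ) • S) := by
  rw [ContinuousLinearMap.nonneg_iff_isPositive, ContinuousLinearMap.isPositive_iff_complex]
  intro f
  rw [← inner_conj_symm, inner_two_smul_adjoint_comp hα, Complex.conj_ofReal,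
    RCLike.re_to_complex, Complex.ofReal_re]
  exact ⟨rfl, by positivity⟩

end AdjointComp

section Theta

variable {α σ Λ : ℝ}

theorem coeFn_mulSynth (φ : L2R) (f : photonSpace σ Λ) :
    mulSynth σ Λ φ f =ᵐ[volume] fun x => (φ x : ℂ) • synth σ Λ (f : L2Shell σ Λ) x :=
  (memLp_smul_synth φ f.1).coeFn_toLp

theorem ofReal_norm_mulSynth_sq (φ : L2R) (f : photonSpace σ Λ) :
    ENNReal.ofReal (‖mulSynth σ Λ φ f‖ ^ 2)
      = ∫⁻ x, ‖φ x‖ₑ ^ 2 * ‖synth σ Λ (f : L2Shell σ Λ) x‖ₑ ^ 2 := by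
  rw [← enorm_sq_eq_ofReal, Lp.enorm_def, eLpNorm_two_sq]
  refine lintegral_congr_ae ?_
  filter_upwards [coeFn_mulSynth φ f] with x hx
  have h : ‖((φ x : ℝ) : ℂ)‖ₑ = ‖φ x‖ₑ := by simp [enorm_eq_nnnorm]
  rw [hx, enorm_smul, mul_pow, h]

theorem inner_two_smul_Theta (hα : 0 ≤ α) (φ : L2R) (f : photonSpace σ Λ) :
    ⟪f, ((2 : ℂ) • Theta α σ Λ φ) f⟫_ℂ = ((2 * α * ‖mulSynth σ Λ φ f‖ ^ 2 : ℝ) : ℂ) :=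
  inner_two_smul_adjoint_comp hα (mulSynth σ Λ φ) f

theorem two_smul_Theta_nonneg (hα : 0 ≤ α) (φ : L2R) : 0 ≤ (2 : ℂ) • Theta α σ Λ φ :=
  two_smul_adjoint_comp_nonneg hα (mulSynth σ Λ φ)

theorem ofReal_re_inner_Theta (hα : 0 ≤ α) (φ : L2R) (f : photonSpace σ Λ) :
    ENNReal.ofReal (⟪f, ((2 : ℂ) • Theta α σ Λ φ) f⟫_ℂ).re = ENNReal.ofReal (2 * α)
      * ∫⁻ x, ‖φ x‖ₑ ^ 2 * ‖synth σ Λ (f : L2Shell σ Λ) x‖ₑ ^ 2 := by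
  rw [inner_two_smul_Theta hα, Complex.ofReal_re, ENNReal.ofReal_mul (by positivity),
    ofReal_norm_mulSynth_sq]

/-! ### Finiteness of the trace -/

/-- The vector representing `f ↦ (e^{-s|k|} f)ˇ(x)_j`. -/
theorem exists_inner_eq_synth_decay (s : ℝ) (x : E3) (j : Fin 3) :
    ∃ v : L2Shell σ Λ, (‖v‖ₑ ^ 2 = ∫⁻ k in shell σ Λ, ENNReal.ofReal (Real.exp (-(s * ‖k‖)) ^ 2)) ∧
      ∀ f : photonSpace σ Λ, synth σ Λ (decay σ Λ s f : L2Shell σ Λ) x j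
        = (((2 * Real.pi) ^ (-(3 / 2) : ℝ) : ℝ) : ℂ) * ⟪v, (f : L2Shell σ Λ)⟫_ℂ := by
  set m : E3 → ℂ := fun k => Complex.exp (Complex.I * ((⟪k, x⟫_ℝ : ℝ) : ℂ))
    * ((Real.exp (-(s * ‖k‖)) : ℝ) : ℂ) with hm
  have hmc : Continuous m := by fun_prop
  have hmn : ∀ k, ‖m k‖ = Real.exp (-(s * ‖k‖)) := fun k => by
    rw [hm, norm_mul, norm_phase, one_mul, Complex.norm_real, Real.norm_of_nonneg (Real.exp_pos _).le]
  set w : E3 → C3 := fun k => EuclideanSpace.single j (star (m k)) with hw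
  have hwn : ∀ k, ‖w k‖ = Real.exp (-(s * ‖k‖)) := fun k => by
    rw [hw, PiLp.norm_single, norm_star, hmn]
  have hwc : Continuous w := by
    have h1 : w = fun k => star (m k) • (EuclideanSpace.single j (1 : ℂ) : C3) := by
      funext k
      ext i
      simp [hw]
    rw [h1]
    fun_prop
  have hwm : MemLp w 2 ((volume : Measure E3).restrict (shell σ Λ)) := by
    refine MemLp.of_bound hwc.aestronglyMeasurable (Real.exp (|s| * Λ)) ?_
    filter_upwards [ae_mem_shell] with k hk
    have := norm_decay_le s k hk
    rwa [Complex.norm_real, Real.norm_of_nonneg (Real.exp_pos _).le, ← hwn] at this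
  refine ⟨hwm.toLp w, ?_, fun f => ?_⟩
  · rw [Lp.enorm_def, eLpNorm_two_sq]
    refine lintegral_congr_ae ?_
    filter_upwards [hwm.coeFn_toLp] with k hk
    rw [hk, enorm_sq_eq_ofReal, hwn]
  · have h1 : synth σ Λ (decay σ Λ s f : L2Shell σ Λ) x j
        = (((2 * Real.pi) ^ (-(3 / 2) : ℝ) : ℝ) : ℂ) * (∫ k in shell σ Λ,
          Complex.exp (Complex.I * ((⟪k, x⟫_ℝ : ℝ) : ℂ)) • (decay σ Λ s f : L2Shell σ Λ) k) j := rfl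
    rw [h1]
    congr 1
    have h2 := (EuclideanSpace.proj j : C3 →L[ℂ] ℂ).integral_comp_comm
      (integrable_phase_smul (decay σ Λ s f : L2Shell σ Λ) x)
    refine h2.symm.trans ?_
    rw [L2.inner_def]
    refine integral_congr_ae ?_
    filter_upwards [hwm.coeFn_toLp, isMult_decay s f] with k h3 h4
    rw [h3, h4, hw, EuclideanSpace.inner_single_left]
    simp only [hm, starRingEnd_apply, star_star]
    rw [mul_assoc]
    rfl

theorem enorm_sq_eq_sum (z : C3) : ‖z‖ₑ ^ 2 = ∑ j, ‖z j‖ₑ ^ 2 := by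
  simp only [enorm_sq_eq_ofReal]
  rw [← ENNReal.ofReal_sum_of_nonneg fun j _ => by positivity, EuclideanSpace.norm_sq_eq]

theorem tsum_enorm_inner_sq_le {E ι : Type*} [NormedAddCommGroup E] [InnerProductSpace ℂ E]
    {u : ι → E} (hu : Orthonormal ℂ u) (v : E) : ∑' i, ‖⟪v, u i⟫_ℂ‖ₑ ^ 2 ≤ ‖v‖ₑ ^ 2 := by
  simp only [enorm_sq_eq_ofReal, norm_inner_symm v]
  rw [← ENNReal.ofReal_tsum_of_nonneg (fun i => by positivity) (hu.inner_products_summable v)]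
  exact ENNReal.ofReal_le_ofReal (hu.tsum_inner_products_le v)

/-- Each component of the evaluation at `x` is the inner product with a vector of the ambient shell
space that need not be divergence-free. Bessel's inequality suffices; three components give the
factor 3, and the bound does not depend on `x`. -/
theorem tsum_enorm_synth_decay_sq_le {ι : Type*} (b : HilbertBasis ι ℂ (photonSpace σ Λ))
    (s : ℝ) (x : E3) :
    ∑' i, ‖synth σ Λ (decay σ Λ s (b i) : L2Shell σ Λ) x‖ₑ ^ 2
      ≤ 3 * (‖(2 * Real.pi) ^ (-(3 / 2) : ℝ)‖ₑ ^ 2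
        * ∫⁻ k in shell σ Λ, ENNReal.ofReal (Real.exp (-(s * ‖k‖)) ^ 2)) := by
  have hu : Orthonormal ℂ fun i => ((b i : photonSpace σ Λ) : L2Shell σ Λ) :=
    b.orthonormal.comp_linearIsometry (photonSpace σ Λ).subtypeₗᵢ
  have hj : ∀ j : Fin 3, ∑' i, ‖synth σ Λ (decay σ Λ s (b i) : L2Shell σ Λ) x j‖ₑ ^ 2
      ≤ ‖(2 * Real.pi) ^ (-(3 / 2) : ℝ)‖ₑ ^ 2
        * ∫⁻ k in shell σ Λ, ENNReal.ofReal (Real.exp (-(s * ‖k‖)) ^ 2) := by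
    intro j
    obtain ⟨v, hv1, hv2⟩ := exists_inner_eq_synth_decay (σ := σ) (Λ := Λ) s x j
    have hc : ‖(((2 * Real.pi) ^ (-(3 / 2) : ℝ) : ℝ) : ℂ)‖ₑ = ‖(2 * Real.pi) ^ (-(3 / 2) : ℝ)‖ₑ := by
      simp only [enorm_eq_nnnorm, Complex.nnnorm_real]
    simp only [hv2, enorm_mul, mul_pow, hc]
    rw [ENNReal.tsum_mul_left, ← hv1]
    gcongr
    exact tsum_enorm_inner_sq_le hu v
  simp only [enorm_sq_eq_sum, Fin.sum_univ_three]
  rw [ENNReal.tsum_add, ENNReal.tsum_add]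
  refine (add_le_add (add_le_add (hj 0) (hj 1)) (hj 2)).trans (le_of_eq ?_)
  ring

theorem lintegral_exp_sq {r : ℝ} (hr : 0 < r) :
    ∫⁻ s in Ioi (0 : ℝ), ENNReal.ofReal (Real.exp (-(s * r)) ^ 2) = ENNReal.ofReal (2⁻¹ * r⁻¹) := by
  have e : ∀ s : ℝ, Real.exp (-(s * r)) ^ 2 = Real.exp (-(2 * r) * s) := fun s => by
    rw [← Real.exp_nat_mul]; congr 1; push_cast; ring
  simp only [e]
  rw [← ofReal_integral_eq_lintegral_ofReal (integrableOn_exp_mul_Ioi (by linarith) 0)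
    (Filter.Eventually.of_forall fun s => (Real.exp_pos _).le), integral_exp_mul_Ioi (by linarith)]
  congr 1
  rw [mul_zero, Real.exp_zero]
  field_simp

/-- Integrating over `s` first leaves `1 / (2 |k|)`, which is locally integrable in dimension three.
-/
theorem lintegral_lintegral_exp_ne_top (σ Λ : ℝ) :
    ∫⁻ s in Ioi (0 : ℝ), ∫⁻ k in shell σ Λ, ENNReal.ofReal (Real.exp (-(s * ‖k‖)) ^ 2) ≠ ⊤ := by
  have hm : Measurable (Function.uncurry fun (s : ℝ) (k : E3) =>
      ENNReal.ofReal (Real.exp (-(s * ‖k‖)) ^ 2)) := by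
    have : Continuous fun p : ℝ × E3 => Real.exp (-(p.1 * ‖p.2‖)) ^ 2 := by fun_prop
    exact this.measurable.ennreal_ofReal
  rw [lintegral_lintegral_swap hm.aemeasurable]
  have hne : ∀ᵐ k ∂((volume : Measure E3).restrict (shell σ Λ)), k ≠ 0 :=
    ae_restrict_of_ae (Measure.ae_ne volume 0)
  have h1 : ∫⁻ k in shell σ Λ, ∫⁻ s in Ioi (0 : ℝ), ENNReal.ofReal (Real.exp (-(s * ‖k‖)) ^ 2)
      = ∫⁻ k in shell σ Λ, ENNReal.ofReal (2⁻¹ * ‖k‖⁻¹) := by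
    refine lintegral_congr_ae ?_
    filter_upwards [hne] with k hk
    exact lintegral_exp_sq (norm_pos_iff.2 hk)
  rw [h1]
  have hd : Module.finrank ℝ E3 = 3 := by simp
  have hloc : LocallyIntegrable (fun k : E3 => 2⁻¹ * ‖k‖⁻¹) volume := by
    refine locallyIntegrable_of_norm_le_rpow (C := 2⁻¹) (α := 1) (by rw [hd]; norm_num)
      (by rw [hd]; norm_num) (Filter.Eventually.of_forall fun k => ?_)
      (by fun_prop : Measurable fun k : E3 => 2⁻¹ * ‖k‖⁻¹).aestronglyMeasurable
    rw [Real.norm_of_nonneg (by positivity), Real.rpow_neg_one]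
  have hint : IntegrableOn (fun k : E3 => 2⁻¹ * ‖k‖⁻¹) (shell σ Λ) volume :=
    (hloc.integrableOn_isCompact (isCompact_closedBall (0 : E3) Λ)).mono_set
      fun k hk => mem_closedBall_zero_iff.2 hk.2.le
  exact hint.lintegral_lt_top.ne

/-- By `X_le_tsum` it suffices to bound the integral over `s` of the trace of `e^{-s|k|} 2Θ
e^{-s|k|}`. For each `s` this trace is at most `‖φ‖₂²` times a bound uniform in `x`, which is
integrable in `s`. -/
theorem X_Theta_ne_top (hα : 0 ≤ α) (φ : L2R) : X σ Λ ((2 : ℂ) • Theta α σ Λ φ) ≠ ⊤ := by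
  set b := (exists_hilbertBasis ℂ (photonSpace σ Λ)).choose_spec.choose with hb
  have : Countable (exists_hilbertBasis ℂ (photonSpace σ Λ)).choose := countable_of_hilbertBasis b
  set c : ℝ≥0∞ := ‖(2 * Real.pi) ^ (-(3 / 2) : ℝ)‖ₑ ^ 2 with hc
  have h2 : ∀ s : ℝ, ∑' i, ENNReal.ofReal (⟪decay σ Λ s (b i),
      ((2 : ℂ) • Theta α σ Λ φ) (decay σ Λ s (b i))⟫_ℂ).re
      ≤ ENNReal.ofReal (2 * α) * ((∫⁻ x, ‖φ x‖ₑ ^ 2) * (3 * (c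
        * ∫⁻ k in shell σ Λ, ENNReal.ofReal (Real.exp (-(s * ‖k‖)) ^ 2)))) := by
    intro s
    simp only [ofReal_re_inner_Theta hα]
    rw [ENNReal.tsum_mul_left]
    gcongr
    have hφm : AEMeasurable (fun x => ‖φ x‖ₑ ^ 2) :=
      (Lp.aestronglyMeasurable φ).enorm.pow_const 2
    have hm : ∀ i, AEMeasurable (fun x =>
        ‖φ x‖ₑ ^ 2 * ‖synth σ Λ (decay σ Λ s (b i) : L2Shell σ Λ) x‖ₑ ^ 2) volume := fun i =>
      hφm.mul ((continuous_synth
        (decay σ Λ s (b i) : L2Shell σ Λ)).enorm.measurable.pow_const 2).aemeasurable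
    rw [← lintegral_tsum hm, ← lintegral_mul_const'' _ hφm]
    refine lintegral_mono fun x => ?_
    rw [ENNReal.tsum_mul_left]
    gcongr
    exact tsum_enorm_synth_decay_sq_le b s x
  have hφ : ∫⁻ x, ‖φ x‖ₑ ^ 2 ≠ ⊤ := by
    rw [← eLpNorm_two_sq]
    exact ENNReal.pow_ne_top (Lp.eLpNorm_ne_top φ)
  have hm : Measurable fun s : ℝ =>
      ∫⁻ k in shell σ Λ, ENNReal.ofReal (Real.exp (-(s * ‖k‖)) ^ 2) := by
    have h3 : Continuous fun p : ℝ × E3 => Real.exp (-(p.1 * ‖p.2‖)) ^ 2 := by fun_prop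
    exact Measurable.lintegral_prod_right' (f := fun p : ℝ × E3 =>
      ENNReal.ofReal (Real.exp (-(p.1 * ‖p.2‖)) ^ 2)) h3.measurable.ennreal_ofReal
  refine ne_top_of_le_ne_top ?_ (X_le_tsum b (two_smul_Theta_nonneg hα φ))
  rw [← lintegral_tsum fun i => ?_]
  · refine ne_top_of_le_ne_top ?_ (lintegral_mono h2)
    rw [lintegral_const_mul _ (((hm.const_mul c).const_mul 3).const_mul _),
      lintegral_const_mul _ ((hm.const_mul c).const_mul 3), lintegral_const_mul _ (hm.const_mul c),
      lintegral_const_mul _ hm]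
    refine ENNReal.mul_ne_top (by finiteness) (ENNReal.mul_ne_top hφ (ENNReal.mul_ne_top
      (by finiteness) (ENNReal.mul_ne_top ?_ (lintegral_lintegral_exp_ne_top σ Λ))))
    rw [hc]
    finiteness
  · have h4 : Continuous fun s => decay σ Λ s (b i) :=
      continuous_iff_continuousAt.2 fun s => (hasDerivAt_decay s (b i)).continuousAt
    have h5 : Continuous fun s => ((2 : ℂ) • Theta α σ Λ φ) (decay σ Λ s (b i)) :=
      ((2 : ℂ) • Theta α σ Λ φ).continuous.comp h4
    exact (Complex.continuous_re.comp (h4.inner h5)).measurable.ennreal_ofReal.aemeasurable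

end Theta

/-! ### Operators identified through their quadratic forms. -/

section QuadraticForms

variable {H G : Type*} [NormedAddCommGroup H] [InnerProductSpace ℂ H] [CompleteSpace H]
  [NormedAddCommGroup G] [InnerProductSpace ℂ G] [CompleteSpace G]

/-- Quadratic forms of nonnegative operators are real, and complex polarization recovers an operator
from its form. -/
theorem eq_of_re_inner_eq {S T : H →L[ℂ] H} (hS : 0 ≤ S) (hT : 0 ≤ T)
    (h : ∀ f, (⟪f, S f⟫_ℂ).re = (⟪f, T f⟫_ℂ).re) : S = T := by
  have hre : ∀ {R : H →L[ℂ] H}, 0 ≤ R → ∀ f, ⟪R f, f⟫_ℂ = (((⟪f, R f⟫_ℂ).re : ℝ) : ℂ) := by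
    intro R hR f
    have h1 := ((ContinuousLinearMap.isPositive_iff_complex R).1
      ((ContinuousLinearMap.nonneg_iff_isPositive R).1 hR) f).1
    rw [← h1, ← inner_conj_symm f, Complex.conj_re]
    rfl
  have h2 : (S : H →ₗ[ℂ] H) = T := (ext_inner_map _ _).1 fun f => by
    simp only [ContinuousLinearMap.coe_coe]
    rw [hre hS, hre hT, h]
  exact ContinuousLinearMap.coe_injective h2

/-- Jensen's inequality for `A ↦ Tr(√(K² + A) - K)`, with the average of the operators given
through its quadratic form. -/
theorem lintegral_traceSqrtSub_le_of_inner [SecondCountableTopology H] {Y : Type*}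
    [TopologicalSpace Y] [SecondCountableTopology Y] [MeasurableSpace Y] [OpensMeasurableSpace Y]
    {ν : Measure Y} [IsProbabilityMeasure ν] {K : H →L[ℂ] H} (hK : 0 ≤ K) {A : Y → H →L[ℂ] H}
    (hA : ∀ y, 0 ≤ A y) {C : ℝ} (hC : ∀ y, ‖A y‖ ≤ C) {s : Set Y} (hs : MeasurableSet s)
    (hνs : ν.restrict s = ν) (hAs : ContinuousOn A s) {B : H →L[ℂ] H} (hB : 0 ≤ B)
    (hAB : ∀ f, ∫⁻ y, ENNReal.ofReal (⟪f, A y f⟫_ℂ).re ∂ν = ENNReal.ofReal (⟪f, B f⟫_ℂ).re) :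
    ∫⁻ y, traceSqrtSub K (A y) ∂ν ≤ traceSqrtSub K B := by
  have hmA : AEStronglyMeasurable A ν := by
    have := hAs.aestronglyMeasurable (μ := ν) hs
    rwa [hνs] at this
  have hiA : Integrable A ν := Integrable.of_bound hmA C (Filter.Eventually.of_forall hC)
  have hA0 : 0 ≤ ∫ y, A y ∂ν :=
    (convex_Ici (𝕜 := ℝ) (0 : H →L[ℂ] H)).integral_mem isClosed_Ici
      (Filter.Eventually.of_forall hA) hiA
  have hint : ∫ y, A y ∂ν = B := by
    refine eq_of_re_inner_eq hA0 hB fun f => ?_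
    let L : (H →L[ℂ] H) →L[ℝ] ℝ := Complex.reCLM.comp
      (((innerSL ℂ f).comp (ContinuousLinearMap.apply ℂ H f)).restrictScalars ℝ)
    have hL : ∀ T : H →L[ℂ] H, L T = (⟪f, T f⟫_ℂ).re := fun T => rfl
    have h1 : ∫ y, L (A y) ∂ν = L (∫ y, A y ∂ν) := L.integral_comp_comm hiA
    have h2 : Integrable (fun y => L (A y)) ν := L.integrable_comp hiA
    have h3 := ofReal_integral_eq_lintegral_ofReal h2
      (Filter.Eventually.of_forall fun y => nonneg_re_inner (hA y) f)
    rw [h1] at h3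
    have h4 : ENNReal.ofReal (L (∫ y, A y ∂ν)) = ENNReal.ofReal (⟪f, B f⟫_ℂ).re :=
      h3.trans (hAB f)
    exact (ENNReal.ofReal_eq_ofReal_iff (nonneg_re_inner hA0 f) (nonneg_re_inner hB f)).1 h4
  rw [← hint]
  exact lintegral_traceSqrtSub_le hK hA hC hs hνs hAs

/-- An isometry with a right inverse is unitary, and polarization upgrades the identity of forms to
the conjugation required by `traceSqrtSub_conj`. -/
theorem traceSqrtSub_eq_of_inner {K A B M M' : H →L[ℂ] H} (hK : 0 ≤ K) (hA : 0 ≤ A) (hB : 0 ≤ B)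
    (hn : ∀ f, ‖M f‖ = ‖f‖) (hMM' : ∀ f, M (M' f) = f) (hKM : ∀ f, K (M f) = M (K f))
    (hAB : ∀ f, ⟪M f, A (M f)⟫_ℂ = ⟪f, B f⟫_ℂ) : traceSqrtSub K A = traceSqrtSub K B := by
  let U : H ≃ₗᵢ[ℂ] H := LinearIsometryEquiv.ofSurjective ⟨M.toLinearMap, hn⟩ fun y => ⟨M' y, hMM' y⟩
  have hU : ∀ f, U f = M f := fun f => rfl
  refine traceSqrtSub_conj U hK hA hB (fun f => hKM f) fun f => ?_
  let V : H →L[ℂ] H := U.symm.toContinuousLinearEquiv.toContinuousLinearMap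
  have h1 : ((V.comp (A.comp M) : H →L[ℂ] H) : H →ₗ[ℂ] H) = B := (ext_inner_map _ _).1 fun f => by
    have h2 : ⟪U.symm (A (M f)), f⟫_ℂ = ⟪A (M f), M f⟫_ℂ := by
      rw [← U.inner_map_map, LinearIsometryEquiv.apply_symm_apply, hU]
    refine Eq.trans h2 ?_
    rw [← inner_conj_symm, hAB, inner_conj_symm]
    rfl
  have h3 : U.symm (A (U f)) = B f := LinearMap.congr_fun h1 f
  rw [← h3, LinearIsometryEquiv.apply_symm_apply]

theorem continuousOn_two_smul_adjoint_comp {Y : Type*} [TopologicalSpace Y] {s : Set Y} (r : ℂ)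
    {S : Y → H →L[ℂ] G} (hS : ContinuousOn S s) :
    ContinuousOn (fun y => (2 : ℂ) • (ContinuousLinearMap.adjoint (r • S y)).comp (r • S y)) s := by
  have h1 : ContinuousOn (fun y => r • S y) s := hS.const_smul r
  have h2 : ContinuousOn (fun y => ContinuousLinearMap.adjoint (r • S y)) s :=
    (ContinuousLinearMap.adjoint (𝕜 := ℂ) (E := H) (F := G)).continuous.comp_continuousOn h1
  exact (h2.clm_comp h1).const_smul (2 : ℂ)

theorem norm_two_smul_adjoint_comp_le (r : ℂ) (S : H →L[ℂ] G) :
    ‖(2 : ℂ) • (ContinuousLinearMap.adjoint (r • S)).comp (r • S)‖ ≤ 2 * (‖r‖ * ‖S‖) ^ 2 := by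
  rw [norm_smul, Complex.norm_ofNat]
  gcongr
  refine (ContinuousLinearMap.opNorm_comp_le _ _).trans (le_of_eq ?_)
  rw [LinearIsometryEquiv.norm_map, norm_smul, sq]

end QuadraticForms

/-! ### Continuity, boundedness and translation covariance of `φ ↦ Θ_φ`. -/

section Theta

variable {α σ Λ : ℝ}

theorem mulSynth_sub (φ ψ : L2R) :
    mulSynth σ Λ (φ - ψ) = mulSynth σ Λ φ - mulSynth σ Λ ψ := by
  ext1 f
  refine Lp.ext ?_
  have e : (mulSynth σ Λ φ - mulSynth σ Λ ψ) f = mulSynth σ Λ φ f - mulSynth σ Λ ψ f := rfl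
  rw [e]
  filter_upwards [coeFn_mulSynth (φ - ψ) f, coeFn_mulSynth φ f, coeFn_mulSynth ψ f,
    Lp.coeFn_sub φ ψ, Lp.coeFn_sub (mulSynth σ Λ φ f) (mulSynth σ Λ ψ f)] with x h1 h2 h3 h4 h5
  rw [h1, h5, h4, Pi.sub_apply, Pi.sub_apply, h2, h3, Complex.ofReal_sub, sub_smul]

theorem mulSynth_smul (c : ℝ) (φ : L2R) (f : photonSpace σ Λ) :
    mulSynth σ Λ (c • φ) f = (c : ℂ) • mulSynth σ Λ φ f := by
  refine Lp.ext ?_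
  filter_upwards [coeFn_mulSynth (c • φ) f, coeFn_mulSynth φ f, Lp.coeFn_smul c φ,
    Lp.coeFn_smul (c : ℂ) (mulSynth σ Λ φ f)] with x h1 h2 h3 h4
  rw [h1, h4, h3, Pi.smul_apply, Pi.smul_apply, h2, smul_eq_mul, Complex.ofReal_mul, smul_smul]

theorem exists_norm_mulSynth_le (σ Λ : ℝ) :
    ∃ M : ℝ, 0 ≤ M ∧ ∀ φ : L2R, ‖mulSynth σ Λ φ‖ ≤ M * ‖φ‖ := by
  obtain ⟨M, hM0, hM⟩ := exists_norm_synth_le σ Λ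
  refine ⟨M, hM0, fun φ => ContinuousLinearMap.opNorm_le_bound _ (by positivity) fun f => ?_⟩
  have h : ‖mulSynth σ Λ φ f‖ ≤ (M * ‖f.1‖) * ‖φ‖ := by
    refine Lp.norm_le_mul_norm_of_ae_le_mul ?_
    filter_upwards [coeFn_mulSynth φ f, ae_norm_smul_synth_le φ f.1 (hM f.1)] with x h1 h2
    rwa [h1]
  refine h.trans (le_of_eq ?_)
  rw [Submodule.coe_norm]; ring

theorem continuous_mulSynth : Continuous (mulSynth σ Λ) := by
  obtain ⟨M, hM0, hM⟩ := exists_norm_mulSynth_le σ Λ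
  have h : LipschitzWith ⟨M, hM0⟩ (mulSynth σ Λ) := LipschitzWith.of_dist_le_mul fun φ ψ => by
    rw [dist_eq_norm, dist_eq_norm, ← mulSynth_sub]
    exact hM _
  exact h.continuous

theorem continuousOn_two_smul_Theta {Y : Type*} [TopologicalSpace Y] {s : Set Y} {φ : Y → L2R}
    (hφ : ContinuousOn φ s) : ContinuousOn (fun y => (2 : ℂ) • Theta α σ Λ (φ y)) s :=
  continuousOn_two_smul_adjoint_comp ((Real.sqrt α : ℝ) : ℂ)
    (continuous_mulSynth.comp_continuousOn hφ)

theorem exists_norm_two_smul_Theta_le (α σ Λ : ℝ) :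
    ∃ C : ℝ, ∀ φ : L2R, ‖φ‖ ≤ 1 → ‖(2 : ℂ) • Theta α σ Λ φ‖ ≤ C := by
  obtain ⟨M, hM0, hM⟩ := exists_norm_mulSynth_le σ Λ
  refine ⟨2 * (‖((Real.sqrt α : ℝ) : ℂ)‖ * M) ^ 2, fun φ hφ => ?_⟩
  refine (norm_two_smul_adjoint_comp_le _ (mulSynth σ Λ φ)).trans ?_
  have := (hM φ).trans (mul_le_of_le_one_right hM0 hφ)
  gcongr

/-! ### Translation invariance -/

theorem synth_phase {a : E3} {M : photonSpace σ Λ →L[ℂ] photonSpace σ Λ}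
    (hM : IsMult (fun k => Complex.exp (Complex.I * ((⟪k, a⟫_ℝ : ℝ) : ℂ))) M) (f : photonSpace σ Λ)
    (x : E3) : synth σ Λ (M f : L2Shell σ Λ) x = synth σ Λ (f : L2Shell σ Λ) (x + a) := by
  simp only [synth]
  congr 1
  refine integral_congr_ae ?_
  filter_upwards [hM f] with k hk
  rw [hk, smul_smul, ← Complex.exp_add, inner_add_right, Complex.ofReal_add, mul_add]

/-- Multiplication by `e^{i k·a}` is unitary on the divergence-free fields, commutes with `|k|` and
translates the inverse Fourier transform by `a`. It therefore conjugates the two operators `Θ`. -/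
theorem X_Theta_translate (hα : 0 ≤ α) {φ ψ : L2R} {a : E3}
    (h : ψ =ᵐ[volume] fun x => φ (x + a)) :
    X σ Λ ((2 : ℂ) • Theta α σ Λ ψ) = X σ Λ ((2 : ℂ) • Theta α σ Λ φ) := by
  have hc : ∀ a : E3, Continuous fun k : E3 => Complex.exp (Complex.I * ((⟪k, a⟫_ℝ : ℝ) : ℂ)) :=
    fun a => by fun_prop
  obtain ⟨M, hM⟩ := exists_isMult (σ := σ) (Λ := Λ) (hc a) (C := 1)
    fun k _ => (norm_phase k a).le
  obtain ⟨M', hM'⟩ := exists_isMult (σ := σ) (Λ := Λ) (hc (-a)) (C := 1)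
    fun k _ => (norm_phase k (-a)).le
  have hMM' : ∀ f, M (M' f) = f := fun f => by
    apply photonSpace_ext
    filter_upwards [hM (M' f), hM' f] with k h1 h2
    rw [h1, h2, smul_smul, ← Complex.exp_add, inner_neg_right, Complex.ofReal_neg, mul_neg,
      add_neg_cancel, Complex.exp_zero, one_smul]
  have hn : ∀ f, ‖M f‖ = ‖f‖ := fun f => by
    have h1 : ‖M f‖ ^ 2 = ‖f‖ ^ 2 := by
      rw [norm_sq_photonSpace, norm_sq_photonSpace]
      refine integral_congr_ae ?_
      filter_upwards [hM f] with k hk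
      rw [hk, norm_smul, norm_phase, one_mul]
    exact (sq_eq_sq₀ (norm_nonneg _) (norm_nonneg _)).1 h1
  refine traceSqrtSub_eq_of_inner absK_nonneg (two_smul_Theta_nonneg hα ψ)
    (two_smul_Theta_nonneg hα φ) hn hMM' (fun f => ?_) fun f => ?_
  · apply photonSpace_ext
    filter_upwards [isMult_absK (M f), hM f, hM (absK σ Λ f), isMult_absK f] with k h1 h2 h3 h4
    rw [h1, h2, h3, h4, smul_comm]
  · rw [inner_two_smul_Theta hα, inner_two_smul_Theta hα]
    have h1 : ENNReal.ofReal (‖mulSynth σ Λ ψ (M f)‖ ^ 2)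
        = ENNReal.ofReal (‖mulSynth σ Λ φ f‖ ^ 2) := by
      rw [ofReal_norm_mulSynth_sq, ofReal_norm_mulSynth_sq,
        ← lintegral_add_right_eq_self (fun x =>
          ‖φ x‖ₑ ^ 2 * ‖synth σ Λ (f : L2Shell σ Λ) x‖ₑ ^ 2) a]
      refine lintegral_congr_ae ?_
      filter_upwards [h] with x hx
      rw [hx, synth_phase hM]
    rw [ENNReal.ofReal_eq_ofReal_iff (by positivity) (by positivity)] at h1
    rw [h1]

end Theta

/-! ### Localization of the Lieb-Loss functional -/

theorem exists_normalized_bump : ∃ D : ℝ, 0 ≤ D ∧ ∀ L : ℝ, 0 < L → ∃ b : E3 → ℝ,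
    ContDiff ℝ ∞ b ∧ HasCompactSupport b ∧ (∀ x, 0 ≤ b x) ∧
    (∀ x, x ∉ Metric.ball (0 : E3) L → b x = 0) ∧ ∫⁻ x, ‖b x‖ₑ ^ 2 = 1 ∧
    ∫⁻ x, ‖∇ b x‖ₑ ^ 2 = ENNReal.ofReal (D / L ^ 2) := by
  obtain ⟨f, h1, h2, h3, h4, h5⟩ := exists_bump one_pos
  set N := ∫ x, ‖f x‖ ^ 2 with hN
  refine ⟨(∫ x, ‖∇ f x‖ ^ 2) / N, by positivity, fun L hL => ?_⟩
  set l := L⁻¹ with hl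
  have hl0 : 0 < l := inv_pos.2 hL
  -- This normalizes the bump of width `L` in `L²`; its Dirichlet integral is then `L⁻²` times that
  -- of the normalized unit bump.
  set c := √(l ^ 3 / N) with hc
  have hc2 : c ^ 2 = l ^ 3 / N := Real.sq_sqrt (by positivity)
  have hcf : ContDiff ℝ ∞ fun x => c * f x := contDiff_const.mul h1
  have hgc : ∀ x, ∇ (fun x => c * f x) x = c • ∇ f x := fun x => by
    rw [gradient, fderiv_const_mul (h1.differentiable (by simp) x), map_smul, gradient]
  have hg : ∀ x, ∇ (fun x => c * f (l • x)) x = l • c • ∇ f (l • x) := fun x => by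
    have h := gradient_comp_affine hcf l 0 x
    rw [hgc] at h
    simpa only [sub_zero] using h
  have hsc : ∀ (F : Type) [NormedAddCommGroup F] [NormedSpace ℝ F] (g : E3 → F), MemLp g 2 volume →
      ∀ r : ℝ, ∫⁻ x, ‖r • g (l • x)‖ₑ ^ 2
        = ENNReal.ofReal (r ^ 2 * ((l ^ 3)⁻¹ * ∫ x, ‖g x‖ ^ 2)) := by
    intro F _ _ g hg r
    have h6 := lintegral_comp_affine (g := fun x => ‖g x‖ₑ ^ 2) (hg.1.enorm.pow_const 2) hl0 0
    simp only [add_zero] at h6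
    simp only [enorm_smul, mul_pow]
    rw [lintegral_const_mul' _ _ (by finiteness), h6, lintegral_enorm_sq_eq_ofReal hg,
      enorm_sq_eq_ofReal, Real.norm_eq_abs, sq_abs, ENNReal.ofReal_mul (by positivity),
      ENNReal.ofReal_mul (by positivity)]
  refine ⟨fun x => c * f (l • x), contDiff_const.mul (h1.comp (by fun_prop)),
    (hasCompactSupport_dilate h2 hl0.ne').mul_left, fun x => mul_nonneg (by positivity) (h3 _),
    fun x hx => ?_, ?_, ?_⟩
  · change c * f (l • x) = 0
    rw [h4, mul_zero]
    rw [mem_ball_zero_iff, not_lt] at hx ⊢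
    rw [norm_smul, Real.norm_of_nonneg hl0.le, hl]
    rwa [le_inv_mul_iff₀ hL, mul_one]
  · have h7 := hsc ℝ f (memLp_test h1 h2) c
    simp only [smul_eq_mul] at h7
    rw [h7, hc2, ← hN]
    have : l ^ 3 / N * ((l ^ 3)⁻¹ * N) = 1 := by field_simp
    rw [this, ENNReal.ofReal_one]
  · simp only [hg, smul_smul]
    rw [hsc E3 (∇ f) (memLp_gradient h1 h2) (l * c), mul_pow, hc2]
    congr 1
    rw [hl]
    field_simp

/-! ### Translated cutoffs and Jensen's inequality. -/

theorem memLp_cutoff {b : E3 → ℝ} (hb : ContDiff ℝ ∞ b) (hc : HasCompactSupport b) (φ : L2R)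
    (y : E3) : MemLp (fun x => b (x - y) * φ x) 2 volume := by
  obtain ⟨C, hC⟩ := hc.exists_bound_of_continuous hb.continuous
  refine (Lp.memLp φ).of_le_mul (c := C) ((hb.continuous.comp
    (continuous_sub_right y)).aestronglyMeasurable.mul (Lp.aestronglyMeasurable φ))
    (Filter.Eventually.of_forall fun x => ?_)
  rw [norm_mul]
  exact mul_le_mul_of_nonneg_right (hC _) (norm_nonneg _)

/-- The function `x ↦ b(x - y) φ(x)` as an element of `L²`. -/
noncomputable def cutoff {b : E3 → ℝ} (hb : ContDiff ℝ ∞ b) (hc : HasCompactSupport b) (φ : L2R)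
    (y : E3) : L2R := (memLp_cutoff hb hc φ y).toLp _

section Cutoff

variable {b : E3 → ℝ} (hb : ContDiff ℝ ∞ b) (hc : HasCompactSupport b) (φ : L2R)

theorem coeFn_cutoff (y : E3) : cutoff hb hc φ y =ᵐ[volume] fun x => b (x - y) * φ x :=
  (memLp_cutoff hb hc φ y).coeFn_toLp

theorem enorm_cutoff_sq (y : E3) :
    ‖cutoff hb hc φ y‖ₑ ^ 2 = ∫⁻ x, ‖b (x - y) * φ x‖ₑ ^ 2 := by
  rw [cutoff, Lp.enorm_toLp, eLpNorm_two_sq]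

/-- A Lipschitz bound for `b` is inherited in `L²` norm. Continuity in the centre supplies the
measurability that Jensen's inequality needs. -/
theorem continuous_cutoff : Continuous (cutoff hb hc φ) := by
  obtain ⟨K, hK⟩ := hb.lipschitzWith_of_hasCompactSupport hc (by simp)
  have h : LipschitzWith (K * ‖φ‖₊) (cutoff hb hc φ) := LipschitzWith.of_dist_le_mul fun y z => by
    rw [dist_eq_norm, dist_eq_norm, NNReal.coe_mul, coe_nnnorm, mul_right_comm]
    refine Lp.norm_le_mul_norm_of_ae_le_mul ?_
    filter_upwards [Lp.coeFn_sub (cutoff hb hc φ y) (cutoff hb hc φ z), coeFn_cutoff hb hc φ y,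
      coeFn_cutoff hb hc φ z] with x h1 h2 h3
    rw [h1, Pi.sub_apply, h2, h3, ← sub_mul, norm_mul]
    refine mul_le_mul_of_nonneg_right ?_ (norm_nonneg _)
    have h4 := hK.dist_le_mul (x - y) (x - z)
    rw [dist_eq_norm, dist_eq_norm] at h4
    refine h4.trans (le_of_eq ?_)
    rw [sub_sub_sub_cancel_left, norm_sub_rev]
  exact h.continuous

theorem lintegral_enorm_cutoff_sq :
    ∫⁻ y, ‖cutoff hb hc φ y‖ₑ ^ 2 = (∫⁻ x, ‖b x‖ₑ ^ 2) * ‖φ‖ₑ ^ 2 := by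
  simp only [enorm_cutoff_sq, enorm_mul, mul_pow]
  rw [lintegral_lintegral_sub_mul (k := fun x => ‖b x‖ₑ ^ 2) (h := fun x => ‖φ x‖ₑ ^ 2)
    (hb.continuous.enorm.measurable.pow_const 2) ((Lp.aestronglyMeasurable φ).enorm.pow_const 2),
    Lp.enorm_def φ, eLpNorm_two_sq]

end Cutoff

/-- `Θ` is homogeneous of degree two in its function, so the weight undoes the normalization; for `ψ
= 0` both sides vanish. -/
theorem enorm_sq_mul_ofReal_re_inner_Theta {α σ Λ : ℝ} (hα : 0 ≤ α) (ψ : L2R)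
    (f : photonSpace σ Λ) :
    ‖ψ‖ₑ ^ 2 * ENNReal.ofReal (⟪f, ((2 : ℂ) • Theta α σ Λ (‖ψ‖⁻¹ • ψ)) f⟫_ℂ).re
      = ENNReal.ofReal (⟪f, ((2 : ℂ) • Theta α σ Λ ψ) f⟫_ℂ).re := by
  rw [inner_two_smul_Theta hα, inner_two_smul_Theta hα, Complex.ofReal_re, Complex.ofReal_re,
    enorm_sq_eq_ofReal, ← ENNReal.ofReal_mul (by positivity), mulSynth_smul, norm_smul,
    Complex.norm_real, norm_inv, norm_norm]
  congr 1
  rcases eq_or_ne ψ 0 with rfl | h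
  · have h0 : mulSynth σ Λ (0 : L2R) f = 0 := by
      have := mulSynth_smul (0 : ℝ) (0 : L2R) f
      rwa [zero_smul, Complex.ofReal_zero, zero_smul] at this
    rw [h0]; simp
  · have : ‖ψ‖ ≠ 0 := norm_ne_zero_iff.2 h
    field_simp

/-- Jensen's inequality for the probability density `‖b(· - y) φ‖²`. The weighted operators average
to `2Θ_φ`, because their forms are integrals against `b(x - y)² φ(x)²` and `∫ b(x - y)² dy = 1`. -/
theorem lintegral_X_cutoff_le {b : E3 → ℝ} (hb : ContDiff ℝ ∞ b) (hc : HasCompactSupport b)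
    {φ : L2R} (h1 : ∫⁻ x, ‖b x‖ₑ ^ 2 = 1) (hφ : ‖φ‖ = 1) {α σ Λ : ℝ} (hα : 0 ≤ α) :
    ∫⁻ y, ‖cutoff hb hc φ y‖ₑ ^ 2
        * X σ Λ ((2 : ℂ) • Theta α σ Λ (‖cutoff hb hc φ y‖⁻¹ • cutoff hb hc φ y))
      ≤ X σ Λ ((2 : ℂ) • Theta α σ Λ φ) := by
  set P := cutoff hb hc φ with hP
  have hPc : Continuous P := continuous_cutoff hb hc φ
  have hwm : Measurable fun y => ‖P y‖ₑ ^ 2 := hPc.enorm.measurable.pow_const 2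
  have hwt : ∀ᵐ y, ‖P y‖ₑ ^ 2 < ⊤ := Filter.Eventually.of_forall fun y => by finiteness
  set ν : Measure E3 := volume.withDensity fun y => ‖P y‖ₑ ^ 2 with hν
  have hprob : IsProbabilityMeasure ν := ⟨by
    rw [hν, withDensity_apply _ MeasurableSet.univ, Measure.restrict_univ,
      lintegral_enorm_cutoff_sq, h1, enorm_sq_eq_ofReal, hφ]
    simp⟩
  -- The normalized cutoff is continuous only where it does not vanish; the complement has zero
  -- weight.
  set s : Set E3 := {y | P y ≠ 0} with hs
  have hso : IsOpen s := isOpen_compl_singleton.preimage hPc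
  have hνs : ν.restrict s = ν := by
    refine Measure.restrict_eq_self_of_ae_mem ?_
    rw [hν, ae_withDensity_iff hwm]
    refine Filter.Eventually.of_forall fun y hy => ?_
    intro h0
    rw [h0] at hy
    simp at hy
  have hN1 : ∀ y, ‖‖P y‖⁻¹ • P y‖ ≤ 1 := fun y => by
    rw [norm_smul, norm_inv, norm_norm]
    exact inv_mul_le_one
  have hNc : ContinuousOn (fun y => ‖P y‖⁻¹ • P y) s :=
    (hPc.norm.continuousOn.inv₀ fun y hy => norm_ne_zero_iff.2 hy).smul hPc.continuousOn
  obtain ⟨C, hC⟩ := exists_norm_two_smul_Theta_le α σ Λ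
  have key := lintegral_traceSqrtSub_le_of_inner (ν := ν) (K := absK σ Λ) absK_nonneg
    (fun y => two_smul_Theta_nonneg hα (‖P y‖⁻¹ • P y)) (fun y => hC _ (hN1 y)) hso.measurableSet
    hνs (continuousOn_two_smul_Theta hNc) (two_smul_Theta_nonneg hα φ) fun f => ?_
  · rw [hν, lintegral_withDensity_eq_lintegral_mul_non_measurable _ hwm hwt] at key
    exact key
  · rw [hν, lintegral_withDensity_eq_lintegral_mul_non_measurable _ hwm hwt]
    simp only [Pi.mul_apply]
    have h2 : ∀ y, ‖P y‖ₑ ^ 2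
        * ENNReal.ofReal (⟪f, ((2 : ℂ) • Theta α σ Λ (‖P y‖⁻¹ • P y)) f⟫_ℂ).re
        = ENNReal.ofReal (2 * α) * ∫⁻ x, ‖b (x - y)‖ₑ ^ 2
          * (‖φ x‖ₑ ^ 2 * ‖synth σ Λ (f : L2Shell σ Λ) x‖ₑ ^ 2) := fun y => by
      rw [enorm_sq_mul_ofReal_re_inner_Theta hα, ofReal_re_inner_Theta hα]
      congr 1
      refine lintegral_congr_ae ?_
      filter_upwards [coeFn_cutoff hb hc φ y] with x hx
      rw [hP, hx, enorm_mul, mul_pow, mul_assoc]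
    simp only [h2]
    rw [lintegral_const_mul' _ _ ENNReal.ofReal_ne_top, lintegral_lintegral_sub_mul
      (k := fun x => ‖b x‖ₑ ^ 2)
      (h := fun x => ‖φ x‖ₑ ^ 2 * ‖synth σ Λ (f : L2Shell σ Λ) x‖ₑ ^ 2)
      (hb.continuous.enorm.measurable.pow_const 2)
      (((Lp.aestronglyMeasurable φ).enorm.pow_const 2).mul
        ((continuous_synth (f : L2Shell σ Λ)).enorm.measurable.pow_const 2).aemeasurable),
      h1, one_mul, ofReal_re_inner_Theta hα]

theorem ae_nonneg_of_eq_abs {φ : L2R} (h : φ = |φ|) : ∀ᵐ x, 0 ≤ φ x := by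
  have h1 := Lp.coeFn_abs φ
  rw [← h] at h1
  filter_upwards [h1] with x hx
  rw [hx]; exact abs_nonneg _

/-- The normalized cutoff, moved to the origin, is admissible for the localized problem. The factor
`‖P‖²` clears the normalization and makes the case `P = 0` trivial. -/
theorem ELLLoc_mul_le {b : E3 → ℝ} (hb : ContDiff ℝ ∞ b) (hc : HasCompactSupport b)
    (hb0 : ∀ x, 0 ≤ b x) {L : ℝ} (hbL : ∀ x, x ∉ Metric.ball (0 : E3) L → b x = 0) {φ : L2R}
    (hφ : φ = |φ|) {G : E3 → E3} (hG : IsWeakGrad φ G) {α σ Λ : ℝ} (hα : 0 ≤ α) (y : E3) :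
    ELLLoc L α σ Λ * ‖cutoff hb hc φ y‖ₑ ^ 2
      ≤ (∫⁻ x, ‖b (x - y) • G x + φ x • ∇ b (x - y)‖ₑ ^ 2) / 2
        + ‖cutoff hb hc φ y‖ₑ ^ 2
          * X σ Λ ((2 : ℂ) • Theta α σ Λ (‖cutoff hb hc φ y‖⁻¹ • cutoff hb hc φ y)) / 2 := by
  set P := cutoff hb hc φ y with hP
  rcases eq_or_ne P 0 with h0 | h0
  · simp [h0]
  have hP0 : 0 < ‖P‖ := norm_pos_iff.2 h0
  obtain ⟨C, -, hC⟩ := exists_bound_gradient hb hc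
  obtain ⟨C', hC'⟩ := hc.exists_bound_of_continuous hb.continuous
  have hw := (hG.comp_affine one_pos y).mul_smooth hb (C := max C C')
    (fun x => (hC' x).trans (le_max_right _ _)) fun x => (hC x).trans (le_max_left _ _)
  simp only [one_smul] at hw
  have hpos : ∀ᵐ x, 0 ≤ b x * φ (x + y) := by
    have := (quasiMeasurePreserving_affine one_pos y).ae (ae_nonneg_of_eq_abs hφ)
    filter_upwards [this] with x hx
    rw [one_smul] at hx
    exact mul_nonneg (hb0 x) hx
  have hnorm : ∫⁻ x, ‖b x * φ (x + y)‖ₑ ^ 2 = ENNReal.ofReal (‖P‖ ^ 2) := by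
    rw [← enorm_sq_eq_ofReal, hP, enorm_cutoff_sq,
      ← lintegral_add_right_eq_self (fun x => ‖b (x - y) * φ x‖ₑ ^ 2) y]
    simp only [add_sub_cancel_right]
  have hgrad : ∫⁻ x, ‖b x • G (x + y) + φ (x + y) • ∇ b x‖ₑ ^ 2
      = ∫⁻ x, ‖b (x - y) • G x + φ x • ∇ b (x - y)‖ₑ ^ 2 := by
    rw [← lintegral_add_right_eq_self
      (fun x => ‖b (x - y) • G x + φ x • ∇ b (x - y)‖ₑ ^ 2) y]
    simp only [add_sub_cancel_right]
  obtain ⟨ψ, h1, h2, h3, h4, h5⟩ := hw.exists_normalized hpos (by positivity) hnorm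
  rw [Real.sqrt_sq hP0.le] at h1
  have hY : MemY L ψ := ⟨h3, by
    filter_upwards [h1] with x hx hxL
    rw [hx, hbL x hxL, zero_mul, mul_zero]⟩
  have hX : X σ Λ ((2 : ℂ) • Theta α σ Λ ψ) = X σ Λ ((2 : ℂ) • Theta α σ Λ (‖P‖⁻¹ • P)) := by
    refine X_Theta_translate hα (a := y) ?_
    have h6 : ∀ᵐ x, (‖P‖⁻¹ • P : L2R) x = ‖P‖⁻¹ * (b (x - y) * φ x) := by
      filter_upwards [Lp.coeFn_smul ‖P‖⁻¹ P, coeFn_cutoff hb hc φ y] with x h7 h8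
      rw [h7, Pi.smul_apply, smul_eq_mul, hP, h8]
    have h7 := (quasiMeasurePreserving_affine one_pos y).ae h6
    filter_upwards [h1, h7] with x h8 h9
    rw [one_smul, add_sub_cancel_right] at h9
    rw [h8, h9]
  have hE : ELLLoc L α σ Λ ≤ effEnergy α σ Λ ψ := iInf₂_le ψ ⟨h2, hY, h4⟩
  rw [hgrad] at h5
  have hw0 : ‖P‖ₑ ^ 2 * ENNReal.ofReal (‖P‖ ^ 2)⁻¹ = 1 := by
    rw [enorm_sq_eq_ofReal, ← ENNReal.ofReal_mul (by positivity), mul_inv_cancel₀ (by positivity),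
      ENNReal.ofReal_one]
  calc ELLLoc L α σ Λ * ‖P‖ₑ ^ 2
      ≤ ‖P‖ₑ ^ 2 * (gradSq ψ / 2 + X σ Λ ((2 : ℂ) • Theta α σ Λ ψ) / 2) := by
        rw [mul_comm]
        gcongr
        exact hE
    _ ≤ ‖P‖ₑ ^ 2 * ((ENNReal.ofReal (‖P‖ ^ 2)⁻¹
          * ∫⁻ x, ‖b (x - y) • G x + φ x • ∇ b (x - y)‖ₑ ^ 2) / 2
          + X σ Λ ((2 : ℂ) • Theta α σ Λ (‖P‖⁻¹ • P)) / 2) := by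
        rw [hX]
        gcongr
    _ = _ := by
        rw [mul_add, ← mul_div_assoc, ← mul_div_assoc, ← mul_assoc, hw0, one_mul]

theorem ELLLoc_le_effEnergy_add {b : E3 → ℝ} (hb : ContDiff ℝ ∞ b) (hc : HasCompactSupport b)
    (hb0 : ∀ x, 0 ≤ b x) {L : ℝ} (hbL : ∀ x, x ∉ Metric.ball (0 : E3) L → b x = 0)
    (h1 : ∫⁻ x, ‖b x‖ₑ ^ 2 = 1) {φ : L2R} (hφ : φ = |φ|) (hφ1 : ‖φ‖ = 1) {α σ Λ : ℝ}
    (hα : 0 ≤ α) :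
    ELLLoc L α σ Λ ≤ effEnergy α σ Λ φ + (∫⁻ x, ‖∇ b x‖ₑ ^ 2) / 2 := by
  have hφe : ‖φ‖ₑ ^ 2 = 1 := by rw [enorm_sq_eq_ofReal, hφ1]; simp
  have key : ∀ G : Lp E3 2 (volume : Measure E3), HasWeakGradient φ G →
      ELLLoc L α σ Λ ≤ ‖G‖ₑ ^ 2 / 2
        + (X σ Λ ((2 : ℂ) • Theta α σ Λ φ) / 2 + (∫⁻ x, ‖∇ b x‖ₑ ^ 2) / 2) := by
    intro G hG
    have hm : Measurable fun y => ∫⁻ x, ‖b (x - y) • G x + φ x • ∇ b (x - y)‖ₑ ^ 2 := by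
      have hGm : Measurable (G : E3 → E3) := (Lp.stronglyMeasurable G).measurable
      have hφm : Measurable (φ : E3 → ℝ) := (Lp.stronglyMeasurable φ).measurable
      have hbm : Measurable b := hb.continuous.measurable
      have hbm' : Measurable (∇ b) := hb.continuous_gradient.measurable
      exact Measurable.lintegral_prod_right' (f := fun p : E3 × E3 =>
        ‖b (p.2 - p.1) • G p.2 + φ p.2 • ∇ b (p.2 - p.1)‖ₑ ^ 2) (by fun_prop)
    calc ELLLoc L α σ Λ = ∫⁻ y, ELLLoc L α σ Λ * ‖cutoff hb hc φ y‖ₑ ^ 2 := by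
          rw [lintegral_const_mul _
            ((continuous_cutoff hb hc φ).enorm.measurable.pow_const 2),
            lintegral_enorm_cutoff_sq, h1, hφe, one_mul, mul_one]
      _ ≤ ∫⁻ y, ((∫⁻ x, ‖b (x - y) • G x + φ x • ∇ b (x - y)‖ₑ ^ 2) / 2
          + ‖cutoff hb hc φ y‖ₑ ^ 2 * X σ Λ ((2 : ℂ) • Theta α σ Λ
            (‖cutoff hb hc φ y‖⁻¹ • cutoff hb hc φ y)) / 2) :=
          lintegral_mono fun y => ELLLoc_mul_le hb hc hb0 hbL hφ hG.isWeakGrad hα y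
      _ = (∫⁻ y, ∫⁻ x, ‖b (x - y) • G x + φ x • ∇ b (x - y)‖ₑ ^ 2) / 2
          + (∫⁻ y, ‖cutoff hb hc φ y‖ₑ ^ 2 * X σ Λ ((2 : ℂ) • Theta α σ Λ
            (‖cutoff hb hc φ y‖⁻¹ • cutoff hb hc φ y))) / 2 := by
          -- Additivity needs measurability of the gradient term only, so that of `X` as a function
          -- of `y` is never required.
          rw [lintegral_add_left (hm.div_const 2)]
          simp only [div_eq_mul_inv]
          rw [lintegral_mul_const' _ _ (by simp), lintegral_mul_const' _ _ (by simp)]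
      _ ≤ (‖G‖ₑ ^ 2 + ∫⁻ x, ‖∇ b x‖ₑ ^ 2) / 2 + X σ Λ ((2 : ℂ) • Theta α σ Λ φ) / 2 := by
          rw [lintegral_lintegral_enorm_sq_cutoff hb hc (Lp.aestronglyMeasurable φ)
            (Lp.aestronglyMeasurable G), h1, one_mul, ← eLpNorm_two_sq φ, ← Lp.enorm_def, hφe,
            mul_one, ← eLpNorm_two_sq G, ← Lp.enorm_def]
          gcongr
          exact lintegral_X_cutoff_le hb hc h1 hφ1 hα
      _ = _ := by rw [ENNReal.add_div]; ring
  -- `gradSq` is an infimum over weak gradients; pulling it out reduces the claim to each `G`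
  -- separately.
  rw [effEnergy, add_assoc, gradSq, ENNReal.iInf_div_of_ne (by simp) (by simp), ENNReal.iInf_add]
  refine le_iInf fun G => ?_
  rw [ENNReal.iInf_div_of_ne (by simp) (by simp), ENNReal.iInf_add]
  exact le_iInf fun hG => key G hG

theorem ELL_le_ELLLoc (L α σ Λ : ℝ) : ELL α σ Λ ≤ ELLLoc L α σ Λ :=
  le_iInf₂ fun φ h => iInf₂_le φ ⟨h.1, h.2.1.1, h.2.2⟩

theorem ELLLoc_ne_top {L α σ Λ : ℝ} (hL : 0 < L) (hα : 0 ≤ α) : ELLLoc L α σ Λ ≠ ⊤ := by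
  obtain ⟨f, h1, h2, h3, h4, h5⟩ := exists_bump hL
  obtain ⟨ψ, h6, h7, h8, h9, h10⟩ := (isWeakGrad_of_contDiff h1 h2).exists_normalized
    (Filter.Eventually.of_forall h3) h5 (lintegral_enorm_sq_eq_ofReal (memLp_test h1 h2))
  have hY : MemY L ψ := ⟨h8, by
    filter_upwards [h6] with x hx hxL
    rw [hx, h4 x hxL, mul_zero]⟩
  refine ne_top_of_le_ne_top ?_ (iInf₂_le ψ ⟨h7, hY, h9⟩)
  have h11 : gradSq ψ ≠ ⊤ := by
    refine ne_top_of_le_ne_top ?_ h10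
    rw [lintegral_enorm_sq_eq_ofReal (memLp_gradient h1 h2)]
    finiteness
  exact ENNReal.add_ne_top.2 ⟨ENNReal.div_ne_top h11 (by simp),
    ENNReal.div_ne_top (X_Theta_ne_top hα ψ) (by simp)⟩

theorem exists_ELLLoc_le : ∃ C : ℝ, 0 ≤ C ∧ ∀ L α σ Λ : ℝ, 0 < L → 0 ≤ α →
    (ELLLoc L α σ Λ).toReal ≤ (ELL α σ Λ).toReal + C / L ^ 2 := by
  obtain ⟨D, hD0, hD⟩ := exists_normalized_bump
  refine ⟨D / 2, by positivity, fun L α σ Λ hL hα => ?_⟩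
  obtain ⟨b, hb, hc, hb0, hbL, h1, h2⟩ := hD L hL
  have h3 : ELLLoc L α σ Λ ≤ ELL α σ Λ + ENNReal.ofReal (D / 2 / L ^ 2) := by
    rw [ELL, ENNReal.iInf₂_add]
    refine le_iInf₂ fun φ hφ => ?_
    refine (ELLLoc_le_effEnergy_add hb hc hb0 hbL h1 hφ.1 hφ.2.2 hα).trans_eq ?_
    rw [h2, ofReal_div_two, div_right_comm]
  have h4 : ELL α σ Λ ≠ ⊤ := ne_top_of_le_ne_top (ELLLoc_ne_top hL hα) (ELL_le_ELLLoc L α σ Λ)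
  have h5 := ENNReal.toReal_mono (by finiteness) h3
  rwa [ENNReal.toReal_add h4 ENNReal.ofReal_ne_top, ENNReal.toReal_ofReal (by positivity)] at h5

end LiebLoss

/-- Localization estimates for the Lieb-Loss energy and the auxiliary energy. All four infima are
finite, so that the inequalities are between real numbers. -/
theorem mainTheorem4 :
    ∃ C : ℝ, ∀ α β L σ Λ : ℝ, 0 < α → 0 < β → 0 < L → 0 ≤ σ → 1 ≤ Λ →
      (LiebLoss.ELL α σ Λ ≠ ⊤ ∧ LiebLoss.ELLLoc L α σ Λ ≠ ⊤ ∧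
        (LiebLoss.ELLLoc L α σ Λ).toReal - C / L ^ 2 ≤ (LiebLoss.ELL α σ Λ).toReal ∧
        (LiebLoss.ELL α σ Λ).toReal ≤ (LiebLoss.ELLLoc L α σ Λ).toReal) ∧
      (LiebLoss.auxF β ≠ ⊤ ∧ LiebLoss.auxFLoc L β ≠ ⊤ ∧
        (LiebLoss.auxFLoc L β).toReal - C / L ^ 2 ≤ (LiebLoss.auxF β).toReal ∧
        (LiebLoss.auxF β).toReal ≤ (LiebLoss.auxFLoc L β).toReal) := by
  obtain ⟨C₁, hC₁, h₁⟩ := LiebLoss.exists_ELLLoc_le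
  obtain ⟨C₂, hC₂, h₂⟩ := LiebLoss.exists_auxFLoc_le
  -- Both constants are nonnegative, so their sum serves for both energies.
  refine ⟨C₁ + C₂, fun α β L σ Λ hα hβ hL _ _ => ?_⟩
  have hE := LiebLoss.ELLLoc_ne_top (σ := σ) (Λ := Λ) hL hα.le
  have hF := LiebLoss.auxFLoc_ne_top hL hβ.le
  have hE' := LiebLoss.ELL_le_ELLLoc L α σ Λ
  have hF' := LiebLoss.auxF_le_auxFLoc L β
  have e : (C₁ + C₂) / L ^ 2 = C₁ / L ^ 2 + C₂ / L ^ 2 := add_div _ _ _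
  have p₁ : 0 ≤ C₁ / L ^ 2 := by positivity
  have p₂ : 0 ≤ C₂ / L ^ 2 := by positivity
  have g₁ := h₁ L α σ Λ hL hα.le
  have g₂ := h₂ β L hβ hL
  refine ⟨⟨ne_top_of_le_ne_top hE hE', hE, by linarith, ENNReal.toReal_mono hE hE'⟩,
    ne_top_of_le_ne_top hF hF', hF, by linarith, ENNReal.toReal_mono hF hF'⟩
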